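/- Let $\Im=\mathbb R\times\mathbb S^2$ with points $(u,s)$ and measure $du\,d\mu_{\mathbb S^2}$ ($d\mu_{\mathbb S^2}$ the standard measure of total mass $4\pi$), and let $\mathcal S(\Im)$ be the real vector space of real $\psi\in C^\infty(\Im)$ with $\psi,\partial_u\psi\in L^2(\Im)$, with the symplectic form $\sigma(\psi,\psi')=\int_\Im(\psi\,\partial_u\psi'-\psi'\,\partial_u\psi)\,du\,d\mu_{\mathbb S^2}$. Let $\mathcal A(\Im)$ be the unital complex $*$-algebra obtained from the tensor algebra $\mathbb C\otimes\bigoplus_n\mathcal S(\Im)^{\otimes n}$ by dividing out the two-sided $*$-ideal generated by the elements $\psi\otimes\psi'-\psi'\otimes\psi-i\sigma(\psi,\psi')\mathbb I$; its generators $[\psi]$ are self-adjoint. The BMS group $G_{BMS}$ consists of the transformations $\gamma=(\Lambda,f)$ of $\Im$, $(u,\zeta)\mapsto\big(K_\Lambda(\zeta)(u+f(\zeta)),\tfrac{a\zeta+b}{c\zeta+d}\big)$, where $\zeta=e^{i\varphi}\cot(\theta/2)$ is the complex coordinate on $\mathbb S^2\cong\mathbb C\cup\{\infty\}$, $f\in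 C^\infty(\mathbb S^2)$, $\Lambda\in SO(3,1)_\uparrow$ is the image of $\begin{pmatrix}a&b\\c&d\end{pmatrix}\in SL(2,\mathbb C)$, and $K_\Lambda(\zeta)=\frac{1+|\zeta|^2}{|a\zeta+b|^2+|c\zeta+d|^2}$ (extended continuously to $\zeta=\infty$). There is a unique representation $\alpha$ of $G_{BMS}$ by $*$-automorphisms of $\mathcal A(\Im)$ with $\alpha_\gamma[\psi]=[A_\gamma\psi]$, $(A_\gamma\psi)(p)=K_\Lambda(\gamma^{-1}p)^{-1}\psi(\gamma^{-1}p)$ (in particular $A_\gamma\psi\in\mathcal S(\Im)$). Here $K_\Lambda(q)$ means $K_\Lambda$ at the $\mathbb S^2$-component of $q$. The Bondi frames are the coordinate systems $(u',s')=\gamma(u,s)$ with $\gamma\in G_{BMS}$; $\{\alpha_t\}_{t\in\mathbb R}$ denotes the restriction of $\alpha$ to the flow of $\partial_{u'}$, that is, to $\gamma^{-1}T_t\gamma$ with $T_t(u,s)=(u+t,s)$. A state on $\mathcal A(\Im)$ is a normalized positive linear functional. It is quasi-free if its odd $n$-point functions $\omega([\psi_1]\cdots[\psi_n])$ vanish and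 the even ones are the sums over all partitions of $\{1,\dots,n\}$ into pairs $i<j$ of the products of the two-point functions $\omega([\psi_i][\psi_j])$. Let $\widehat\psi(k,s)=(2\pi)^{-1/2}\int_{\mathbb R}e^{iku}\psi(u,s)\,du$ be the Fourier-Plancherel transform. There is a unique quasi-free state $\omega_\Im$ on $\mathcal A(\Im)$ with two-point function $$\omega_\Im([\psi][\psi'])=\mathrm{Re}\int_{\mathbb R^+\times\mathbb S^2}2k\,\overline{\widehat\psi(k,s)}\,\widehat\psi'(k,s)\,dk\,d\mu_{\mathbb S^2}(s)+\frac i2\sigma(\psi,\psi').$$ Theorem. (a) $\omega_\Im$ is invariant under $\alpha_\gamma$ for all $\gamma\in G_{BMS}$; and in the GNS representation $(\mathcal H,\mathcal D,\pi,\Omega)$ of $\omega_\Im$ there is a unique unitary representation $V$ of $G_{BMS}$ with $V_\gamma\Omega=\Omega$, $V_\gamma\mathcal D=\mathcal D$ and $V_\gamma\pi(a)V_\gamma^{-1}=\pi(\alpha_\gamma(a))$ on $\mathcal D$ for all $a\in\mathcal A(\Im)$. (b) For every Bondi frame, the unique family of unitaries $U_t$ that implements $\{\alpha_t\}$ in the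 GNS representation of $\omega_\Im$ and fixes the cyclic vector is a strongly continuous one-parameter group $U_t=e^{ith}$ with self-adjoint generator $h\ge 0$. (c) Fix any Bondi frame. Then $\omega_\Im$ is the unique quasi-free state $\omega$ on $\mathcal A(\Im)$ such that, in the GNS representation $(\mathcal H,\mathcal D,\pi,\Omega)$ of $\omega$, $\{\alpha_t\}$ is implemented, with $\Omega$ fixed, by a strongly continuous one-parameter unitary group $U_t=e^{ith}$ with self-adjoint generator $h\ge0$ which has no zero eigenvalue on the one-particle space $\overline{\mathrm{span}_{\mathbb C}\{\pi([\psi])\Omega:\psi\in\mathcal S(\Im)\}}$. -/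

import Mathlib

open MeasureTheory Filter Topology
open scoped Manifold ContDiff TensorProduct InnerProductSpace FourierTransform Matrix

noncomputable section

namespace NullInfinity

abbrev E3 : Type := EuclideanSpace ℝ (Fin 3)

/-- The unit sphere `𝕊²` in `ℝ³`. -/
abbrev S2 : Type := Metric.sphere (0 : E3) 1

instance factFinrankE3 : Fact (Module.finrank ℝ E3 = 2 + 1) := ⟨by simp⟩

/-- The standard rotation invariant surface measure on `𝕊²` (total mass `4π`). -/
def sphereMeasure : Measure S2 := (volume : Measure E3).toSphere

/-- `ℑ = ℝ × 𝕊²`, with points `(u, s)`. -/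
abbrev Scri : Type := ℝ × S2

/-- The measure `du dμ_{𝕊²}` on `ℑ`. -/
def scriMeasure : Measure Scri := (volume : Measure ℝ).prod sphereMeasure

/-! ### The action of `SL(2, ℂ)` on the sphere -/

abbrev SL2C : Type := Matrix.SpecialLinearGroup (Fin 2) ℂ

abbrev SmoothS2 : Type := C^∞⟮𝓡 2, S2; 𝓘(ℝ, ℝ), ℝ⟯

/-- For a unit vector `v = (x, y, z)` with `ζ = (x + i y) / (1 - z)` this is the rank one projector
`(1 + |ζ|²)⁻¹ (ζ, 1)ᵀ (ζ̄, 1)`, written so that it makes sense at `ζ = ∞` too. -/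
def spinProj (v : E3) : Matrix (Fin 2) (Fin 2) ℂ :=
  !![(1 + (v 2 : ℂ)) / 2, ((v 0 : ℂ) + Complex.I * (v 1 : ℂ)) / 2;
     ((v 0 : ℂ) - Complex.I * (v 1 : ℂ)) / 2, (1 - (v 2 : ℂ)) / 2]

/-- The vector part of a Hermitian `2 × 2` matrix. -/
def vecPart (M : Matrix (Fin 2) (Fin 2) ℂ) : E3 :=
  !₂[2 * (M 0 1).re, 2 * (M 0 1).im, (M 0 0).re - (M 1 1).re]

/-- `A X(v) A†` -/
def spinConj (A : SL2C) (v : E3) : Matrix (Fin 2) (Fin 2) ℂ :=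
  A.1 * spinProj v * A.1ᴴ

/-- The trace of `A X(v) A†`; in the coordinate `ζ` it is
`(|aζ + b|² + |cζ + d|²) / (1 + |ζ|²)`. -/
def dilation (A : SL2C) (v : E3) : ℝ := (spinConj A v).trace.re

/-- The conformal factor `K_A(s) = (1 + |ζ|²) / (|aζ + b|² + |cζ + d|²)`. -/
def confFactor (A : SL2C) (s : S2) : ℝ := (dilation A s)⁻¹

theorem norm_sq_coords (v : E3) : ‖v‖ ^ 2 = v 0 ^ 2 + v 1 ^ 2 + v 2 ^ 2 := by
  rw [EuclideanSpace.norm_sq_eq]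
  simp [Fin.sum_univ_three]

theorem S2_coords (s : S2) : s.1 0 ^ 2 + s.1 1 ^ 2 + s.1 2 ^ 2 = 1 := by
  rw [← norm_sq_coords, norm_eq_of_mem_sphere]; norm_num

theorem S2_coords_complex (s : S2) :
    (s.1 0 : ℂ) ^ 2 + (s.1 1 : ℂ) ^ 2 + (s.1 2 : ℂ) ^ 2 = 1 := by
  have h := congrArg (fun r : ℝ => (r : ℂ)) (S2_coords s)
  simpa using h

theorem spinProj_isHermitian (v : E3) : (spinProj v).IsHermitian := by
  ext i j
  fin_cases i <;> fin_cases j <;> simp [spinProj] <;> ring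

theorem spinProj_sq (s : S2) : spinProj s * spinProj s = spinProj s := by
  have h := S2_coords_complex s
  ext i j
  fin_cases i <;> fin_cases j <;>
    simp [spinProj, Matrix.mul_apply, Fin.sum_univ_two] <;>
    first
    | linear_combination (1 / 4) * h - (1 / 4) * (s.1 1 : ℂ) ^ 2 * Complex.I_sq
    | ring

theorem spinProj_trace (v : E3) : (spinProj v).trace = 1 := by
  simp [spinProj, Matrix.trace, Fin.sum_univ_two]; ring

theorem spinProj_det (s : S2) : (spinProj s).det = 0 := by
  have h := S2_coords_complex s
  simp [spinProj, Matrix.det_fin_two]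
  linear_combination -(1 / 4) * h + (1 / 4) * (s.1 1 : ℂ) ^ 2 * Complex.I_sq

theorem spinConj_isHermitian (A : SL2C) (v : E3) : (spinConj A v).IsHermitian :=
  Matrix.isHermitian_mul_mul_conjTranspose _ (spinProj_isHermitian v)

theorem spinConj_trace (A : SL2C) (v : E3) : (spinConj A v).trace = (dilation A v : ℂ) := by
  have h := congrArg Matrix.trace (spinConj_isHermitian A v)
  rw [Matrix.trace_conjTranspose] at h
  exact (Complex.conj_eq_iff_re.mp h).symm

theorem spinConj_det (A : SL2C) (s : S2) : (spinConj A s).det = 0 := by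
  simp [spinConj, Matrix.det_mul, spinProj_det]

theorem dilation_pos (A : SL2C) (s : S2) : 0 < dilation A s := by
  have h1 : spinConj A s = (A.1 * spinProj s) * (A.1 * spinProj s)ᴴ := by
    rw [Matrix.conjTranspose_mul, (spinProj_isHermitian s).eq, spinConj, ← Matrix.mul_assoc,
      Matrix.mul_assoc A.1 (spinProj s) (spinProj s), spinProj_sq]
  have h2 : dilation A s ≠ 0 := by
    intro h
    have h3 := spinConj_trace A s
    rw [h, h1, Complex.ofReal_zero] at h3
    open scoped ComplexOrder in
    rw [Matrix.trace_mul_conjTranspose_self_eq_zero_iff] at h3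
    have h4 : spinProj s.1 = A⁻¹.1 * (A.1 * spinProj s) := by
      rw [← Matrix.mul_assoc, ← Matrix.SpecialLinearGroup.coe_mul, inv_mul_cancel]; simp
    have h5 := spinProj_trace s.1
    rw [h4, h3] at h5
    simp at h5
  have h6 : 0 ≤ dilation A s := by
    rw [dilation, h1]
    simp only [Matrix.trace, Matrix.diag_apply, Fin.sum_univ_two, Matrix.mul_apply (M := A.1 * _),
      Matrix.conjTranspose_apply, Complex.add_re, RCLike.star_def, Complex.mul_conj,
      Complex.ofReal_re]
    linarith [Complex.normSq_nonneg ((A.1 * spinProj s) 0 0),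
      Complex.normSq_nonneg ((A.1 * spinProj s) 0 1),
      Complex.normSq_nonneg ((A.1 * spinProj s) 1 0),
      Complex.normSq_nonneg ((A.1 * spinProj s) 1 1)]
  exact lt_of_le_of_ne h6 (Ne.symm h2)

theorem confFactor_pos (A : SL2C) (s : S2) : 0 < confFactor A s := inv_pos.2 (dilation_pos A s)

/-- A Hermitian matrix is recovered from its trace and its vector part. -/
theorem eq_smul_spinProj {M : Matrix (Fin 2) (Fin 2) ℂ} (hM : M.IsHermitian) {t : ℝ}
    (ht : M.trace = t) (h0 : t ≠ 0) : M = (t : ℂ) • spinProj (t⁻¹ • vecPart M) := by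
  have h00 : ((M 0 0).re : ℂ) = M 0 0 := hM.coe_re_apply_self 0
  have h11 : ((M 1 1).re : ℂ) = M 1 1 := hM.coe_re_apply_self 1
  have h10 : M 1 0 = (starRingEnd ℂ) (M 0 1) := (hM.apply 1 0).symm
  have h01 : ((M 0 1).re : ℂ) + (M 0 1).im * Complex.I = M 0 1 := Complex.re_add_im _
  have h01' : ((M 0 1).re : ℂ) - (M 0 1).im * Complex.I = M 1 0 := by
    rw [h10]; apply Complex.ext <;> simp
  have htr : M 0 0 + M 1 1 = t := by rw [← ht, Matrix.trace_fin_two]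
  have h0' : (t : ℂ) ≠ 0 := by exact_mod_cast h0
  ext i j
  fin_cases i <;> fin_cases j <;> simp [spinProj, vecPart] <;> field_simp
  · rw [h00, h11]; linear_combination htr
  · linear_combination - h01
  · linear_combination - h01'
  · rw [h00, h11]; linear_combination htr

theorem spinConj_eq (A : SL2C) (s : S2) : spinConj A s =
    (dilation A s : ℂ) • spinProj ((dilation A s)⁻¹ • vecPart (spinConj A s)) :=
  eq_smul_spinProj (spinConj_isHermitian A s) (spinConj_trace A s) (dilation_pos A s).ne'

theorem norm_sq_eq_one_of_det {v : E3} (h : (spinProj v).det = 0) : ‖v‖ = 1 := by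
  have h1 : ((v 0 : ℂ)) ^ 2 + (v 1 : ℂ) ^ 2 + (v 2 : ℂ) ^ 2 = 1 := by
    simp [spinProj, Matrix.det_fin_two] at h
    linear_combination -4 * h + (v 1 : ℂ) ^ 2 * Complex.I_sq
  have h2 : ‖v‖ ^ 2 = 1 := by rw [norm_sq_coords]; exact_mod_cast h1
  nlinarith [norm_nonneg v]

theorem sphereAct_mem (A : SL2C) (s : S2) :
    (dilation A s)⁻¹ • vecPart (spinConj A s) ∈ Metric.sphere (0 : E3) 1 := by
  rw [mem_sphere_zero_iff_norm]
  apply norm_sq_eq_one_of_det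
  have h := spinConj_det A s
  rw [spinConj_eq, Matrix.det_smul] at h
  have h0 : (dilation A s : ℂ) ≠ 0 := by exact_mod_cast (dilation_pos A s).ne'
  simpa [h0] using h

/-- The action `ζ ↦ (aζ + b) / (cζ + d)` of `SL(2, ℂ)` on the sphere: the projector
of the image point is proportional to `A X(s) A†`. -/
def sphereAct (A : SL2C) (s : S2) : S2 :=
  ⟨(dilation A s)⁻¹ • vecPart (spinConj A s), sphereAct_mem A s⟩

theorem spinProj_injective : Function.Injective spinProj := by
  intro v w h
  have h00 := congrFun (congrFun h 0) 0
  have h01 := congrFun (congrFun h 0) 1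
  simp [spinProj] at h00 h01
  have h2 := congrArg Complex.re h01
  have h3 := congrArg Complex.im h01
  simp at h2 h3
  ext i
  fin_cases i
  · exact h2
  · exact h3
  · exact h00

theorem spinConj_eq' (A : SL2C) (s : S2) :
    spinConj A s = (dilation A s : ℂ) • spinProj (sphereAct A s) := spinConj_eq A s

theorem spinConj_mul (A B : SL2C) (s : S2) :
    spinConj (A * B) s = (dilation B s : ℂ) • spinConj A (sphereAct B s) := by
  have : spinConj (A * B) s = A.1 * spinConj B s * A.1ᴴ := by
    simp [spinConj, Matrix.mul_assoc]
  rw [this, spinConj_eq']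
  simp [spinConj]

theorem dilation_mul (A B : SL2C) (s : S2) :
    dilation (A * B) s = dilation A (sphereAct B s) * dilation B s := by
  rw [dilation, spinConj_mul, Matrix.trace_smul, spinConj_trace, smul_eq_mul, ← Complex.ofReal_mul,
    Complex.ofReal_re, mul_comm]

theorem dilation_one (v : E3) : dilation 1 v = 1 := by
  simp [dilation, spinConj, spinProj_trace]

theorem sphereAct_one (s : S2) : sphereAct 1 s = s := by
  apply Subtype.ext
  apply spinProj_injective
  have h := spinConj_eq' 1 s
  rw [dilation_one] at h
  simpa [spinConj] using h.symm

theorem sphereAct_mul (A B : SL2C) (s : S2) :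
    sphereAct (A * B) s = sphereAct A (sphereAct B s) := by
  apply Subtype.ext
  apply spinProj_injective
  have h := spinConj_eq' (A * B) s
  rw [spinConj_mul, spinConj_eq', dilation_mul, smul_smul, ← Complex.ofReal_mul,
    mul_comm (dilation B s)] at h
  have h0 : ((dilation A (sphereAct B s) * dilation B s : ℝ) : ℂ) ≠ 0 := by
    exact_mod_cast (mul_pos (dilation_pos _ _) (dilation_pos _ _)).ne'
  exact (smul_right_injective _ h0 h).symm

theorem contDiff_spinConj (A : SL2C) (i j : Fin 2) :
    ContDiff ℝ ∞ (fun v : E3 => spinConj A v i j) := by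
  have hc : ∀ k, ContDiff ℝ ∞ (fun v : E3 => ((v k : ℝ) : ℂ)) := fun k =>
    Complex.ofRealCLM.contDiff.comp (EuclideanSpace.proj k : E3 →L[ℝ] ℝ).contDiff
  have h : ∀ k l, ContDiff ℝ ∞ (fun v : E3 => spinProj v k l) := by
    intro k l
    have := hc 0
    have := hc 1
    have := hc 2
    fin_cases k <;> fin_cases l <;> simp [spinProj] <;> fun_prop
  simp only [spinConj, Matrix.mul_apply, Fin.sum_univ_two]
  have := h 0 0
  have := h 0 1
  have := h 1 0
  have := h 1 1
  fun_prop

theorem contDiff_dilation (A : SL2C) : ContDiff ℝ ∞ (dilation A) := by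
  have h : dilation A = fun v => (spinConj A v 0 0).re + (spinConj A v 1 1).re := by
    funext v; simp [dilation, Matrix.trace_fin_two]
  rw [h]
  exact (Complex.reCLM.contDiff.comp (contDiff_spinConj A 0 0)).add
    (Complex.reCLM.contDiff.comp (contDiff_spinConj A 1 1))

theorem contMDiff_dilation (A : SL2C) :
    ContMDiff (𝓡 2) 𝓘(ℝ, ℝ) ∞ (fun s : S2 => dilation A s) :=
  (contDiff_dilation A).contMDiff.comp contMDiff_coe_sphere

theorem contMDiff_sphereAct (A : SL2C) : ContMDiff (𝓡 2) (𝓡 2) ∞ (sphereAct A) := by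
  have h1 : ContDiff ℝ ∞ (fun v : E3 => vecPart (spinConj A v)) := by
    rw [contDiff_euclidean]
    intro i
    have h01 := contDiff_spinConj A 0 1
    have h00 := contDiff_spinConj A 0 0
    have h11 := contDiff_spinConj A 1 1
    fin_cases i
    · exact contDiff_const.mul (Complex.reCLM.contDiff.comp h01)
    · exact contDiff_const.mul (Complex.imCLM.contDiff.comp h01)
    · exact (Complex.reCLM.contDiff.comp h00).sub (Complex.reCLM.contDiff.comp h11)
  have h2 : ContMDiff (𝓡 2) 𝓘(ℝ, E3) ∞
      (fun s : S2 => (dilation A s)⁻¹ • vecPart (spinConj A s)) :=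
    ((contMDiff_dilation A).inv₀ (fun s => (dilation_pos A s).ne')).smul
      (h1.contMDiff.comp contMDiff_coe_sphere)
  exact h2.codRestrict_sphere (sphereAct_mem A)

/-! In the complex coordinate `ζ`, the formulas take their usual form. -/

/-- The complex coordinate `ζ = e^{iφ} cot(θ/2)` of a point of the sphere off the north pole. -/
def zeta (s : S2) : ℂ := ((s.1 0 : ℂ) + Complex.I * (s.1 1 : ℂ)) / (1 - (s.1 2 : ℂ))

theorem spinConj_zeta (A : SL2C) (s : S2) (hs : s.1 2 ≠ 1) (i j : Fin 2) :
    spinConj A s i j = (1 - (s.1 2 : ℂ)) / 2 *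
      ((A.1 i 0 * zeta s + A.1 i 1) *
        (starRingEnd ℂ) (A.1 j 0 * zeta s + A.1 j 1)) := by
  have h1 : (1 - (s.1 2 : ℂ)) ≠ 0 := by
    rw [sub_ne_zero]; exact_mod_cast hs.symm
  have h := S2_coords_complex s
  have hz : (starRingEnd ℂ) (zeta s) =
      ((s.1 0 : ℂ) - Complex.I * (s.1 1 : ℂ)) / (1 - (s.1 2 : ℂ)) := by
    simp [zeta, sub_eq_add_neg]
  have e1 : (s.1 0 : ℂ) + Complex.I * (s.1 1 : ℂ) = (1 - (s.1 2 : ℂ)) * zeta s := by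
    rw [zeta]; field_simp
  have e2 : (s.1 0 : ℂ) - Complex.I * (s.1 1 : ℂ) =
      (1 - (s.1 2 : ℂ)) * (starRingEnd ℂ) (zeta s) := by
    rw [hz]; field_simp
  have e3 : 1 + (s.1 2 : ℂ) = (1 - (s.1 2 : ℂ)) * (zeta s * (starRingEnd ℂ) (zeta s)) := by
    apply mul_left_cancel₀ h1
    linear_combination -h + (s.1 1 : ℂ) ^ 2 * Complex.I_sq +
      ((s.1 0 : ℂ) - Complex.I * (s.1 1 : ℂ)) * e1 + (1 - (s.1 2 : ℂ)) * zeta s * e2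
  simp only [spinConj, spinProj, Matrix.mul_apply, Fin.sum_univ_two, Matrix.conjTranspose_apply,
    Matrix.of_apply, Matrix.cons_val', Matrix.cons_val_zero, Matrix.cons_val_one,
    Matrix.cons_val_fin_one, map_add, map_mul, RCLike.star_def]
  rw [e1, e2, e3]
  ring

/-- Away from `ζ = ∞`, `K_A = (1 + ζζ̄) / (|aζ + b|² + |cζ + d|²)`. -/
theorem confFactor_eq_zeta (A : SL2C) (s : S2) (hs : s.1 2 ≠ 1) :
    confFactor A s = (1 + ‖zeta s‖ ^ 2) /
      (‖A.1 0 0 * zeta s + A.1 0 1‖ ^ 2 + ‖A.1 1 0 * zeta s + A.1 1 1‖ ^ 2) := by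
  have h1 : 1 - s.1 2 ≠ 0 := sub_ne_zero.2 hs.symm
  have key : ∀ B : SL2C, dilation B s = (1 - s.1 2) / 2 *
      (‖B.1 0 0 * zeta s + B.1 0 1‖ ^ 2 + ‖B.1 1 0 * zeta s + B.1 1 1‖ ^ 2) := by
    intro B
    apply Complex.ofReal_injective
    rw [← spinConj_trace, Matrix.trace_fin_two, spinConj_zeta B s hs, spinConj_zeta B s hs,
      Complex.mul_conj, Complex.mul_conj, Complex.normSq_eq_norm_sq, Complex.normSq_eq_norm_sq]
    push_cast
    ring
  have hone : (1 - s.1 2) / 2 * (1 + ‖zeta s‖ ^ 2) = 1 := by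
    have := key 1
    rw [dilation_one] at this
    simp at this
    linarith
  have hd := dilation_pos A s
  rw [confFactor, key A] at *
  have h2 : ‖A.1 0 0 * zeta s + A.1 0 1‖ ^ 2 + ‖A.1 1 0 * zeta s + A.1 1 1‖ ^ 2 ≠ 0 :=
    fun h0 => by rw [h0] at hd; simp at hd
  rw [eq_div_iff h2, mul_inv, mul_assoc, inv_mul_cancel₀ h2, mul_one]
  exact inv_eq_of_mul_eq_one_right hone

theorem zeta_eq_div (s : S2) : zeta s = spinProj s 0 1 / spinProj s 1 1 := by
  simp only [zeta, spinProj, Matrix.of_apply, Matrix.cons_val', Matrix.cons_val_zero,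
    Matrix.cons_val_one, Matrix.cons_val_fin_one]
  rw [div_div_div_cancel_right₀ two_ne_zero]

/-- Away from `ζ = ∞`, the point `s` with coordinate `ζ` is mapped to the point with coordinate
`(aζ + b) / (cζ + d)`. -/
theorem zeta_sphereAct (A : SL2C) (s : S2) (hs : s.1 2 ≠ 1)
    (hA : A.1 1 0 * zeta s + A.1 1 1 ≠ 0) :
    zeta (sphereAct A s) = (A.1 0 0 * zeta s + A.1 0 1) / (A.1 1 0 * zeta s + A.1 1 1) := by
  have h0 : (dilation A s : ℂ) ≠ 0 := by
    exact_mod_cast (dilation_pos A s).ne'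
  have h1 : (1 - (s.1 2 : ℂ)) / 2 ≠ 0 := by
    apply div_ne_zero _ two_ne_zero
    rw [sub_ne_zero]; exact_mod_cast hs.symm
  have h2 : (starRingEnd ℂ) (A.1 1 0 * zeta s + A.1 1 1) ≠ 0 :=
    (map_ne_zero _).2 hA
  have h3 : spinProj (sphereAct A s) = (dilation A s : ℂ)⁻¹ • spinConj A s := by
    rw [spinConj_eq', smul_smul, inv_mul_cancel₀ h0, one_smul]
  rw [zeta_eq_div, h3, Matrix.smul_apply, Matrix.smul_apply, smul_eq_mul, smul_eq_mul,
    mul_div_mul_left _ _ (inv_ne_zero h0), spinConj_zeta A s hs, spinConj_zeta A s hs,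
    mul_div_mul_left _ _ h1, mul_div_mul_right _ _ h2]

/-! ### The Bondi-Metzner-Sachs group -/

theorem confFactor_mul (A B : SL2C) (s : S2) :
    confFactor (A * B) s = confFactor A (sphereAct B s) * confFactor B s := by
  rw [confFactor, dilation_mul, mul_inv]; rfl

theorem confFactor_one (s : S2) : confFactor 1 s = 1 := by
  rw [confFactor, dilation_one, inv_one]

theorem confFactor_inv (A : SL2C) (s : S2) :
    confFactor A (sphereAct A⁻¹ s) * confFactor A⁻¹ s = 1 := by
  rw [← confFactor_mul, mul_inv_cancel, confFactor_one]

theorem confFactor_inv' (A : SL2C) (s : S2) :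
    confFactor A⁻¹ (sphereAct A s) * confFactor A s = 1 := by
  rw [← confFactor_mul, inv_mul_cancel, confFactor_one]

/-- The transformation `(u, s) ↦ (K_A(s) (u + f(s)), A s)` of `ℑ`. -/
def bmsPerm (A : SL2C) (f : SmoothS2) : Equiv.Perm Scri where
  toFun p := (confFactor A p.2 * (p.1 + f p.2), sphereAct A p.2)
  invFun q := (confFactor A⁻¹ q.2 * q.1 - f (sphereAct A⁻¹ q.2), sphereAct A⁻¹ q.2)
  left_inv := by
    rintro ⟨u, s⟩
    have h : sphereAct A⁻¹ (sphereAct A s) = s := by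
      rw [← sphereAct_mul, inv_mul_cancel, sphereAct_one]
    apply Prod.ext
    · simp only [h, ← mul_assoc, confFactor_inv', one_mul, add_sub_cancel_right]
    · exact h
  right_inv := by
    rintro ⟨u, s⟩
    have h : sphereAct A (sphereAct A⁻¹ s) = s := by
      rw [← sphereAct_mul, mul_inv_cancel, sphereAct_one]
    apply Prod.ext
    · simp only [sub_add_cancel, ← mul_assoc, confFactor_inv, one_mul]
    · exact h

/-- The function `s ↦ K_A(s)⁻¹ f(A s)`. -/
def pullWeight (A : SL2C) (f : SmoothS2) : SmoothS2 :=
  ⟨fun s => dilation A s * f (sphereAct A s),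
    (contMDiff_dilation A).mul (f.contMDiff.comp (contMDiff_sphereAct A))⟩

theorem bmsPerm_mul (A B : SL2C) (f g : SmoothS2) :
    bmsPerm A f * bmsPerm B g = bmsPerm (A * B) (g + pullWeight B f) := by
  ext1 ⟨u, s⟩
  have hd := (dilation_pos B s).ne'
  apply Prod.ext
  · change confFactor A (sphereAct B s) * (confFactor B s * (u + g s) + f (sphereAct B s)) =
      confFactor (A * B) s * (u + (g s + dilation B s * f (sphereAct B s)))
    rw [confFactor_mul, confFactor, confFactor]
    field_simp
    ring
  · exact (sphereAct_mul A B s).symm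

theorem bmsPerm_one : bmsPerm 1 0 = 1 := by
  ext1 ⟨u, s⟩
  apply Prod.ext
  · change confFactor 1 s * (u + (0 : SmoothS2) s) = u
    simp [confFactor_one]
  · exact sphereAct_one s

/-- The BMS group: the transformations `(u, s) ↦ (K_Λ(s) (u + f(s)), Λ s)` of `ℑ`, where
`f ∈ C^∞(𝕊²)` and `Λ` is a proper orthochronous Lorentz transformation,
acting through either of its two preimages in `SL(2, ℂ)`. -/
def BMSGroup : Subgroup (Equiv.Perm Scri) where
  carrier := {γ | ∃ (A : SL2C) (f : SmoothS2), γ = bmsPerm A f}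
  mul_mem' := by
    rintro _ _ ⟨A, f, rfl⟩ ⟨B, g, rfl⟩
    exact ⟨_, _, bmsPerm_mul A B f g⟩
  one_mem' := ⟨1, 0, bmsPerm_one.symm⟩
  inv_mem' := by
    rintro _ ⟨A, f, rfl⟩
    refine ⟨A⁻¹, -pullWeight A⁻¹ f, ?_⟩
    rw [inv_eq_iff_mul_eq_one, bmsPerm_mul, mul_inv_cancel, neg_add_cancel, bmsPerm_one]

/-- The element of the BMS group given by `A ∈ SL(2, ℂ)` and `f ∈ C^∞(𝕊²)`. -/
def bms (A : SL2C) (f : SmoothS2) : BMSGroup := ⟨bmsPerm A f, A, f, rfl⟩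

/-- The translation `(u, s) ↦ (u + t, s)`; these form the flow of `∂_u`. -/
def uTranslation (t : ℝ) : BMSGroup := bms 1 (ContMDiffMap.const t)

/-- The flow `(u', s') ↦ (u' + t, s')` of `∂_{u'}` for the Bondi frame `(u', s') = γ(u, s)`. All
Bondi frames are of this form with `γ` in the BMS group. -/
def frameTranslation (γ : BMSGroup) (t : ℝ) : BMSGroup := γ⁻¹ * uTranslation t * γ

/-! ### The symplectic space -/

def uDeriv (ψ : Scri → ℝ) (p : Scri) : ℝ := deriv (fun u => ψ (u, p.2)) p.1

def SmoothScri (ψ : Scri → ℝ) : Prop := ContMDiff (𝓘(ℝ, ℝ).prod (𝓡 2)) 𝓘(ℝ, ℝ) ∞ ψ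

theorem SmoothScri.differentiableAt {ψ : Scri → ℝ} (h : SmoothScri ψ) (p : Scri) :
    DifferentiableAt ℝ (fun u => ψ (u, p.2)) p.1 := by
  have h1 : ContMDiff 𝓘(ℝ, ℝ) 𝓘(ℝ, ℝ) ∞ (fun u : ℝ => ψ (u, p.2)) :=
    ContMDiff.comp h (contMDiff_id.prodMk contMDiff_const)
  exact (contMDiff_iff_contDiff.1 h1).differentiable (by simp) _

/-- The real vector space `{ψ ∈ C^∞(ℑ) : ψ, ∂_uψ ∈ L²(ℑ)}`. -/
def bdrySpace : Submodule ℝ (Scri → ℝ) where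
  carrier := {ψ | SmoothScri ψ ∧ MemLp ψ 2 scriMeasure ∧ MemLp (uDeriv ψ) 2 scriMeasure}
  zero_mem' := by
    refine ⟨contMDiff_const, MemLp.zero, ?_⟩
    have : uDeriv 0 = 0 := by funext p; simp [uDeriv]
    rw [this]; exact MemLp.zero
  add_mem' := by
    rintro ψ φ ⟨h1, h2, h3⟩ ⟨k1, k2, k3⟩
    refine ⟨ContMDiff.add h1 k1, h2.add k2, ?_⟩
    have : uDeriv (ψ + φ) = uDeriv ψ + uDeriv φ := by
      funext p; exact deriv_add (h1.differentiableAt p) (k1.differentiableAt p)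
    rw [this]; exact h3.add k3
  smul_mem' := by
    rintro c ψ ⟨h1, h2, h3⟩
    refine ⟨contMDiff_const.mul h1, h2.const_smul c, ?_⟩
    have : uDeriv (c • ψ) = c • uDeriv ψ := by
      funext p; exact deriv_const_smul c (h1.differentiableAt p)
    rw [this]; exact h3.const_smul c

/-- The symplectic form `∫ (ψ ∂_uψ' - ψ' ∂_uψ) du dμ_{𝕊²}`. -/
def bdrySymp (ψ φ : bdrySpace) : ℝ :=
  ∫ p, (ψ.1 p * uDeriv φ.1 p - φ.1 p * uDeriv ψ.1 p) ∂scriMeasure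

theorem bdrySymp_swap (ψ φ : bdrySpace) : bdrySymp φ ψ = -bdrySymp ψ φ := by
  rw [bdrySymp, bdrySymp, ← integral_neg]
  congr 1; funext p; ring

/-! ### The boundary algebra -/

section TensorStar

variable (V : Type*) [AddCommGroup V] [Module ℝ V]

/-- Reversal `v₁ ⊗ ⋯ ⊗ vₙ ↦ vₙ ⊗ ⋯ ⊗ v₁` of the real tensor algebra. -/
def tensorRev : TensorAlgebra ℝ V →ₐ[ℝ] (TensorAlgebra ℝ V)ᵐᵒᵖ :=
  TensorAlgebra.lift ℝ
    ((MulOpposite.opLinearEquiv ℝ).toLinearMap ∘ₗ TensorAlgebra.ι ℝ)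

theorem tensorRev_ι (v : V) :
    tensorRev V (TensorAlgebra.ι ℝ v) = MulOpposite.op (TensorAlgebra.ι ℝ v) := by
  simp [tensorRev]

theorem tensorRev_tensorRev (x : TensorAlgebra ℝ V) :
    (tensorRev V (tensorRev V x).unop).unop = x := by
  induction x using TensorAlgebra.induction with
  | algebraMap r => simp
  | ι v => simp [tensorRev_ι]
  | mul a b ha hb => simp [ha, hb]
  | add a b ha hb => simp [ha, hb]

instance tensorStarRing : StarRing (TensorAlgebra ℝ V) where
  star x := (tensorRev V x).unop
  star_involutive := tensorRev_tensorRev V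
  star_mul a b := by
    change (tensorRev V (a * b)).unop = (tensorRev V b).unop * (tensorRev V a).unop
    simp
  star_add a b := by
    change (tensorRev V (a + b)).unop = (tensorRev V a).unop + (tensorRev V b).unop
    rw [map_add, MulOpposite.unop_add]

instance tensorStarModule : StarModule ℝ (TensorAlgebra ℝ V) where
  star_smul r x := by
    change (tensorRev V (r • x)).unop = r • (tensorRev V x).unop
    rw [map_smul, MulOpposite.unop_smul]

theorem star_tensor_ι (v : V) :
    star (TensorAlgebra.ι ℝ v) = (TensorAlgebra.ι ℝ v : TensorAlgebra ℝ V) := by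
  change (tensorRev V _).unop = _
  rw [tensorRev_ι, MulOpposite.unop_op]

end TensorStar

/-- The complex unital `*`-algebra `ℂ ⊗ ⨁ₙ S^{⊗n}`. -/
def BdryTensor : Type := ℂ ⊗[ℝ] TensorAlgebra ℝ bdrySpace

instance : Ring BdryTensor := inferInstanceAs (Ring (ℂ ⊗[ℝ] TensorAlgebra ℝ bdrySpace))
instance : Algebra ℂ BdryTensor :=
  inferInstanceAs (Algebra ℂ (ℂ ⊗[ℝ] TensorAlgebra ℝ bdrySpace))
instance : StarRing BdryTensor :=
  inferInstanceAs (StarRing (ℂ ⊗[ℝ] TensorAlgebra ℝ bdrySpace))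

/-- The element `1 ⊗ ψ` of the tensor algebra. -/
def tgen (ψ : bdrySpace) : BdryTensor :=
  (1 ⊗ₜ TensorAlgebra.ι ℝ ψ : ℂ ⊗[ℝ] TensorAlgebra ℝ bdrySpace)

/-- The canonical commutation relations `ψ ⊗ ψ' - ψ' ⊗ ψ = i σ(ψ, ψ') 𝟙`. -/
inductive CCR : BdryTensor → BdryTensor → Prop
  | comm (ψ φ : bdrySpace) :
      CCR (tgen ψ * tgen φ - tgen φ * tgen ψ)
        (algebraMap ℂ BdryTensor (Complex.I * (bdrySymp ψ φ : ℂ)))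

theorem star_tgen (ψ : bdrySpace) : star (tgen ψ) = tgen ψ := by
  change star (1 ⊗ₜ TensorAlgebra.ι ℝ ψ : ℂ ⊗[ℝ] TensorAlgebra ℝ bdrySpace) = _
  rw [TensorProduct.star_tmul, star_one, star_tensor_ι]
  rfl

theorem star_algebraMap_tensor (z : ℂ) :
    star (algebraMap ℂ BdryTensor z) = algebraMap ℂ BdryTensor (star z) := by
  change star (z ⊗ₜ 1 : ℂ ⊗[ℝ] TensorAlgebra ℝ bdrySpace) = star z ⊗ₜ 1
  rw [TensorProduct.star_tmul, star_one]

theorem CCR.star_closed (a b : BdryTensor) (h : CCR a b) : CCR (star a) (star b) := by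
  obtain ⟨ψ, φ⟩ := h
  have h : star (Complex.I * (bdrySymp ψ φ : ℂ)) = Complex.I * (bdrySymp φ ψ : ℂ) := by
    rw [bdrySymp_swap ψ φ]; simp
  rw [star_sub, star_mul, star_mul, star_tgen, star_tgen, star_algebraMap_tensor, h]
  exact CCR.comm φ ψ

/-- The boundary algebra: the quotient of the tensor algebra by the two-sided `*`-ideal generated
by the commutation relations. -/
def BdryAlgebra : Type := RingQuot CCR

instance : Ring BdryAlgebra := inferInstanceAs (Ring (RingQuot CCR))
instance : Algebra ℂ BdryAlgebra := inferInstanceAs (Algebra ℂ (RingQuot CCR))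
instance : StarRing BdryAlgebra := RingQuot.starRing CCR CCR.star_closed

/-- The quotient map. -/
def toBdryAlgebra : BdryTensor →ₐ[ℂ] BdryAlgebra := RingQuot.mkAlgHom ℂ CCR

theorem toBdryAlgebra_apply (x : BdryTensor) :
    toBdryAlgebra x = (⟨Quot.mk _ x⟩ : RingQuot CCR) := by
  change (RingQuot.mkAlgHom ℂ CCR : BdryTensor →+* RingQuot CCR) x = _
  rw [RingQuot.mkAlgHom_coe, RingQuot.mkRingHom_def]
  rfl

theorem star_toBdryAlgebra (x : BdryTensor) :
    star (toBdryAlgebra x) = toBdryAlgebra (star x) := by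
  rw [toBdryAlgebra_apply, toBdryAlgebra_apply]
  rfl

/-- The generator `[ψ]`. -/
def gen (ψ : bdrySpace) : BdryAlgebra := toBdryAlgebra (tgen ψ)

theorem star_gen (ψ : bdrySpace) : star (gen ψ) = gen ψ := by
  rw [gen, star_toBdryAlgebra, star_tgen]

theorem gen_comm (ψ φ : bdrySpace) : gen ψ * gen φ - gen φ * gen ψ =
    algebraMap ℂ BdryAlgebra (Complex.I * (bdrySymp ψ φ : ℂ)) := by
  have h := RingQuot.mkAlgHom_rel ℂ (CCR.comm ψ φ)
  change toBdryAlgebra _ = toBdryAlgebra _ at h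
  simpa [gen] using h

/-! ### States and their GNS representations -/

section States

variable {𝒜 : Type*} [Ring 𝒜] [Algebra ℂ 𝒜] [StarRing 𝒜]

/-- Normalized positive linear functionals. -/
structure IsState (w : 𝒜 →ₗ[ℂ] ℂ) : Prop where
  map_one : w 1 = 1
  nonneg : ∀ a, 0 ≤ (w (star a * a)).re ∧ (w (star a * a)).im = 0

/-- A GNS quadruple `(H, D, π, Ω)` of `w`. -/
structure GNS (w : 𝒜 →ₗ[ℂ] ℂ) (H : Type*) [NormedAddCommGroup H] [InnerProductSpace ℂ H] where
  D : Submodule ℂ H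
  dense : Dense (D : Set H)
  π : 𝒜 →ₐ[ℂ] Module.End ℂ D
  π_star : ∀ (a : 𝒜) (x y : D), inner ℂ (x : H) (π a y : H) = inner ℂ (π (star a) x : H) (y : H)
  Ω : D
  cyclic : ∀ x : D, ∃ a, π a Ω = x
  vev : ∀ a, w a = inner ℂ (Ω : H) (π a Ω : H)

variable {w : 𝒜 →ₗ[ℂ] ℂ} {H : Type*} [NormedAddCommGroup H] [InnerProductSpace ℂ H]

/-- The unitary operator `V` implements the automorphism `β` in the GNS representation and fixes
the cyclic vector: `V Ω = Ω`, `V D = D` and `V π(a) V⁻¹ = π(β a)` on `D`. -/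
structure GNS.Implements (G : GNS w H) (β : 𝒜 ≃⋆ₐ[ℂ] 𝒜) (V : H ≃ₗᵢ[ℂ] H) : Prop where
  map_Ω : V G.Ω = G.Ω
  mem_D_iff : ∀ x, V x ∈ G.D ↔ x ∈ G.D
  intertwines : ∀ (a : 𝒜) (x : G.D),
    V (G.π a x) = G.π (β a) ⟨V x, (mem_D_iff x).2 x.2⟩

/-- For a one-parameter unitary group `U t = exp (i t h)` with self-adjoint generator `h`, this says
that `x` is in the domain of `h` and `h x = y`. -/
def GeneratorApply (U : ℝ → (H ≃ₗᵢ[ℂ] H)) (x y : H) : Prop :=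
  HasDerivAt (fun t : ℝ => U t x) (Complex.I • y) 0

/-- `U` is a strongly continuous one-parameter unitary group whose self-adjoint generator `h`,
`U t = exp (i t h)`, is nonnegative. -/
structure HasNonnegGenerator (U : ℝ → (H ≃ₗᵢ[ℂ] H)) : Prop where
  map_zero : U 0 = 1
  map_add : ∀ t s, U (t + s) = U t * U s
  continuous : ∀ x, Continuous fun t => U t x
  nonneg : ∀ x y, GeneratorApply U x y → 0 ≤ (inner ℂ x y).re

end States

/-! ### The boundary state -/

/-- The Fourier-Plancherel transform `k ↦ (2π)^{-1/2} ∫ e^{iku} f(u) du` of an `L²` function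
(zero if `f` is not in `L²`). -/
def fourierPlancherel (f : ℝ → ℝ) : ℝ → ℂ :=
  open scoped Classical in
  if h : MemLp (fun u => (f u : ℂ)) 2 volume then
    fun k => ((Real.sqrt (2 * Real.pi))⁻¹ : ℂ) *
      (𝓕 (h.toLp (fun u => (f u : ℂ))) : Lp ℂ 2 (volume : Measure ℝ)) (-k / (2 * Real.pi))
  else 0

/-- The transform of `ψ` along the `u`-direction. -/
def uHat (ψ : Scri → ℝ) (k : ℝ) (s : S2) : ℂ := fourierPlancherel (fun u => ψ (u, s)) k

/-- `μ(ψ, ψ') = Re ∫_{ℝ⁺ × 𝕊²} 2k conj(ψ̂(k, s)) ψ̂'(k, s) dk dμ_{𝕊²}(s)`. -/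
def bdryInner (ψ φ : bdrySpace) : ℝ :=
  (∫ s, ∫ k in Set.Ioi (0 : ℝ),
    2 * (k : ℂ) * (starRingEnd ℂ) (uHat ψ.1 k s) * uHat φ.1 k s ∂volume ∂sphereMeasure).re

/-- Quasi-free: every `n`-point function is the sum over all decompositions of `{1, …, n}` into
pairs (that is, fixed-point-free involutions `σ`) of the products of the two-point functions
of the pairs `i < σ i`. For odd `n` there are none, and the `n`-point function vanishes. -/
def IsQuasiFree (w : BdryAlgebra →ₗ[ℂ] ℂ) : Prop :=
  ∀ (n : ℕ) (ψ : Fin n → bdrySpace),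
    w (List.ofFn fun i => gen (ψ i)).prod =
      ∑ σ : Equiv.Perm (Fin n) with ∀ i, σ (σ i) = i ∧ σ i ≠ i,
        ∏ i : Fin n with i < σ i, w (gen (ψ i) * gen (ψ (σ i)))

/-- The quasi-free state on the boundary algebra with two-point function `μ + (i/2) σ`. -/
structure IsBdryState (w : BdryAlgebra →ₗ[ℂ] ℂ) : Prop where
  isState : IsState w
  quasiFree : IsQuasiFree w
  twoPoint : ∀ ψ φ : bdrySpace,
    w (gen ψ * gen φ) = (bdryInner ψ φ : ℂ) + Complex.I / 2 * (bdrySymp ψ φ : ℂ)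

/-- The function `p ↦ K_A(γ⁻¹ p)⁻¹ ψ(γ⁻¹ p)` for the BMS transformation `γ = (A, f)`. -/
def bmsPush (A : SL2C) (f : SmoothS2) (ψ : Scri → ℝ) (p : Scri) : ℝ :=
  (confFactor A ((bmsPerm A f).symm p).2)⁻¹ * ψ ((bmsPerm A f).symm p)

/-- `α` is the representation of the BMS group by `*`-automorphisms of the boundary algebra with
`α_γ [ψ] = [A_γ ψ]`, where `(A_γ ψ)(p) = K(γ⁻¹ p)⁻¹ ψ(γ⁻¹ p)` again belongs to `bdrySpace`. -/
def IsBMSRepresentation (α : BMSGroup →* (BdryAlgebra ≃⋆ₐ[ℂ] BdryAlgebra)) : Prop :=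
  ∀ (A : SL2C) (f : SmoothS2) (ψ : bdrySpace),
    ∃ h : bmsPush A f ψ.1 ∈ bdrySpace, α (bms A f) (gen ψ) = gen ⟨bmsPush A f ψ.1, h⟩

section OneParticle

variable {w : BdryAlgebra →ₗ[ℂ] ℂ} {H : Type*} [NormedAddCommGroup H] [InnerProductSpace ℂ H]

/-- The one-particle space, the closed complex span of the vectors `π([ψ]) Ω`. -/
def GNS.oneParticle (G : GNS w H) : Submodule ℂ H :=
  (Submodule.span ℂ (Set.range fun ψ : bdrySpace => (G.π (gen ψ) G.Ω : H))).topologicalClosure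

/-- The generator of `U` has no zero eigenvalue on the one-particle space. -/
def GNS.NoZeroMode (G : GNS w H) (U : ℝ → (H ≃ₗᵢ[ℂ] H)) : Prop :=
  ∀ x ∈ G.oneParticle, GeneratorApply U x 0 → x = 0

end OneParticle

/-- In the GNS representation of `w`, the one-parameter group `β` of automorphisms is implemented,
with fixed cyclic vector, by a strongly continuous unitary group with nonnegative generator,
and the generator has no zero eigenvalue on the one-particle space. -/
def IsGroundStateWithoutZeroModes (w : BdryAlgebra →ₗ[ℂ] ℂ) (β : ℝ → (BdryAlgebra ≃⋆ₐ[ℂ] BdryAlgebra)) :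
    Prop :=
  ∃ (H : Type) (_ : NormedAddCommGroup H) (_ : InnerProductSpace ℂ H) (_ : CompleteSpace H)
    (G : GNS w H) (U : ℝ → (H ≃ₗᵢ[ℂ] H)),
    (∀ t, G.Implements (β t) (U t)) ∧ HasNonnegGenerator U ∧ G.NoZeroMode U

end NullInfinity

end

open NullInfinity

/-! Everything rests on one Hilbert space realization of the two-point function. Put (Kψ)(k,s) =
√(2k) ψ̂(k,s) on X = ℝ⁺ × 𝕊². For real ψ one has ψ̂(-k) = conj ψ̂(k), so by Plancherel the imaginary
part of ∫ conj(Kψ) Kφ is ∫ ψ ∂_uφ, that is σ(ψ,φ)/2, while its real part is μ(ψ,φ) by definition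
(`scriForm_eq`). The two-point function is therefore W(ψ,φ) = ⟨Kψ, Kφ⟩ in L²(X).

Existence. Fock space is modelled on polynomials in the elements of a basis of the real space: [ψ]
acts as multiplication by the linear form of ψ plus the derivation that extends W(ψ,·). These
operators satisfy the commutation relations (`fieldOp_comm`), and the constant term of their
products applied to 1 is Wick's sum over pairings (`constantCoeff_prod_fieldOp`). Positivity comes
from sending a polynomial to its wave functions in L²(Xⁿ), weighted by 1/√n!; multiplication and
derivation are then adjoint (`inner_fockVec_fockEmb_mul`). So the vacuum functional is a quasi-free
state, and a quasi-free state is determined by its two-point function (`IsQuasiFree.ext`).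

(a) On each generator of ℑ, A_γψ is an affine substitution u ↦ κu - c multiplied by κ. The form ∫ 2k
conj(f̂) ĝ dk is invariant under affine substitutions, and the two factors κ are absorbed by the
Jacobian κ² of the conformal map of the sphere (`isConformalJacobian`). The Jacobian comes from the
action of SL(2,ℂ) on the light cone, where the determinant of the derivative is the energy ratio;
this is checked for null rotations, which generate the group. So W is invariant, hence so is the
state (`bdryVacuum_bmsRep`), and cyclicity gives unique implementing unitaries.

(b) Translation by t multiplies Kψ by exp(ikt), hence the n-particle wave functions by exp(it(k₁ + ⋯
+ kₙ)). The generator is multiplication by a function that is nonnegative, and positive almost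
everywhere for n ≥ 1 (`IsEnergyFlow.nonneg`, `IsEnergyFlow.eq_zero`). Other Bondi frames are
unitarily conjugate to this one.

(c) Let two quasi-free states satisfy the conditions. The commutation relations fix the imaginary
parts of both two-point functions, so the difference d(t) of the correlations ⟨ψ, U_t φ⟩ is real.
Positivity of the generators makes Gaussian averages of d bounded in the upper half-plane;
reflection and Liouville's theorem make them constant, so d is constant (`correlation_sub_const`).
By the mean ergodic theorem the absence of zero modes forces the time averages of both correlations
to 0 (`tendsto_average_correlation`). So d = 0, the two-point functions agree, and the states
coincide. -/

noncomputable section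

namespace NullInfinity

/-! ### Polynomial model of the bosonic Fock space over a real vector space -/

section Fock

open MvPolynomial

variable {E I : Type*} [AddCommGroup E] [Module ℝ E] (b : Module.Basis I ℝ E)

/-- The linear embedding of `E` as the linear forms in the polynomial algebra. -/
def fockEmb : E →ₗ[ℝ] MvPolynomial I ℂ := b.constr ℝ (fun i => (X i : MvPolynomial I ℂ))

/-- The derivation that extends a linear functional on `E`. -/
def lineDer (l : E →ₗ[ℝ] ℂ) : Derivation ℂ (MvPolynomial I ℂ) (MvPolynomial I ℂ) :=
  mkDerivation ℂ fun i => C (l (b i))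

theorem fockEmb_basis (i : I) : fockEmb b (b i) = X i := by
  simp [fockEmb]

theorem lineDer_X (l : E →ₗ[ℝ] ℂ) (i : I) : lineDer b l (X i) = C (l (b i)) := by
  simp [lineDer, mkDerivation_X]

theorem lineDer_C (l : E →ₗ[ℝ] ℂ) (z : ℂ) : lineDer b l (C z) = 0 := derivation_C _ _

theorem lineDer_emb (l : E →ₗ[ℝ] ℂ) (v : E) : lineDer b l (fockEmb b v) = C (l v) := by
  have h : ((lineDer b l).toLinearMap.restrictScalars ℝ) ∘ₗ fockEmb b =
      ((Algebra.linearMap ℂ (MvPolynomial I ℂ)).restrictScalars ℝ) ∘ₗ l := by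
    apply b.ext
    intro i
    simp [fockEmb_basis, lineDer_X, MvPolynomial.algebraMap_eq]
  simpa using congrArg (fun g => g v) h

/-- The commutator of two derivations is again a derivation, hence is determined by the variables.
-/
theorem derivation_comm_of_X {D D' : Derivation ℂ (MvPolynomial I ℂ) (MvPolynomial I ℂ)}
    (h : ∀ i, D (D' (X i)) = D' (D (X i))) (s : MvPolynomial I ℂ) : D (D' s) = D' (D s) := by
  have h0 : ⁅D, D'⁆ = 0 := by
    apply derivation_ext
    intro i
    rw [Derivation.commutator_apply, h]
    simp
  have h1 := congrArg (fun g : Derivation ℂ (MvPolynomial I ℂ) (MvPolynomial I ℂ) => g s) h0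
  simpa [Derivation.commutator_apply, sub_eq_zero] using h1

theorem lineDer_comm (l l' : E →ₗ[ℝ] ℂ) (s : MvPolynomial I ℂ) :
    lineDer b l (lineDer b l' s) = lineDer b l' (lineDer b l s) :=
  derivation_comm_of_X (fun i => by simp [lineDer_X]) s

theorem pderiv_lineDer_comm (i : I) (l : E →ₗ[ℝ] ℂ) (s : MvPolynomial I ℂ) :
    pderiv i (lineDer b l s) = lineDer b l (pderiv i s) := by
  classical
  refine derivation_comm_of_X (fun j => ?_) s
  rw [lineDer_X, pderiv_X, pderiv_C, Pi.single_apply]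
  split_ifs <;> simp

theorem derivation_sum_apply (T : Finset I)
    (D : I → Derivation ℂ (MvPolynomial I ℂ) (MvPolynomial I ℂ)) (s : MvPolynomial I ℂ) :
    (∑ i ∈ T, D i) s = ∑ i ∈ T, D i s := by
  classical
  induction T using Finset.induction_on with
  | empty => simp
  | insert i T hi ih => rw [Finset.sum_insert hi, Finset.sum_insert hi, Derivation.add_apply, ih]

/-- The basis is infinite, so a functional need not be a finite combination of coordinates; on a
polynomial in finitely many variables it may be treated as one. This turns amplitudes into finite
sums of square-integrable functions. -/
theorem lineDer_eq_sum (l : E →ₗ[ℝ] ℂ) {T : Finset I} {s : MvPolynomial I ℂ}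
    (hs : s ∈ supported ℂ (T : Set I)) :
    lineDer b l s = ∑ i ∈ T, l (b i) • pderiv i s := by
  classical
  have h : lineDer b l s = (∑ i ∈ T, l (b i) • pderiv i :
      Derivation ℂ (MvPolynomial I ℂ) (MvPolynomial I ℂ)) s := by
    apply derivation_eq_of_forall_mem_vars
    intro i hi
    have hT : i ∈ T := (mem_supported.1 hs) hi
    rw [lineDer_X, derivation_sum_apply]
    simp [pderiv_X, Pi.single_apply, hT, smul_eq_C_mul]
  rw [h, derivation_sum_apply]
  rfl

theorem derivation_mem_supported {T : Set I}
    {D : Derivation ℂ (MvPolynomial I ℂ) (MvPolynomial I ℂ)}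
    (hD : ∀ i, D (X i) ∈ supported ℂ T) {s : MvPolynomial I ℂ} (hs : s ∈ supported ℂ T) :
    D s ∈ supported ℂ T := by
  refine Algebra.adjoin_induction (p := fun s _ => D s ∈ supported ℂ T) ?_ ?_ ?_ ?_ hs
  · rintro _ ⟨i, -, rfl⟩
    exact hD i
  · intro r
    rw [Derivation.map_algebraMap]
    exact Subalgebra.zero_mem _
  · intro x y _ _ hx hy
    rw [map_add]
    exact Subalgebra.add_mem _ hx hy
  · intro x y hx hy hx' hy'
    rw [Derivation.leibniz]
    exact Subalgebra.add_mem _ (Subalgebra.mul_mem _ hx hy') (Subalgebra.mul_mem _ hy hx')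

theorem lineDer_mem_supported {T : Set I} (l : E →ₗ[ℝ] ℂ) {s : MvPolynomial I ℂ}
    (hs : s ∈ supported ℂ T) : lineDer b l s ∈ supported ℂ T :=
  derivation_mem_supported (fun i => by
    rw [lineDer_X]; exact Subalgebra.algebraMap_mem _ _) hs

theorem exists_finset_mem_supported (s s' : MvPolynomial I ℂ) :
    ∃ T : Finset I, s ∈ supported ℂ (T : Set I) ∧ s' ∈ supported ℂ (T : Set I) := by
  classical
  refine ⟨s.vars ∪ s'.vars, mem_supported.2 ?_, mem_supported.2 ?_⟩
  · exact_mod_cast Finset.subset_union_left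
  · exact_mod_cast Finset.subset_union_right

/-- The field operator: the sum of the creation operator and the annihilation operator. -/
def fieldOp (W : E →ₗ[ℝ] E →ₗ[ℝ] ℂ) (v : E) : Module.End ℂ (MvPolynomial I ℂ) :=
  LinearMap.mulLeft ℂ (fockEmb b v) + (lineDer b (W v)).toLinearMap

theorem fieldOp_apply (W : E →ₗ[ℝ] E →ₗ[ℝ] ℂ) (v : E) (s : MvPolynomial I ℂ) :
    fieldOp b W v s = fockEmb b v * s + lineDer b (W v) s := rfl

theorem lineDer_add (l l' : E →ₗ[ℝ] ℂ) : lineDer b (l + l') = lineDer b l + lineDer b l' := by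
  apply derivation_ext
  intro i
  simp [lineDer_X]

theorem lineDer_smul (r : ℝ) (l : E →ₗ[ℝ] ℂ) (s : MvPolynomial I ℂ) :
    lineDer b (r • l) s = r • lineDer b l s := by
  have h : lineDer b (r • l) = (r : ℂ) • lineDer b l := by
    apply derivation_ext
    intro i
    simp [lineDer_X, smul_eq_C_mul]
  rw [h]
  rfl

/-- The field operator as a linear map. -/
def fieldLin (W : E →ₗ[ℝ] E →ₗ[ℝ] ℂ) : E →ₗ[ℝ] Module.End ℂ (MvPolynomial I ℂ) where
  toFun := fieldOp b W
  map_add' v w := by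
    refine LinearMap.ext fun s => ?_
    simp only [fieldOp_apply, map_add, LinearMap.add_apply, lineDer_add, Derivation.add_apply]
    ring
  map_smul' r v := by
    refine LinearMap.ext fun s => ?_
    simp only [fieldOp_apply, map_smul, LinearMap.smul_apply, lineDer_smul, RingHom.id_apply,
      smul_add, smul_mul_assoc]

/-- The commutator of an annihilation operator with a field is a scalar, by the Leibniz rule. Both
the commutation relations and Wick's theorem come from this. -/
theorem lineDer_fieldOp (W : E →ₗ[ℝ] E →ₗ[ℝ] ℂ) (l : E →ₗ[ℝ] ℂ) (v : E) (s : MvPolynomial I ℂ) :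
    lineDer b l (fieldOp b W v s) = l v • s + fieldOp b W v (lineDer b l s) := by
  rw [fieldOp_apply, fieldOp_apply, map_add, Derivation.leibniz, lineDer_emb,
    lineDer_comm b l, smul_eq_mul, smul_eq_mul, smul_eq_C_mul]
  ring

theorem fieldOp_comm (W : E →ₗ[ℝ] E →ₗ[ℝ] ℂ) (v w : E) :
    fieldOp b W v * fieldOp b W w - fieldOp b W w * fieldOp b W v =
      algebraMap ℂ _ (W v w - W w v) := by
  refine LinearMap.ext fun s => ?_
  simp only [LinearMap.sub_apply, Module.End.mul_apply, Module.algebraMap_end_apply]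
  rw [fieldOp_apply b W v (fieldOp b W w s), fieldOp_apply b W w (fieldOp b W v s),
    lineDer_fieldOp, lineDer_fieldOp]
  simp only [fieldOp_apply, sub_smul, lineDer_comm b (W v)]
  ring

/-- Linear forms have no constant term, so a vacuum expectation sees only the annihilation part of
the leftmost field. -/
theorem constantCoeff_fieldOp (W : E →ₗ[ℝ] E →ₗ[ℝ] ℂ) (v : E) (s : MvPolynomial I ℂ) :
    constantCoeff (fieldOp b W v s) = constantCoeff (lineDer b (W v) s) := by
  have h : constantCoeff (fockEmb b v) = 0 := by
    have h : (((constantCoeff (R := ℂ) (σ := I)).toAddMonoidHom.toIntLinearMap.toAddMonoidHom).comp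
        (fockEmb b).toAddMonoidHom) v = constantCoeff (fockEmb b v) := rfl
    rw [← b.linearCombination_repr v, Finsupp.linearCombination_apply, Finsupp.sum, map_sum,
      map_sum]
    refine Finset.sum_eq_zero fun i _ => ?_
    rw [map_smul, fockEmb_basis, ← Complex.coe_smul, smul_eq_C_mul]
    simp
  rw [fieldOp_apply, map_add, map_mul, h, zero_mul, zero_add]

/-! #### Wave functions -/

variable {X : Type*}

/-- Evaluation of the one-particle wave functions at a point. -/
def evalAt (K : E →ₗ[ℝ] (X → ℂ)) (x : X) : E →ₗ[ℝ] ℂ := LinearMap.proj x ∘ₗ K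

theorem evalAt_apply (K : E →ₗ[ℝ] (X → ℂ)) (x : X) (v : E) : evalAt K x v = K v x := rfl

/-- The `n`-particle wave function of a polynomial, up to the factor `√n!`. -/
def amp (K : E →ₗ[ℝ] (X → ℂ)) : ∀ n : ℕ, MvPolynomial I ℂ →ₗ[ℂ] ((Fin n → X) → ℂ)
  | 0 => LinearMap.pi fun _ => lcoeff ℂ 0
  | n + 1 => LinearMap.pi fun x =>
      LinearMap.proj (Fin.tail x) ∘ₗ amp K n ∘ₗ (lineDer b (evalAt K (x 0))).toLinearMap

theorem amp_zero (K : E →ₗ[ℝ] (X → ℂ)) (s : MvPolynomial I ℂ) (x : Fin 0 → X) :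
    amp b K 0 s x = constantCoeff s := rfl

theorem amp_succ (K : E →ₗ[ℝ] (X → ℂ)) (n : ℕ) (s : MvPolynomial I ℂ) (x : Fin (n + 1) → X) :
    amp b K (n + 1) s x = amp b K n (lineDer b (evalAt K (x 0)) s) (Fin.tail x) := rfl

theorem amp_succ_eq_sum (K : E →ₗ[ℝ] (X → ℂ)) (n : ℕ) {T : Finset I} {s : MvPolynomial I ℂ}
    (hs : s ∈ supported ℂ (T : Set I)) (x : Fin (n + 1) → X) :
    amp b K (n + 1) s x = ∑ i ∈ T, K (b i) (x 0) * amp b K n (pderiv i s) (Fin.tail x) := by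
  rw [amp_succ, lineDer_eq_sum b _ hs, map_sum, Finset.sum_apply]
  refine Finset.sum_congr rfl fun i _ => ?_
  rw [map_smul, Pi.smul_apply, smul_eq_mul, evalAt_apply]

theorem amp_one (K : E →ₗ[ℝ] (X → ℂ)) (n : ℕ) : amp b K (n + 1) (1 : MvPolynomial I ℂ) = 0 := by
  funext x
  rw [amp_succ, Derivation.map_one_eq_zero, map_zero]
  rfl

/-- All `n`-fold derivatives vanish. -/
def DerVanish : ℕ → MvPolynomial I ℂ → Prop
  | 0, s => s = 0
  | n + 1, s => ∀ l : E →ₗ[ℝ] ℂ, DerVanish n (lineDer b l s)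

theorem DerVanish.succ {n : ℕ} {s : MvPolynomial I ℂ} (h : DerVanish b n s) :
    DerVanish b (n + 1) s := by
  induction n generalizing s with
  | zero => intro l; rw [show s = 0 from h, map_zero]; rfl
  | succ n ih => intro l; exact ih (h l)

theorem DerVanish.mono {n m : ℕ} (hnm : n ≤ m) {s : MvPolynomial I ℂ} (h : DerVanish b n s) :
    DerVanish b m s := by
  induction hnm with
  | refl => exact h
  | step _ ih => exact ih.succ

theorem DerVanish.add {n : ℕ} {s s' : MvPolynomial I ℂ} (h : DerVanish b n s)
    (h' : DerVanish b n s') : DerVanish b n (s + s') := by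
  induction n generalizing s s' with
  | zero => rw [show s = 0 from h, show s' = 0 from h', add_zero]; rfl
  | succ n ih => intro l; rw [map_add]; exact ih (h l) (h' l)

theorem DerVanish.smul {n : ℕ} {s : MvPolynomial I ℂ} (z : ℂ) (h : DerVanish b n s) :
    DerVanish b n (z • s) := by
  induction n generalizing s with
  | zero => rw [show s = 0 from h, smul_zero]; rfl
  | succ n ih => intro l; rw [Derivation.map_smul]; exact ih (h l)

theorem DerVanish.mul_X {n : ℕ} {s : MvPolynomial I ℂ} (h : DerVanish b n s) (i : I) :
    DerVanish b (n + 1) (s * MvPolynomial.X i) := by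
  induction n generalizing s with
  | zero => intro l; rw [show s = 0 from h, zero_mul, map_zero]; rfl
  | succ n ih =>
    intro l
    rw [Derivation.leibniz, lineDer_X, smul_eq_mul, smul_eq_mul, mul_comm s, ← smul_eq_C_mul,
      mul_comm (MvPolynomial.X i)]
    exact (h.smul b _).add b (ih (h l))

theorem exists_derVanish (s : MvPolynomial I ℂ) : ∃ n, DerVanish b n s := by
  induction s using MvPolynomial.induction_on with
  | C a => exact ⟨1, fun l => lineDer_C b l a⟩
  | add p q hp hq =>
    obtain ⟨n, hn⟩ := hp
    obtain ⟨m, hm⟩ := hq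
    exact ⟨max n m, (hn.mono b (le_max_left _ _)).add b (hm.mono b (le_max_right _ _))⟩
  | mul_X p i hp =>
    obtain ⟨n, hn⟩ := hp
    exact ⟨n + 1, hn.mul_X b i⟩

theorem DerVanish.amp_eq_zero (K : E →ₗ[ℝ] (X → ℂ)) {n : ℕ} {s : MvPolynomial I ℂ}
    (h : DerVanish b n s) : amp b K n s = 0 := by
  induction n generalizing s with
  | zero => rw [show s = 0 from h, map_zero]
  | succ n ih =>
    funext x
    rw [amp_succ, ih (h _)]
    rfl

/-- A polynomial has a bounded number of particles, so no estimate is needed to place its vector in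
the ℓ² sum. -/
theorem exists_amp_eq_zero (K : E →ₗ[ℝ] (X → ℂ)) (s : MvPolynomial I ℂ) :
    ∃ N, ∀ n, N ≤ n → amp b K n s = 0 := by
  obtain ⟨N, hN⟩ := exists_derVanish b s
  exact ⟨N, fun n hn => (hN.mono b hn).amp_eq_zero b K⟩

/-! #### The inner product -/

variable [MeasurableSpace X] (ν : Measure X)

/-- `∫ conj(f) g`. -/
def sqForm (f g : X → ℂ) : ℂ := ∫ x, (starRingEnd ℂ) (f x) * g x ∂ν

theorem integrable_conj_mul {Y : Type*} [MeasurableSpace Y] {μ : Measure Y} {f g : Y → ℂ}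
    (hf : MemLp f 2 μ) (hg : MemLp g 2 μ) :
    Integrable (fun x => (starRingEnd ℂ) (f x) * g x) μ :=
  hf.star.integrable_mul hg

theorem memLp_mul_prod {Y Z : Type*} [MeasurableSpace Y] [MeasurableSpace Z] {μ : Measure Y}
    {ρ : Measure Z} [SFinite μ] [SFinite ρ] {f : Y → ℂ} {g : Z → ℂ}
    (hf : MemLp f 2 μ) (hg : MemLp g 2 ρ) :
    MemLp (fun p : Y × Z => f p.1 * g p.2) 2 (μ.prod ρ) := by
  have hm : AEStronglyMeasurable (fun p : Y × Z => f p.1 * g p.2) (μ.prod ρ) :=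
    hf.1.comp_fst.mul hg.1.comp_snd
  rw [memLp_two_iff_integrable_sq_norm hm]
  have h1 := (memLp_two_iff_integrable_sq_norm hf.1).1 hf
  have h2 := (memLp_two_iff_integrable_sq_norm hg.1).1 hg
  refine (h1.mul_prod h2).congr (Filter.Eventually.of_forall fun p => ?_)
  simp [mul_pow]

variable {ν} in
theorem memLp_head_mul_tail [SigmaFinite ν] {n : ℕ} {f : X → ℂ} {g : (Fin n → X) → ℂ} (hf : MemLp f 2 ν)
    (hg : MemLp g 2 (Measure.pi fun _ : Fin n => ν)) :
    MemLp (fun x : Fin (n + 1) → X => f (x 0) * g (Fin.tail x)) 2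
      (Measure.pi fun _ : Fin (n + 1) => ν) :=
  (memLp_mul_prod hf hg).comp_measurePreserving (measurePreserving_piFinSuccAbove (fun _ => ν) 0)

theorem integral_head_mul_tail [SigmaFinite ν] {n : ℕ} (f : X → ℂ) (g : (Fin n → X) → ℂ) :
    ∫ x : Fin (n + 1) → X, f (x 0) * g (Fin.tail x) ∂(Measure.pi fun _ : Fin (n + 1) => ν) =
      (∫ x, f x ∂ν) * ∫ x, g x ∂(Measure.pi fun _ : Fin n => ν) := by
  rw [← integral_prod_mul]
  exact (measurePreserving_piFinSuccAbove (fun _ : Fin (n + 1) => ν) 0).integral_comp'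
    (fun p : X × (Fin n → X) => f p.1 * g p.2)

variable {ν} {K : E →ₗ[ℝ] (X → ℂ)} (hK : ∀ v, MemLp (K v) 2 ν)

include hK in
theorem memLp_amp [SigmaFinite ν] (n : ℕ) (s : MvPolynomial I ℂ) :
    MemLp (amp b K n s) 2 (Measure.pi fun _ : Fin n => ν) := by
  induction n generalizing s with
  | zero =>
    have : amp b K 0 s = fun _ => constantCoeff s := funext fun x => amp_zero b K s x
    rw [this, Measure.pi_of_empty (fun _ : Fin 0 => ν) (fun i => i.elim0)]
    exact memLp_const _
  | succ n ih =>
    obtain ⟨T, hT, -⟩ := exists_finset_mem_supported s s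
    have : amp b K (n + 1) s = fun x => ∑ i ∈ T, K (b i) (x 0) *
        amp b K n (pderiv i s) (Fin.tail x) := funext fun x => amp_succ_eq_sum b K n hT x
    rw [this]
    exact memLp_finsetSum _ fun i _ => memLp_head_mul_tail (hK _) (ih _)

variable (ν K) in
/-- The inner product of the `n`-particle wave functions. -/
def ampForm (n : ℕ) (s s' : MvPolynomial I ℂ) : ℂ :=
  sqForm (Measure.pi fun _ : Fin n => ν) (amp b K n s) (amp b K n s')

include hK in
theorem ampForm_add_left [SigmaFinite ν] (n : ℕ) (s t s' : MvPolynomial I ℂ) :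
    ampForm b ν K n (s + t) s' = ampForm b ν K n s s' + ampForm b ν K n t s' := by
  have h := integral_add (integrable_conj_mul (memLp_amp b hK n s) (memLp_amp b hK n s'))
    (integrable_conj_mul (memLp_amp b hK n t) (memLp_amp b hK n s'))
  rw [ampForm, ampForm, ampForm, sqForm, sqForm, sqForm, ← h]
  congr 1; funext x
  rw [map_add, Pi.add_apply, map_add]; ring

theorem ampForm_conj (n : ℕ) (s s' : MvPolynomial I ℂ) :
    (starRingEnd ℂ) (ampForm b ν K n s s') = ampForm b ν K n s' s := by
  rw [ampForm, ampForm, sqForm, sqForm, ← integral_conj]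
  congr 1; funext x
  simp [mul_comm]

theorem ampForm_smul_right (n : ℕ) (z : ℂ) (s s' : MvPolynomial I ℂ) :
    ampForm b ν K n s (z • s') = z * ampForm b ν K n s s' := by
  rw [ampForm, ampForm, sqForm, sqForm, ← integral_const_mul]
  congr 1; funext x
  rw [map_smul, Pi.smul_apply, smul_eq_mul]; ring

include hK in
theorem ampForm_add_right [SigmaFinite ν] (n : ℕ) (s s' t : MvPolynomial I ℂ) :
    ampForm b ν K n s (s' + t) = ampForm b ν K n s s' + ampForm b ν K n s t := by
  rw [← ampForm_conj, ampForm_add_left b hK, map_add, ampForm_conj, ampForm_conj]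

theorem ampForm_smul_left (n : ℕ) (z : ℂ) (s s' : MvPolynomial I ℂ) :
    ampForm b ν K n (z • s) s' = (starRingEnd ℂ) z * ampForm b ν K n s s' := by
  rw [← ampForm_conj, ampForm_smul_right, map_mul, ampForm_conj]

theorem ampForm_zero_right (n : ℕ) (s : MvPolynomial I ℂ) : ampForm b ν K n s 0 = 0 := by
  simp [ampForm, sqForm]

include hK in
theorem ampForm_sum_right [SigmaFinite ν] {ι : Type*} (n : ℕ) (s : MvPolynomial I ℂ) (T : Finset ι)
    (f : ι → MvPolynomial I ℂ) :
    ampForm b ν K n s (∑ i ∈ T, f i) = ∑ i ∈ T, ampForm b ν K n s (f i) := by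
  classical
  induction T using Finset.induction_on with
  | empty => simp [ampForm_zero_right]
  | insert i T hi ih => rw [Finset.sum_insert hi, Finset.sum_insert hi, ampForm_add_right b hK, ih]

include hK in
-- Expand both amplitudes in partial derivatives and separate the first argument by Fubini: the
-- (n+1)-particle product is the n-particle product of derivatives, contracted with the one-particle
-- Gram matrix.
theorem ampForm_succ [SigmaFinite ν] (n : ℕ) {T : Finset I} {s s' : MvPolynomial I ℂ}
    (hs : s ∈ supported ℂ (T : Set I)) (hs' : s' ∈ supported ℂ (T : Set I)) :
    ampForm b ν K (n + 1) s s' = ∑ i ∈ T, ∑ j ∈ T,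
      sqForm ν (K (b i)) (K (b j)) * ampForm b ν K n (pderiv i s) (pderiv j s') := by
  have h : ∀ x : Fin (n + 1) → X, (starRingEnd ℂ) (amp b K (n + 1) s x) * amp b K (n + 1) s' x =
      ∑ i ∈ T, ∑ j ∈ T, ((starRingEnd ℂ) (K (b i) (x 0)) * K (b j) (x 0)) *
        ((starRingEnd ℂ) (amp b K n (pderiv i s) (Fin.tail x)) *
          amp b K n (pderiv j s') (Fin.tail x)) := by
    intro x
    rw [amp_succ_eq_sum b K n hs, amp_succ_eq_sum b K n hs', map_sum, Finset.sum_mul_sum]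
    refine Finset.sum_congr rfl fun i _ => Finset.sum_congr rfl fun j _ => ?_
    rw [map_mul]; ring
  have hint : ∀ i j, Integrable (fun x : Fin (n + 1) → X =>
      ((starRingEnd ℂ) (K (b i) (x 0)) * K (b j) (x 0)) *
        ((starRingEnd ℂ) (amp b K n (pderiv i s) (Fin.tail x)) *
          amp b K n (pderiv j s') (Fin.tail x))) (Measure.pi fun _ : Fin (n + 1) => ν) := by
    intro i j
    refine (integrable_conj_mul (memLp_head_mul_tail (hK (b i)) (memLp_amp b hK n (pderiv i s)))
      (memLp_head_mul_tail (hK (b j)) (memLp_amp b hK n (pderiv j s')))).congr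
      (Filter.Eventually.of_forall fun x => ?_)
    simp only [map_mul]; ring
  rw [ampForm, sqForm]
  simp_rw [h]
  rw [integral_finsetSum _ fun i _ => integrable_finsetSum _ fun j _ => hint i j]
  refine Finset.sum_congr rfl fun i _ => ?_
  rw [integral_finsetSum _ fun j _ => hint i j]
  refine Finset.sum_congr rfl fun j _ => ?_
  exact integral_head_mul_tail ν (fun x => (starRingEnd ℂ) (K (b i) x) * K (b j) x)
    (fun y => (starRingEnd ℂ) (amp b K n (pderiv i s) y) * amp b K n (pderiv j s') y)

end Fock

/-! ### Wick's theorem -/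

section Pairings

/-- The sum over all decompositions of `Fin n` into pairs. -/
def pairingSum (n : ℕ) (G : Fin n → Fin n → ℂ) : ℂ :=
  ∑ σ : Equiv.Perm (Fin n) with ∀ i, σ (σ i) = i ∧ σ i ≠ i,
    ∏ i : Fin n with i < σ i, G i (σ i)

theorem pairingSum_zero (G : Fin 0 → Fin 0 → ℂ) : pairingSum 0 G = 1 := by
  simp [pairingSum]

theorem pairingSum_one (G : Fin 1 → Fin 1 → ℂ) : pairingSum 1 G = 0 := by
  rw [pairingSum]
  refine Finset.sum_eq_zero fun σ hσ => ?_
  exact absurd (Subsingleton.elim _ _) ((Finset.mem_filter.1 hσ).2 0).2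

/-- The order embedding of `Fin n` into `Fin (n + 2)` that skips `0` and `j + 1`. -/
def skipTwo {n : ℕ} (j : Fin (n + 1)) : Fin n ↪ Fin (n + 2) :=
  (Fin.succAboveEmb j).trans (Fin.succEmb (n + 1))

theorem skipTwo_apply {n : ℕ} (j : Fin (n + 1)) (i : Fin n) :
    skipTwo j i = (j.succAbove i).succ := rfl

theorem skipTwo_ne_zero {n : ℕ} (j : Fin (n + 1)) (i : Fin n) : skipTwo j i ≠ 0 :=
  Fin.succ_ne_zero _

theorem skipTwo_ne_succ {n : ℕ} (j : Fin (n + 1)) (i : Fin n) : skipTwo j i ≠ j.succ := by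
  rw [skipTwo_apply, Ne, Fin.succ_inj]
  exact Fin.succAbove_ne _ _

theorem skipTwo_lt_iff {n : ℕ} (j : Fin (n + 1)) (i k : Fin n) :
    skipTwo j i < skipTwo j k ↔ i < k := by
  rw [skipTwo_apply, skipTwo_apply, Fin.succ_lt_succ_iff, Fin.succAbove_lt_succAbove_iff]

theorem exists_skipTwo {n : ℕ} (j : Fin (n + 1)) {x : Fin (n + 2)} (h0 : x ≠ 0)
    (hj : x ≠ j.succ) : ∃ i, skipTwo j i = x := by
  obtain ⟨y, rfl⟩ := Fin.exists_succ_eq.2 h0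
  obtain ⟨i, rfl⟩ := Fin.exists_succAbove_eq (fun h => hj (congrArg Fin.succ h) : y ≠ j)
  exact ⟨i, rfl⟩

/-- Extend a permutation of `Fin n` by the transposition of the two remaining points. -/
def addPair {n : ℕ} (j : Fin (n + 1)) (τ : Equiv.Perm (Fin n)) : Equiv.Perm (Fin (n + 2)) :=
  Equiv.swap 0 j.succ * τ.viaFintypeEmbedding (skipTwo j)

theorem addPair_skipTwo {n : ℕ} (j : Fin (n + 1)) (τ : Equiv.Perm (Fin n)) (i : Fin n) :
    addPair j τ (skipTwo j i) = skipTwo j (τ i) := by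
  rw [addPair, Equiv.Perm.mul_apply, Equiv.Perm.viaFintypeEmbedding_apply_image,
    Equiv.swap_apply_of_ne_of_ne (skipTwo_ne_zero j _) (skipTwo_ne_succ j _)]

theorem addPair_zero {n : ℕ} (j : Fin (n + 1)) (τ : Equiv.Perm (Fin n)) :
    addPair j τ 0 = j.succ := by
  rw [addPair, Equiv.Perm.mul_apply, Equiv.Perm.viaFintypeEmbedding_apply_notMem_range,
    Equiv.swap_apply_left]
  rintro ⟨i, hi⟩
  exact skipTwo_ne_zero j i hi

theorem addPair_succ {n : ℕ} (j : Fin (n + 1)) (τ : Equiv.Perm (Fin n)) :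
    addPair j τ j.succ = 0 := by
  rw [addPair, Equiv.Perm.mul_apply, Equiv.Perm.viaFintypeEmbedding_apply_notMem_range,
    Equiv.swap_apply_right]
  rintro ⟨i, hi⟩
  exact skipTwo_ne_succ j i hi

theorem forall_fin_skipTwo {n : ℕ} (j : Fin (n + 1)) {p : Fin (n + 2) → Prop} (h0 : p 0)
    (hj : p j.succ) (h : ∀ i, p (skipTwo j i)) (x : Fin (n + 2)) : p x := by
  by_cases hx0 : x = 0
  · rwa [hx0]
  by_cases hxj : x = j.succ
  · rwa [hxj]
  obtain ⟨i, rfl⟩ := exists_skipTwo j hx0 hxj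
  exact h i

/-- Sort the pairings by the partner `j.succ` of 0. Deleting this pair leaves a pairing of the other
n points, and `skipTwo` is increasing, so the condition i < σ i is kept. -/
theorem pairingSum_succ_succ (n : ℕ) (G : Fin (n + 2) → Fin (n + 2) → ℂ) :
    pairingSum (n + 2) G = ∑ j : Fin (n + 1), G 0 j.succ *
      pairingSum n (fun i k => G (skipTwo j i) (skipTwo j k)) := by
  classical
  have hmaps : ∀ σ ∈ (Finset.univ.filter fun σ : Equiv.Perm (Fin (n + 2)) =>
      ∀ i, σ (σ i) = i ∧ σ i ≠ i), ∃ j : Fin (n + 1), j.succ = σ 0 := fun σ hσ =>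
    Fin.exists_succ_eq.2 ((Finset.mem_filter.1 hσ).2 0).2
  have hsplit : pairingSum (n + 2) G = ∑ j : Fin (n + 1),
      ∑ σ ∈ (Finset.univ.filter fun σ : Equiv.Perm (Fin (n + 2)) =>
        ∀ i, σ (σ i) = i ∧ σ i ≠ i) with σ 0 = j.succ,
        ∏ i : Fin (n + 2) with i < σ i, G i (σ i) := by
    rw [pairingSum]
    simp_rw [Finset.sum_filter (fun σ : Equiv.Perm (Fin (n + 2)) => σ 0 = _)]
    rw [Finset.sum_comm]
    refine Finset.sum_congr rfl fun σ hσ => ?_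
    obtain ⟨j, hj⟩ := hmaps σ hσ
    rw [Finset.sum_eq_single j]
    · rw [if_pos hj.symm]
    · intro k _ hk
      rw [if_neg]
      rw [← hj, Fin.succ_inj]
      exact hk.symm
    · simp
  rw [hsplit]
  refine Finset.sum_congr rfl fun j _ => ?_
  rw [pairingSum, Finset.mul_sum]
  symm
  refine Finset.sum_bij (fun τ _ => addPair j τ) ?_ ?_ ?_ ?_
  · intro τ hτ
    have hτ := (Finset.mem_filter.1 hτ).2
    refine Finset.mem_filter.2 ⟨Finset.mem_filter.2 ⟨Finset.mem_univ _, ?_⟩, addPair_zero j τ⟩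
    refine forall_fin_skipTwo j ?_ ?_ ?_
    · rw [addPair_zero, addPair_succ]
      exact ⟨rfl, Fin.succ_ne_zero _⟩
    · rw [addPair_succ, addPair_zero]
      exact ⟨rfl, (Fin.succ_ne_zero _).symm⟩
    · intro i
      rw [addPair_skipTwo, addPair_skipTwo, (hτ i).1]
      exact ⟨rfl, fun h => (hτ i).2 ((skipTwo j).injective h)⟩
  · intro τ _ τ' _ h
    ext1 i
    apply (skipTwo j).injective
    rw [← addPair_skipTwo, ← addPair_skipTwo, h]
  · intro σ hσ
    obtain ⟨hσ, h0⟩ := Finset.mem_filter.1 hσ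
    have hσ := (Finset.mem_filter.1 hσ).2
    have hj : σ j.succ = 0 := by rw [← h0, (hσ 0).1]
    have hex : ∀ i, ∃ k, skipTwo j k = σ (skipTwo j i) := fun i =>
      exists_skipTwo j
        (fun h => skipTwo_ne_succ j i (σ.injective (h.trans hj.symm)))
        (fun h => skipTwo_ne_zero j i (σ.injective (h.trans h0.symm)))
    choose g hg using hex
    -- σ exchanges 0 and `j.succ`, so it restricts to an involution of the remaining points.
    have hgg : Function.Involutive g := by
      intro i
      apply (skipTwo j).injective
      rw [hg, hg, (hσ _).1]
    refine ⟨hgg.toPerm g, Finset.mem_filter.2 ⟨Finset.mem_univ _, fun i => ⟨hgg i, fun h => ?_⟩⟩, ?_⟩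
    · apply (hσ (skipTwo j i)).2
      rw [← hg]
      exact congrArg _ h
    · ext1 x
      revert x
      refine forall_fin_skipTwo j ?_ ?_ ?_
      · rw [addPair_zero, h0]
      · rw [addPair_succ, hj]
      · intro i
        rw [addPair_skipTwo, ← hg]
        rfl
  · intro τ _
    -- The pair {0, `j.succ`} gives exactly one factor: 0 passes the test i < σ i and `j.succ` fails
    -- it.
    rw [Finset.prod_filter, Finset.prod_filter, Fin.prod_univ_succ, Fin.prod_univ_succAbove _ j,
      addPair_zero, addPair_succ, if_pos (Fin.succ_pos j), if_neg (Fin.not_lt_zero _), one_mul]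
    congr 1
    refine Finset.prod_congr rfl fun i _ => ?_
    rw [← skipTwo_apply, addPair_skipTwo]
    simp only [skipTwo_lt_iff]

end Pairings

section Wick

open MvPolynomial

variable {E I : Type*} [AddCommGroup E] [Module ℝ E] (b : Module.Basis I ℝ E)

/-- Move the derivation to the right through the fields. Each commutator is a scalar that deletes
one field, and the derivation finally annihilates 1. -/
theorem lineDer_prod_fieldOp (W : E →ₗ[ℝ] E →ₗ[ℝ] ℂ) (l : E →ₗ[ℝ] ℂ) (n : ℕ)
    (v : Fin (n + 1) → E) :
    lineDer b l ((List.ofFn fun i => fieldOp b W (v i)).prod 1) =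
      ∑ j : Fin (n + 1), l (v j) • (List.ofFn fun i => fieldOp b W (v (j.succAbove i))).prod 1 := by
  induction n with
  | zero =>
    rw [List.ofFn_succ, List.ofFn_zero, List.prod_singleton, lineDer_fieldOp, Fin.sum_univ_one]
    simp
  | succ n ih =>
    rw [List.ofFn_succ, List.prod_cons, Module.End.mul_apply, lineDer_fieldOp,
      ih (fun i => v i.succ), map_sum (fieldOp b W (v 0)), Fin.sum_univ_succ (n := n + 1)]
    congr 1
    refine Finset.sum_congr rfl fun (j : Fin (n + 1)) _ => ?_
    rw [LinearMap.map_smul, List.ofFn_succ, List.prod_cons, Module.End.mul_apply]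
    simp only [Fin.succ_succAbove_zero, Fin.succ_succAbove_succ]

/-- Only the annihilation part of the first field survives; contracting it with the later fields
reproduces the recursion `pairingSum_succ_succ`. -/
theorem constantCoeff_prod_fieldOp (W : E →ₗ[ℝ] E →ₗ[ℝ] ℂ) (n : ℕ) (v : Fin n → E) :
    constantCoeff ((List.ofFn fun i => fieldOp b W (v i)).prod 1) =
      pairingSum n fun i j => W (v i) (v j) := by
  induction n using Nat.twoStepInduction with
  | zero => simp [pairingSum_zero]
  | one =>
    rw [pairingSum_one, List.ofFn_succ, List.prod_cons, Module.End.mul_apply,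
      constantCoeff_fieldOp]
    simp
  | more n ih _ =>
    rw [pairingSum_succ_succ, List.ofFn_succ, List.prod_cons, Module.End.mul_apply,
      constantCoeff_fieldOp, lineDer_prod_fieldOp, map_sum]
    refine Finset.sum_congr rfl fun j _ => ?_
    rw [smul_eq_C_mul, map_mul, constantCoeff_C, ih]
    rfl

end Wick

/-! ### The Fock space -/

section FockVec

open MvPolynomial

variable {E I X : Type*} [AddCommGroup E] [Module ℝ E] (b : Module.Basis I ℝ E)
  [MeasurableSpace X] {ν : Measure X} {K : E →ₗ[ℝ] (X → ℂ)}

theorem sqForm_conj (f g : X → ℂ) : (starRingEnd ℂ) (sqForm ν f g) = sqForm ν g f := by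
  rw [sqForm, sqForm, ← integral_conj]
  congr 1; funext x
  simp [mul_comm]

theorem sqForm_add_right {f g h : X → ℂ} (hf : MemLp f 2 ν) (hg : MemLp g 2 ν)
    (hh : MemLp h 2 ν) : sqForm ν f (g + h) = sqForm ν f g + sqForm ν f h := by
  rw [sqForm, sqForm, sqForm, ← integral_add (integrable_conj_mul hf hg) (integrable_conj_mul hf hh)]
  congr 1; funext x
  rw [Pi.add_apply]; ring

theorem sqForm_smul_right (r : ℝ) (f g : X → ℂ) : sqForm ν f (r • g) = r • sqForm ν f g := by
  rw [sqForm, sqForm, ← integral_smul]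
  congr 1; funext x
  rw [Pi.smul_apply, mul_smul_comm]

theorem sqForm_add_left {f g h : X → ℂ} (hf : MemLp f 2 ν) (hg : MemLp g 2 ν)
    (hh : MemLp h 2 ν) : sqForm ν (f + g) h = sqForm ν f h + sqForm ν g h := by
  rw [← sqForm_conj, sqForm_add_right hh hf hg, map_add, sqForm_conj, sqForm_conj]

theorem sqForm_smul_left (r : ℝ) (f g : X → ℂ) : sqForm ν (r • f) g = r • sqForm ν f g := by
  rw [← sqForm_conj, sqForm_smul_right, ← sqForm_conj f g]
  simp

/-- The two-point function `∫ conj(K v) K w` as a bilinear map. -/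
def twoPt (hK : ∀ v, MemLp (K v) 2 ν) : E →ₗ[ℝ] E →ₗ[ℝ] ℂ :=
  LinearMap.mk₂ ℝ (fun v w => sqForm ν (K v) (K w))
    (fun v v' w => by rw [map_add, sqForm_add_left (hK _) (hK _) (hK _)])
    (fun r v w => by rw [map_smul, sqForm_smul_left])
    (fun v w w' => by rw [map_add, sqForm_add_right (hK _) (hK _) (hK _)])
    (fun r v w => by rw [map_smul, sqForm_smul_right])

theorem twoPt_apply (hK : ∀ v, MemLp (K v) 2 ν) (v w : E) :
    twoPt hK v w = sqForm ν (K v) (K w) := rfl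

theorem constantCoeff_fockEmb_mul (v : E) (s : MvPolynomial I ℂ) :
    constantCoeff (fockEmb b v * s) = 0 := by
  have h := constantCoeff_fieldOp b 0 v s
  rw [fieldOp_apply, map_add, add_eq_right] at h
  exact h

theorem ampForm_zero (s s' : MvPolynomial I ℂ) :
    ampForm b ν K 0 s s' = (starRingEnd ℂ) (constantCoeff s) * constantCoeff s' := by
  rw [ampForm, sqForm, Measure.pi_of_empty (fun _ : Fin 0 => ν) (fun i => i.elim0), integral_dirac,
    amp_zero, amp_zero]

variable [SigmaFinite ν] (hK : ∀ v, MemLp (K v) 2 ν)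

theorem ampForm_sum_mul {T : Finset I} (n : ℕ) (s : MvPolynomial I ℂ) {s' : MvPolynomial I ℂ}
    (hs' : s' ∈ supported ℂ (T : Set I)) (k : I) :
    ∑ j ∈ T, sqForm ν (K (b k)) (K (b j)) * ampForm b ν K n s (pderiv j s') =
      ampForm b ν K n s (lineDer b (twoPt hK (b k)) s') := by
  rw [lineDer_eq_sum b _ hs', ampForm_sum_right b hK]
  refine Finset.sum_congr rfl fun j _ => ?_
  rw [ampForm_smul_right, twoPt_apply]

/-- Adjointness of creation and annihilation before normalization. In the recursion for the product,
∂ᵢ(X_k s) = X_k ∂ᵢ s + δᵢₖ s; the δ term contributes one copy of the right-hand side and the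
induction hypothesis contributes the others. -/
theorem ampForm_X_mul (n : ℕ) (k : I) (s s' : MvPolynomial I ℂ) :
    ampForm b ν K (n + 1) (MvPolynomial.X k * s) s' =
      (n + 1) * ampForm b ν K n s (lineDer b (twoPt hK (b k)) s') := by
  classical
  induction n generalizing s s' with
  | zero =>
    obtain ⟨T, hT, hT'⟩ := exists_finset_mem_supported (MvPolynomial.X k * s) s'
    -- k is adjoined to the support so that the sum over i can be reduced to i = k; for s = 0 it
    -- need not be there already.
    have hT1 : (MvPolynomial.X k * s) ∈ supported ℂ (↑(insert k T) : Set I) :=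
      supported_mono (by simp) hT
    have hT2 : s' ∈ supported ℂ (↑(insert k T) : Set I) := supported_mono (by simp) hT'
    rw [ampForm_succ b hK 0 hT1 hT2, Finset.sum_eq_single k]
    · have h : ∀ j, ampForm b ν K 0 (pderiv k (MvPolynomial.X k * s)) (pderiv j s') =
          ampForm b ν K 0 s (pderiv j s') := by
        intro j
        rw [ampForm_zero, ampForm_zero, Derivation.leibniz, map_add, smul_eq_mul, smul_eq_mul,
          pderiv_X_self, mul_one]
        simp
      simp_rw [h]
      rw [ampForm_sum_mul b hK 0 s hT2 k]
      simp
    · intro i _ hi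
      refine Finset.sum_eq_zero fun j _ => ?_
      rw [ampForm_zero, Derivation.leibniz, pderiv_X_of_ne hi.symm, smul_zero, add_zero,
        smul_eq_mul]
      simp
    · simp
  | succ n ih =>
    obtain ⟨T, hT, hT'⟩ := exists_finset_mem_supported s s'
    have hT1 : s ∈ supported ℂ (↑(insert k T) : Set I) := supported_mono (by simp) hT
    have hT2 : s' ∈ supported ℂ (↑(insert k T) : Set I) := supported_mono (by simp) hT'
    have hX : MvPolynomial.X k ∈ supported ℂ (↑(insert k T) : Set I) := by
      rw [X_mem_supported]; simp
    rw [ampForm_succ b hK (n + 1) (Subalgebra.mul_mem _ hX hT1) hT2]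
    have h : ∀ i j, ampForm b ν K (n + 1) (pderiv i (MvPolynomial.X k * s)) (pderiv j s') =
        (n + 1) * ampForm b ν K n (pderiv i s) (pderiv j (lineDer b (twoPt hK (b k)) s')) +
          (if i = k then ampForm b ν K (n + 1) s (pderiv j s') else 0) := by
      intro i j
      rw [Derivation.leibniz, ampForm_add_left b hK, smul_eq_mul, smul_eq_mul, ih,
        pderiv_lineDer_comm, pderiv_X, Pi.single_apply]
      congr 1
      by_cases hik : i = k
      · subst hik
        simp
      · rw [if_neg hik, if_neg (fun h => hik h.symm), mul_zero, ← ampForm_conj, ampForm_zero_right,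
          map_zero]
    simp_rw [h, mul_add, Finset.sum_add_distrib]
    rw [add_comm]
    have h2 : ∑ i ∈ insert k T, ∑ j ∈ insert k T, sqForm ν (K (b i)) (K (b j)) *
        (if i = k then ampForm b ν K (n + 1) s (pderiv j s') else 0) =
        ampForm b ν K (n + 1) s (lineDer b (twoPt hK (b k)) s') := by
      rw [Finset.sum_eq_single k]
      · simp only [if_true]
        exact ampForm_sum_mul b hK (n + 1) s hT2 k
      · intro i _ hi
        simp [hi]
      · simp
    have h3 : ∑ i ∈ insert k T, ∑ j ∈ insert k T, sqForm ν (K (b i)) (K (b j)) *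
        (((n : ℂ) + 1) * ampForm b ν K n (pderiv i s)
          (pderiv j (lineDer b (twoPt hK (b k)) s'))) =
        (n + 1) * ampForm b ν K (n + 1) s (lineDer b (twoPt hK (b k)) s') := by
      rw [ampForm_succ b hK n hT1 (lineDer_mem_supported b _ hT2), Finset.mul_sum]
      refine Finset.sum_congr rfl fun i _ => ?_
      rw [Finset.mul_sum]
      refine Finset.sum_congr rfl fun j _ => ?_
      ring
    rw [h2, h3]
    push_cast
    ring

/-- Both sides are real-linear in v (the conjugation on the left does not affect real scalars), so
the case of basis vectors suffices. -/
theorem ampForm_fockEmb_mul (n : ℕ) (v : E) (s s' : MvPolynomial I ℂ) :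
    ampForm b ν K (n + 1) (fockEmb b v * s) s' =
      (n + 1) * ampForm b ν K n s (lineDer b (twoPt hK v) s') := by
  let L : E →ₗ[ℝ] ℂ :=
    { toFun := fun v => ampForm b ν K (n + 1) (fockEmb b v * s) s'
      map_add' := fun v w => by rw [map_add, add_mul, ampForm_add_left b hK]
      map_smul' := fun r v => by
        rw [map_smul, smul_mul_assoc, ← Complex.coe_smul, ampForm_smul_left]
        simp }
  let R : E →ₗ[ℝ] ℂ :=
    { toFun := fun v => (n + 1) * ampForm b ν K n s (lineDer b (twoPt hK v) s')
      map_add' := fun v w => by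
        rw [map_add, lineDer_add, Derivation.add_apply, ampForm_add_right b hK, mul_add]
      map_smul' := fun r v => by
        rw [map_smul, lineDer_smul, ← Complex.coe_smul, ampForm_smul_right]
        simp only [RingHom.id_apply, Complex.real_smul]
        ring }
  have h : L = R := b.ext fun k => by
    change ampForm b ν K (n + 1) (fockEmb b (b k) * s) s' = _
    rw [fockEmb_basis]
    exact ampForm_X_mul b hK n k s s'
  exact congrArg (fun g : E →ₗ[ℝ] ℂ => g v) h

end FockVec

section FockSpace

open MvPolynomial

/-- The (unsymmetrized) Fock space over `L²(X)`. -/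
abbrev FockSpace {X : Type*} [MeasurableSpace X] (ν : Measure X) : Type _ :=
  lp (fun n : ℕ => Lp ℂ 2 (Measure.pi fun _ : Fin n => ν)) 2

variable {E I X : Type*} [AddCommGroup E] [Module ℝ E] (b : Module.Basis I ℝ E)
  [MeasurableSpace X] {ν : Measure X} [SigmaFinite ν] {K : E →ₗ[ℝ] (X → ℂ)}
  (hK : ∀ v, MemLp (K v) 2 ν)

/-- The normalized `n`-particle component of a polynomial. -/
def fockComp (n : ℕ) : MvPolynomial I ℂ →ₗ[ℂ] Lp ℂ 2 (Measure.pi fun _ : Fin n => ν) where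
  toFun s := ((√(n.factorial : ℝ))⁻¹ : ℂ) • (memLp_amp b hK n s).toLp (amp b K n s)
  map_add' s t := by
    rw [← smul_add, ← MemLp.toLp_add]
    simp only [map_add]
  map_smul' z s := by
    have h : (memLp_amp b hK n (z • s)).toLp (amp b K n (z • s)) =
        z • (memLp_amp b hK n s).toLp (amp b K n s) := by
      rw [← MemLp.toLp_const_smul]
      exact MemLp.toLp_congr _ _ (Filter.EventuallyEq.of_eq (map_smul _ _ _))
    rw [RingHom.id_apply, smul_comm z, h]

theorem fockComp_apply (n : ℕ) (s : MvPolynomial I ℂ) : fockComp b hK n s =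
    ((√(n.factorial : ℝ))⁻¹ : ℂ) • (memLp_amp b hK n s).toLp (amp b K n s) := rfl

theorem fockComp_coe (n : ℕ) (s : MvPolynomial I ℂ) :
    (fockComp b hK n s : (Fin n → X) → ℂ) =ᵐ[Measure.pi fun _ : Fin n => ν]
      fun x => ((√(n.factorial : ℝ))⁻¹ : ℂ) * amp b K n s x := by
  rw [fockComp_apply]
  filter_upwards [Lp.coeFn_smul ((√(n.factorial : ℝ))⁻¹ : ℂ) ((memLp_amp b hK n s).toLp _),
    (memLp_amp b hK n s).coeFn_toLp] with x h1 h2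
  rw [h1, Pi.smul_apply, h2, smul_eq_mul]

theorem inner_fockComp (n : ℕ) (s s' : MvPolynomial I ℂ) :
    inner ℂ (fockComp b hK n s) (fockComp b hK n s') =
      (n.factorial : ℂ)⁻¹ * ampForm b ν K n s s' := by
  rw [fockComp_apply, fockComp_apply, inner_smul_left, inner_smul_right, ← mul_assoc,
    L2.inner_def]
  congr 1
  · rw [← Complex.ofReal_inv, Complex.conj_ofReal, ← Complex.ofReal_mul, ← mul_inv,
      Real.mul_self_sqrt (Nat.cast_nonneg _)]
    simp
  · rw [ampForm, sqForm]
    refine integral_congr_ae ?_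
    filter_upwards [(memLp_amp b hK n s).coeFn_toLp, (memLp_amp b hK n s').coeFn_toLp] with x h1 h2
    rw [h1, h2, RCLike.inner_apply, mul_comm]

theorem fockComp_eq_zero {n : ℕ} {s : MvPolynomial I ℂ} (h : amp b K n s = 0) :
    fockComp b hK n s = 0 := by
  rw [fockComp_apply]
  have : (memLp_amp b hK n s).toLp (amp b K n s) = 0 := by
    rw [Lp.eq_zero_iff_ae_eq_zero]
    exact (MemLp.coeFn_toLp _).trans (by rw [h])
  rw [this, smul_zero]

theorem memℓp_fockComp (s : MvPolynomial I ℂ) : Memℓp (fun n => fockComp b hK n s) 2 := by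
  obtain ⟨N, hN⟩ := exists_amp_eq_zero b K s
  refine Memℓp.of_exponent_ge (memℓp_zero ?_) zero_le
  refine (Set.finite_Iio N).subset fun n hn => ?_
  by_contra h
  exact hn (fockComp_eq_zero b hK (hN n (not_lt.1 h)))

/-- The Fock space vector of a polynomial. -/
def fockVec : MvPolynomial I ℂ →ₗ[ℂ] FockSpace ν where
  toFun s := ⟨fun n => fockComp b hK n s, memℓp_fockComp b hK s⟩
  map_add' s t := by
    ext1; funext n
    exact map_add (fockComp b hK n) s t
  map_smul' z s := by
    ext1; funext n
    exact map_smul (fockComp b hK n) z s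

theorem fockVec_apply (s : MvPolynomial I ℂ) (n : ℕ) : fockVec b hK s n = fockComp b hK n s := rfl

include hK in
theorem summable_ampForm (s s' : MvPolynomial I ℂ) :
    Summable fun n : ℕ => (n.factorial : ℂ)⁻¹ * ampForm b ν K n s s' := by
  have h := lp.summable_inner (𝕜 := ℂ) (fockVec b hK s) (fockVec b hK s')
  simpa only [fockVec_apply, inner_fockComp] using h

theorem inner_fockVec (s s' : MvPolynomial I ℂ) :
    inner ℂ (fockVec b hK s) (fockVec b hK s') =
      ∑' n : ℕ, (n.factorial : ℂ)⁻¹ * ampForm b ν K n s s' := by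
  rw [lp.inner_eq_tsum]
  simp only [fockVec_apply, inner_fockComp]

theorem inner_fockVec_one (s : MvPolynomial I ℂ) :
    inner ℂ (fockVec b hK 1) (fockVec b hK s) = constantCoeff s := by
  rw [inner_fockVec, tsum_eq_single 0]
  · simp [ampForm_zero]
  · intro n hn
    obtain ⟨m, rfl⟩ := Nat.exists_eq_succ_of_ne_zero hn
    rw [ampForm, Nat.succ_eq_add_one, amp_one]
    simp [sqForm]

/-- The weight 1/n! cancels the factor n + 1 of `ampForm_fockEmb_mul`; a created vector has no
vacuum component, so the sum can be shifted by one. -/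
theorem inner_fockVec_fockEmb_mul (v : E) (s s' : MvPolynomial I ℂ) :
    inner ℂ (fockVec b hK (fockEmb b v * s)) (fockVec b hK s') =
      inner ℂ (fockVec b hK s) (fockVec b hK (lineDer b (twoPt hK v) s')) := by
  rw [inner_fockVec, inner_fockVec, (summable_ampForm b hK _ _).tsum_eq_zero_add, ampForm_zero,
    constantCoeff_fockEmb_mul, map_zero, zero_mul, mul_zero, zero_add]
  congr 1; funext n
  rw [ampForm_fockEmb_mul b hK, Nat.factorial_succ]
  have h : (n : ℂ) + 1 ≠ 0 := by exact_mod_cast Nat.succ_ne_zero n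
  push_cast
  field_simp

theorem inner_fieldOp (v : E) (s s' : MvPolynomial I ℂ) :
    inner ℂ (fockVec b hK (fieldOp b (twoPt hK) v s)) (fockVec b hK s') =
      inner ℂ (fockVec b hK s) (fockVec b hK (fieldOp b (twoPt hK) v s')) := by
  have h : inner ℂ (fockVec b hK (lineDer b (twoPt hK v) s)) (fockVec b hK s') =
      inner ℂ (fockVec b hK s) (fockVec b hK (fockEmb b v * s')) := by
    rw [← inner_conj_symm, ← inner_fockVec_fockEmb_mul, inner_conj_symm]
  rw [fieldOp_apply, fieldOp_apply, map_add, map_add, inner_add_left, inner_add_right,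
    inner_fockVec_fockEmb_mul, h, add_comm]

/-- The derivation annihilates 1, and what remains is a homogeneous linear form. This puts the
one-particle space orthogonal to the vacuum. -/
theorem fockComp_fieldOp_one (v : E) (n : ℕ) (hn : n ≠ 1) :
    fockComp b hK n (fieldOp b (twoPt hK) v 1) = 0 := by
  apply fockComp_eq_zero
  rw [fieldOp_apply, Derivation.map_one_eq_zero, add_zero, mul_one]
  funext x
  match n, hn with
  | 0, _ =>
    have := constantCoeff_fockEmb_mul b v 1
    rw [mul_one] at this
    exact this
  | n + 2, _ =>
    rw [amp_succ, lineDer_emb, amp_succ, lineDer_C, map_zero]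
    rfl

/-! #### Second quantization -/

/-- The algebra endomorphism that extends a linear endomorphism of `E`. -/
def secondQuant (A : E →ₗ[ℝ] E) : MvPolynomial I ℂ →ₐ[ℂ] MvPolynomial I ℂ :=
  aeval fun i => fockEmb b (A (b i))

theorem secondQuant_fockEmb (A : E →ₗ[ℝ] E) (v : E) :
    secondQuant b A (fockEmb b v) = fockEmb b (A v) := by
  have h : ((secondQuant b A).toLinearMap.restrictScalars ℝ) ∘ₗ fockEmb b = fockEmb b ∘ₗ A := by
    apply b.ext
    intro i
    simp [fockEmb_basis, secondQuant]
  exact congrArg (fun g : E →ₗ[ℝ] MvPolynomial I ℂ => g v) h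

theorem lineDer_secondQuant (A : E →ₗ[ℝ] E) (l : E →ₗ[ℝ] ℂ) (s : MvPolynomial I ℂ) :
    lineDer b l (secondQuant b A s) = secondQuant b A (lineDer b (l ∘ₗ A) s) := by
  induction s using MvPolynomial.induction_on with
  | C a =>
    rw [lineDer_C, ← MvPolynomial.algebraMap_eq, AlgHom.commutes, Derivation.map_algebraMap,
      map_zero]
  | add p q hp hq => rw [map_add, map_add, map_add, map_add, hp, hq]
  | mul_X p i hp =>
    rw [map_mul, Derivation.leibniz, Derivation.leibniz, hp, lineDer_X, map_add, smul_eq_mul,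
      smul_eq_mul, smul_eq_mul, smul_eq_mul, map_mul, map_mul, ← fockEmb_basis b i,
      secondQuant_fockEmb, lineDer_emb, ← MvPolynomial.algebraMap_eq, AlgHom.commutes]
    rfl

/-- The creation part is intertwined because substitution is multiplicative; the annihilation part
because invariance of W says that the functional W(Av), pulled back along A, is W(v). -/
theorem secondQuant_fieldOp {W : E →ₗ[ℝ] E →ₗ[ℝ] ℂ} {A : E →ₗ[ℝ] E}
    (hA : ∀ v w, W (A v) (A w) = W v w) (v : E) (s : MvPolynomial I ℂ) :
    secondQuant b A (fieldOp b W v s) = fieldOp b W (A v) (secondQuant b A s) := by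
  have h : W (A v) ∘ₗ A = W v := LinearMap.ext fun w => hA v w
  rw [fieldOp_apply, fieldOp_apply, map_add, map_mul, secondQuant_fockEmb, lineDer_secondQuant, h]

/-- An operator that is multiplication by q on one-particle functions acts on n particles by the
product of the q(xⱼ). -/
theorem amp_secondQuant {A : E →ₗ[ℝ] E} {q : X → ℂ}
    (hA : ∀ v, K (A v) =ᵐ[ν] fun x => q x * K v x) (n : ℕ) (s : MvPolynomial I ℂ) :
    amp b K n (secondQuant b A s) =ᵐ[Measure.pi fun _ : Fin n => ν]
      fun x => (∏ j, q (x j)) * amp b K n s x := by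
  induction n generalizing s with
  | zero =>
    refine Filter.Eventually.of_forall fun x => ?_
    have : constantCoeff (secondQuant b A s) = constantCoeff s := by
      induction s using MvPolynomial.induction_on with
      | C a => rw [← MvPolynomial.algebraMap_eq, AlgHom.commutes]
      | add p q hp hq => simp only [map_add, hp, hq]
      | mul_X p i hp =>
        rw [map_mul, map_mul, map_mul, hp, ← fockEmb_basis b i, secondQuant_fockEmb]
        have h : ∀ v, constantCoeff (fockEmb b v) = 0 := fun v => by
          simpa using constantCoeff_fockEmb_mul b v 1
        rw [h, h]
    change constantCoeff _ = _ * constantCoeff s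
    rw [this]
    simp
  | succ n ih =>
    obtain ⟨T, hT, -⟩ := exists_finset_mem_supported s s
    have hmp := measurePreserving_piFinSuccAbove (fun _ : Fin (n + 1) => ν) 0
    -- The exceptional null set of the hypothesis depends on the vector; only the finitely many
    -- basis vectors indexed by T matter.
    have h1 : ∀ᵐ x ∂(Measure.pi fun _ : Fin (n + 1) => ν), ∀ i ∈ T,
        K (A (b i)) (x 0) = q (x 0) * K (b i) (x 0) := by
      rw [Filter.eventually_all_finset]
      intro i _
      exact (Measure.quasiMeasurePreserving_fst.comp hmp.quasiMeasurePreserving).ae (hA (b i))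
    have h2 : ∀ᵐ x ∂(Measure.pi fun _ : Fin (n + 1) => ν), ∀ i ∈ T,
        amp b K n (secondQuant b A (pderiv i s)) (Fin.tail x) =
          (∏ j, q (Fin.tail x j)) * amp b K n (pderiv i s) (Fin.tail x) := by
      rw [Filter.eventually_all_finset]
      intro i _
      exact (Measure.quasiMeasurePreserving_snd.comp hmp.quasiMeasurePreserving).ae
        (ih (pderiv i s))
    filter_upwards [h1, h2] with x hx1 hx2
    rw [amp_succ, lineDer_secondQuant, lineDer_eq_sum b _ hT, map_sum, map_sum, Finset.sum_apply,
      amp_succ_eq_sum b K n hT, Finset.mul_sum]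
    refine Finset.sum_congr rfl fun i hi => ?_
    rw [map_smul, map_smul, Pi.smul_apply, smul_eq_mul, LinearMap.comp_apply, evalAt_apply,
      hx1 i hi, hx2 i hi, Fin.prod_univ_succ]
    simp only [Fin.tail]
    ring

end FockSpace

/-! ### Generalities on GNS representations -/

section GNSGeneral

variable {𝒜 : Type*} [Ring 𝒜] [Algebra ℂ 𝒜] [StarRing 𝒜]

/-- Equality of norms makes `f` factor isometrically through the dense range of `e`; completeness of
the target extends it. -/
theorem exists_linearIsometry_of_norm_eq {M H H' : Type*} [AddCommGroup M] [Module ℂ M]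
    [NormedAddCommGroup H] [InnerProductSpace ℂ H] [NormedAddCommGroup H']
    [InnerProductSpace ℂ H'] [CompleteSpace H'] (e : M →ₗ[ℂ] H) (f : M →ₗ[ℂ] H')
    (he : DenseRange e) (h : ∀ a, ‖f a‖ = ‖e a‖) : ∃ J : H →ₗᵢ[ℂ] H', ∀ a, J (e a) = f a := by
  have hb : ∃ C, ∀ x, ‖f x‖ ≤ C * ‖e x‖ := ⟨1, fun x => by rw [h, one_mul]⟩
  refine ⟨⟨(f.extendOfNorm e).toLinearMap, fun x => ?_⟩, fun a =>
    LinearMap.extendOfNorm_eq he hb a⟩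
  refine he.induction_on (p := fun x => ‖f.extendOfNorm e x‖ = ‖x‖) x
    (isClosed_eq (f.extendOfNorm e).continuous.norm continuous_norm) fun a => ?_
  rw [LinearMap.extendOfNorm_eq he hb a, h]

variable {w : 𝒜 →ₗ[ℂ] ℂ} {H : Type*} [NormedAddCommGroup H] [InnerProductSpace ℂ H]

/-- The map `a ↦ π(a) Ω`. -/
def GNS.vec (G : GNS w H) : 𝒜 →ₗ[ℂ] H :=
  G.D.subtype ∘ₗ (LinearMap.applyₗ G.Ω) ∘ₗ G.π.toLinearMap

theorem GNS.vec_apply (G : GNS w H) (a : 𝒜) : G.vec a = G.π a G.Ω := rfl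

theorem GNS.vec_one (G : GNS w H) : G.vec 1 = G.Ω := by
  rw [GNS.vec_apply, map_one]; rfl

theorem GNS.vec_mem (G : GNS w H) (a : 𝒜) : G.vec a ∈ G.D := (G.π a G.Ω).2

theorem GNS.exists_vec (G : GNS w H) {x : H} (hx : x ∈ G.D) : ∃ a, G.vec a = x := by
  obtain ⟨a, ha⟩ := G.cyclic ⟨x, hx⟩
  exact ⟨a, congrArg Subtype.val ha⟩

theorem GNS.π_vec (G : GNS w H) (a b : 𝒜) (h : G.vec b ∈ G.D) :
    (G.π a ⟨G.vec b, h⟩ : H) = G.vec (a * b) := by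
  change (G.π a (G.π b G.Ω) : H) = G.π (a * b) G.Ω
  rw [map_mul]; rfl

theorem GNS.denseRange_vec (G : GNS w H) : DenseRange G.vec := by
  refine G.dense.mono fun x hx => ?_
  exact G.exists_vec hx

theorem GNS.inner_vec (G : GNS w H) (a b : 𝒜) :
    inner ℂ (G.vec a) (G.vec b) = w (star a * b) := by
  rw [G.vev, map_mul, Module.End.mul_apply, G.π_star, star_star]
  rfl

theorem GNS.norm_vec_eq {H' : Type*} [NormedAddCommGroup H'] [InnerProductSpace ℂ H']
    (G : GNS w H) (f : 𝒜 →ₗ[ℂ] H') {a c : 𝒜}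
    (hf : inner ℂ (f a) (f a) = w (star c * c)) : ‖f a‖ = ‖G.vec c‖ := by
  rw [← G.inner_vec, inner_self_eq_norm_sq_to_K, inner_self_eq_norm_sq_to_K] at hf
  have h : ‖f a‖ ^ 2 = ‖G.vec c‖ ^ 2 := by exact_mod_cast hf
  exact (sq_eq_sq₀ (norm_nonneg _) (norm_nonneg _)).1 h

/-- A GNS representation is isometrically contained in every Hilbert space realization of the
inner product `w (a* b)`. -/
theorem GNS.exists_linearIsometry {H' : Type*} [NormedAddCommGroup H'] [InnerProductSpace ℂ H']
    [CompleteSpace H'] (G : GNS w H) (f : 𝒜 →ₗ[ℂ] H')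
    (hf : ∀ a b, inner ℂ (f a) (f b) = w (star a * b)) :
    ∃ J : H →ₗᵢ[ℂ] H', ∀ a, J (G.vec a) = f a :=
  exists_linearIsometry_of_norm_eq G.vec f G.denseRange_vec fun a => G.norm_vec_eq f (hf a a)

theorem GNS.Implements.map_vec {G : GNS w H} {β : 𝒜 ≃⋆ₐ[ℂ] 𝒜} {V : H ≃ₗᵢ[ℂ] H}
    (h : G.Implements β V) (a : 𝒜) : V (G.vec a) = G.vec (β a) := by
  rw [GNS.vec_apply, h.intertwines]
  have : (⟨V G.Ω, (h.mem_D_iff G.Ω).2 G.Ω.2⟩ : G.D) = G.Ω := Subtype.ext h.map_Ω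
  rw [this]; rfl

/-- By cyclicity every vector of the domain has the form π(b)Ω, so multiplicativity of β turns the
orbit formula into the full intertwining relation. -/
theorem GNS.implements_iff {G : GNS w H} {β : 𝒜 ≃⋆ₐ[ℂ] 𝒜} {V : H ≃ₗᵢ[ℂ] H} :
    G.Implements β V ↔ ∀ a, V (G.vec a) = G.vec (β a) := by
  refine ⟨fun h => h.map_vec, fun h => ?_⟩
  have hmem : ∀ x, V x ∈ G.D ↔ x ∈ G.D := by
    intro x
    constructor
    · intro hx
      obtain ⟨a, ha⟩ := G.exists_vec hx
      have : V (G.vec (β.symm a)) = V x := by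
        rw [h, StarAlgEquiv.apply_symm_apply, ha]
      rw [← V.injective this]
      exact G.vec_mem _
    · intro hx
      obtain ⟨a, rfl⟩ := G.exists_vec hx
      rw [h]
      exact G.vec_mem _
  refine ⟨?_, hmem, ?_⟩
  · rw [← G.vec_one, h, map_one]
  · rintro a ⟨x, hx⟩
    obtain ⟨b, rfl⟩ := G.exists_vec hx
    have h1 : ∀ hb : V (G.vec b) ∈ G.D, (G.π (β a) ⟨V (G.vec b), hb⟩ : H) =
        G.vec (β a * β b) := by
      rw [h]
      exact fun hb => G.π_vec _ _ hb
    rw [h1, G.π_vec, h, map_mul]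

theorem GNS.implements_unique {G : GNS w H} {β : 𝒜 ≃⋆ₐ[ℂ] 𝒜} {V V' : H ≃ₗᵢ[ℂ] H}
    (h : G.Implements β V) (h' : G.Implements β V') : V = V' := by
  ext x
  refine G.denseRange_vec.induction_on (p := fun x => V x = V' x) x
    (isClosed_eq V.continuous V'.continuous) fun a => ?_
  rw [h.map_vec, h'.map_vec]

/-- Invariance of w makes π(a)Ω ↦ π(βa)Ω isometric; the same construction for β⁻¹ supplies the
inverse. -/
theorem GNS.exists_implements [CompleteSpace H] (G : GNS w H) (β : 𝒜 ≃⋆ₐ[ℂ] 𝒜)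
    (hβ : ∀ a, w (β a) = w a) : ∃ V, G.Implements β V := by
  have key : ∀ β : 𝒜 ≃⋆ₐ[ℂ] 𝒜, (∀ a, w (β a) = w a) →
      ∃ J : H →ₗᵢ[ℂ] H, ∀ a, J (G.vec a) = G.vec (β a) := by
    intro β hβ
    refine G.exists_linearIsometry (G.vec ∘ₗ (β : 𝒜 →ₐ[ℂ] 𝒜).toLinearMap) fun a b => ?_
    change inner ℂ (G.vec (β a)) (G.vec (β b)) = _
    rw [G.inner_vec, ← map_star, ← map_mul, hβ]
  obtain ⟨J, hJ⟩ := key β hβ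
  obtain ⟨J', hJ'⟩ := key β.symm fun a => by rw [← hβ, StarAlgEquiv.apply_symm_apply]
  have h1 : ∀ x, J (J' x) = x := fun x =>
    G.denseRange_vec.induction_on (p := fun x => J (J' x) = x) x
      (isClosed_eq (J.continuous.comp J'.continuous) continuous_id) fun a => by
        rw [hJ', hJ, StarAlgEquiv.apply_symm_apply]
  exact ⟨LinearIsometryEquiv.ofSurjective J fun x => ⟨J' x, h1 x⟩, GNS.implements_iff.2 hJ⟩

theorem GNS.Implements.mul {G : GNS w H} {β β' : 𝒜 ≃⋆ₐ[ℂ] 𝒜} {V V' : H ≃ₗᵢ[ℂ] H}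
    (h : G.Implements β V) (h' : G.Implements β' V') : G.Implements (β * β') (V * V') :=
  GNS.implements_iff.2 fun a => by
    rw [LinearIsometryEquiv.coe_mul, Function.comp_apply, h'.map_vec, h.map_vec]
    rfl

/-- An action by automorphisms that leaves the state invariant is implemented by a unique
unitary representation. -/
theorem GNS.existsUnique_rep [CompleteSpace H] {Γ : Type*} [Group Γ] (α : Γ →* (𝒜 ≃⋆ₐ[ℂ] 𝒜))
    (hα : ∀ γ a, w (α γ a) = w a) (G : GNS w H) :
    ∃! V : Γ →* (H ≃ₗᵢ[ℂ] H), ∀ γ, G.Implements (α γ) (V γ) := by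
  choose V hV using fun γ => G.exists_implements (α γ) (hα γ)
  refine ⟨MonoidHom.mk' V fun γ γ' => ?_, hV, fun V' hV' => ?_⟩
  · refine GNS.implements_unique (hV _) ?_
    rw [map_mul]
    exact (hV γ).mul (hV γ')
  · ext1 γ
    exact GNS.implements_unique (hV' γ) (hV γ)

end GNSGeneral

/-! ### GNS representation from a Hilbert space realization of w(a*b) -/

section GNSConstruction

variable {𝒜 : Type*} [Ring 𝒜] [Algebra ℂ 𝒜] [StarRing 𝒜] {w : 𝒜 →ₗ[ℂ] ℂ}
  {H : Type*} [NormedAddCommGroup H] [InnerProductSpace ℂ H] {f : 𝒜 →ₗ[ℂ] H}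

theorem isState_of_inner (h1 : w 1 = 1) (hf : ∀ a b, inner ℂ (f a) (f b) = w (star a * b)) :
    IsState w := by
  refine ⟨h1, fun a => ?_⟩
  rw [← hf, inner_self_eq_norm_sq_to_K]
  norm_cast
  exact ⟨sq_nonneg _, Complex.ofReal_im _⟩

/-- The null space is a left ideal: ‖f(a(b - c))‖² = ⟨f(b - c), f(a*a(b - c))⟩. Hence left
multiplication does not depend on the preimage chosen in `gnsOp`. -/
theorem map_mul_congr_of_inner (hf : ∀ a b, inner ℂ (f a) (f b) = w (star a * b)) (a : 𝒜) {b c : 𝒜}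
    (h : f b = f c) : f (a * b) = f (a * c) := by
  rw [← sub_eq_zero, ← map_sub, ← mul_sub, ← inner_self_eq_zero (𝕜 := ℂ), hf, star_mul, mul_assoc,
    ← hf, map_sub, h, sub_self, inner_zero_left]

variable (f) in
/-- The closed subspace generated by a linear map. -/
def closedRange : Submodule ℂ H := (LinearMap.range f).topologicalClosure

omit [StarRing 𝒜] in
theorem mem_closedRange (a : 𝒜) : f a ∈ closedRange f :=
  Submodule.le_topologicalClosure _ ⟨a, rfl⟩

variable (f) in
/-- The common domain of the represented operators. -/
def gnsDomain : Submodule ℂ (closedRange f) := (LinearMap.range f).comap (closedRange f).subtype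

variable (f) in
/-- The vector of the domain given by an element of the algebra. -/
def gnsVec (a : 𝒜) : gnsDomain f := ⟨⟨f a, mem_closedRange a⟩, ⟨a, rfl⟩⟩

omit [StarRing 𝒜] in
theorem gnsVec_surjective : Function.Surjective (gnsVec f) := by
  rintro ⟨⟨x, hx⟩, ⟨a, ha⟩⟩
  exact ⟨a, Subtype.ext (Subtype.ext ha)⟩

omit [StarRing 𝒜] in
theorem gnsVec_eq_iff {a b : 𝒜} : gnsVec f a = gnsVec f b ↔ f a = f b := by
  rw [Subtype.ext_iff, Subtype.ext_iff]; rfl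

omit [StarRing 𝒜] in
theorem gnsVec_add (a b : 𝒜) : gnsVec f (a + b) = gnsVec f a + gnsVec f b :=
  Subtype.ext (Subtype.ext (map_add f a b))

omit [StarRing 𝒜] in
theorem gnsVec_smul (z : ℂ) (a : 𝒜) : gnsVec f (z • a) = z • gnsVec f a :=
  Subtype.ext (Subtype.ext (map_smul f z a))

variable (f) in
/-- Left multiplication on the domain. -/
def gnsOp (a : 𝒜) (x : gnsDomain f) : gnsDomain f :=
  gnsVec f (a * Function.surjInv gnsVec_surjective x)

theorem gnsOp_gnsVec (hf : ∀ a b, inner ℂ (f a) (f b) = w (star a * b)) (a b : 𝒜) :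
    gnsOp f a (gnsVec f b) = gnsVec f (a * b) :=
  gnsVec_eq_iff.2 (map_mul_congr_of_inner hf a
    (gnsVec_eq_iff.1 (Function.surjInv_eq gnsVec_surjective (gnsVec f b))))

/-- The representation by left multiplication on the domain. -/
def gnsRep (hf : ∀ a b, inner ℂ (f a) (f b) = w (star a * b)) :
    𝒜 →ₐ[ℂ] Module.End ℂ (gnsDomain f) :=
  { toFun := fun a =>
      { toFun := gnsOp f a
        map_add' := fun x y => by
          obtain ⟨b, rfl⟩ := gnsVec_surjective x
          obtain ⟨c, rfl⟩ := gnsVec_surjective y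
          rw [← gnsVec_add, gnsOp_gnsVec hf, gnsOp_gnsVec hf, gnsOp_gnsVec hf, mul_add,
            gnsVec_add]
        map_smul' := fun z x => by
          obtain ⟨b, rfl⟩ := gnsVec_surjective x
          rw [← gnsVec_smul, gnsOp_gnsVec hf, gnsOp_gnsVec hf, mul_smul_comm, gnsVec_smul,
            RingHom.id_apply] }
    map_one' := LinearMap.ext fun x => by
      obtain ⟨b, rfl⟩ := gnsVec_surjective x
      change gnsOp f 1 (gnsVec f b) = _
      rw [gnsOp_gnsVec hf, one_mul]; rfl
    map_mul' := fun a c => LinearMap.ext fun x => by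
      obtain ⟨b, rfl⟩ := gnsVec_surjective x
      change gnsOp f (a * c) (gnsVec f b) = gnsOp f a (gnsOp f c (gnsVec f b))
      rw [gnsOp_gnsVec hf, gnsOp_gnsVec hf, gnsOp_gnsVec hf, mul_assoc]
    map_zero' := LinearMap.ext fun x => by
      obtain ⟨b, rfl⟩ := gnsVec_surjective x
      change gnsOp f 0 (gnsVec f b) = 0
      rw [gnsOp_gnsVec hf, zero_mul]
      exact Subtype.ext (Subtype.ext (map_zero f))
    map_add' := fun a c => LinearMap.ext fun x => by
      obtain ⟨b, rfl⟩ := gnsVec_surjective x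
      change gnsOp f (a + c) (gnsVec f b) = gnsOp f a (gnsVec f b) + gnsOp f c (gnsVec f b)
      rw [gnsOp_gnsVec hf, gnsOp_gnsVec hf, gnsOp_gnsVec hf, add_mul, gnsVec_add]
    commutes' := fun z => LinearMap.ext fun x => by
      obtain ⟨b, rfl⟩ := gnsVec_surjective x
      change gnsOp f (algebraMap ℂ 𝒜 z) (gnsVec f b) = z • gnsVec f b
      rw [gnsOp_gnsVec hf, ← Algebra.smul_def, gnsVec_smul] }

theorem gnsRep_gnsVec (hf : ∀ a b, inner ℂ (f a) (f b) = w (star a * b)) (a b : 𝒜) :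
    gnsRep hf a (gnsVec f b) = gnsVec f (a * b) := gnsOp_gnsVec hf a b

omit [StarRing 𝒜] in
theorem inner_gnsVec (a b : 𝒜) :
    inner ℂ (gnsVec f a : closedRange f) (gnsVec f b : closedRange f) = inner ℂ (f a) (f b) := rfl

/-- The GNS representation on the closed range of a realization of the inner product `w (a* b)`. -/
def gnsOfInner (h1 : ∀ a, w (star 1 * a) = w a)
    (hf : ∀ a b, inner ℂ (f a) (f b) = w (star a * b)) : GNS w (closedRange f) where
  D := gnsDomain f
  dense := by
    rw [Subtype.dense_iff]
    intro x hx
    refine closure_mono ?_ hx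
    rintro _ ⟨a, rfl⟩
    exact ⟨⟨f a, mem_closedRange a⟩, ⟨a, rfl⟩, rfl⟩
  π := gnsRep hf
  π_star a x y := by
    obtain ⟨b, rfl⟩ := gnsVec_surjective x
    obtain ⟨c, rfl⟩ := gnsVec_surjective y
    rw [gnsRep_gnsVec, gnsRep_gnsVec, inner_gnsVec, inner_gnsVec, hf, hf, star_mul, star_star,
      mul_assoc]
  Ω := gnsVec f 1
  cyclic x := by
    obtain ⟨b, rfl⟩ := gnsVec_surjective x
    exact ⟨b, by rw [gnsRep_gnsVec, mul_one]⟩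
  vev a := by
    rw [gnsRep_gnsVec, mul_one, inner_gnsVec, hf, h1]

end GNSConstruction

/-! ### Unitary conjugation of one-parameter groups -/

section OneParameter

variable {H : Type*} [NormedAddCommGroup H] [InnerProductSpace ℂ H]

theorem generatorApply_conj_iff (U : ℝ → (H ≃ₗᵢ[ℂ] H)) (V : H ≃ₗᵢ[ℂ] H) (x y : H) :
    GeneratorApply (fun t => V⁻¹ * U t * V) x y ↔ GeneratorApply U (V x) (V y) := by
  have hV : ∀ z, V (V⁻¹ z) = z := fun z => V.apply_symm_apply z
  have hV' : ∀ z, V⁻¹ (V z) = z := fun z => V.symm_apply_apply z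
  constructor
  · intro h
    have := (V.toContinuousLinearEquiv : H →L[ℂ] H).restrictScalars ℝ |>.hasFDerivAt
      |>.comp_hasDerivAt (0 : ℝ) h
    refine (this.congr_deriv ?_).congr_of_eventuallyEq (Filter.Eventually.of_forall fun t => ?_)
    · exact map_smul V _ _
    · exact (hV _).symm
  · intro h
    have := (V.symm.toContinuousLinearEquiv : H →L[ℂ] H).restrictScalars ℝ |>.hasFDerivAt
      |>.comp_hasDerivAt (0 : ℝ) h
    refine this.congr_deriv ?_
    exact (map_smul V.symm _ _).trans (congrArg _ (hV' y))

theorem HasNonnegGenerator.conj {U : ℝ → (H ≃ₗᵢ[ℂ] H)} (h : HasNonnegGenerator U)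
    (V : H ≃ₗᵢ[ℂ] H) : HasNonnegGenerator fun t => V⁻¹ * U t * V where
  map_zero := by simp [h.map_zero]
  map_add t s := by rw [h.map_add]; group
  continuous x := V⁻¹.continuous.comp (h.continuous (V x))
  nonneg x y hxy := by
    rw [generatorApply_conj_iff] at hxy
    have := h.nonneg _ _ hxy
    rwa [V.inner_map_map] at this

end OneParameter

/-! ### The boundary algebra -/

section BdryAlgebra

theorem tensor_hom_ext {B : Type*} [Ring B] [Algebra ℂ B] {f g : BdryTensor →ₐ[ℂ] B}
    (h : ∀ ψ, f (tgen ψ) = g (tgen ψ)) : f = g := by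
  refine Algebra.TensorProduct.ext (R := ℝ) (S := ℂ) (A := ℂ) (B := TensorAlgebra ℝ bdrySpace)
    (C := B) (f := f) (g := g) (Subsingleton.elim _ _) ?_
  apply TensorAlgebra.hom_ext
  exact LinearMap.ext h

theorem bdry_hom_ext {B : Type*} [Ring B] [Algebra ℂ B] {f g : BdryAlgebra →ₐ[ℂ] B}
    (h : ∀ ψ, f (gen ψ) = g (gen ψ)) : f = g := by
  have h1 : f.comp toBdryAlgebra = g.comp toBdryAlgebra := tensor_hom_ext h
  exact RingQuot.ringQuot_ext' ℂ f g h1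

/-- The universal property of the tensor algebra. -/
def tensorLift {B : Type*} [Ring B] [Algebra ℂ B] (f : bdrySpace →ₗ[ℝ] B) :
    BdryTensor →ₐ[ℂ] B :=
  (Algebra.TensorProduct.lift (Algebra.ofId ℂ B) (TensorAlgebra.lift ℝ f)
    fun z x => Algebra.commutes z (TensorAlgebra.lift ℝ f x) :
      ℂ ⊗[ℝ] TensorAlgebra ℝ bdrySpace →ₐ[ℂ] B)

theorem tensorLift_tgen {B : Type*} [Ring B] [Algebra ℂ B] (f : bdrySpace →ₗ[ℝ] B)
    (ψ : bdrySpace) : tensorLift f (tgen ψ) = f ψ := by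
  refine (Algebra.TensorProduct.lift_tmul _ _ _ _ _).trans ?_
  simp

/-- The universal property of the boundary algebra. -/
def bdryLift {B : Type*} [Ring B] [Algebra ℂ B] (f : bdrySpace →ₗ[ℝ] B)
    (hf : ∀ ψ φ, f ψ * f φ - f φ * f ψ = algebraMap ℂ B (Complex.I * (bdrySymp ψ φ : ℂ))) :
    BdryAlgebra →ₐ[ℂ] B :=
  RingQuot.liftAlgHom ℂ ⟨tensorLift f, by
    rintro _ _ ⟨ψ, φ⟩
    rw [AlgHom.commutes, map_sub, map_mul, map_mul, tensorLift_tgen, tensorLift_tgen, hf]⟩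

theorem bdryLift_gen {B : Type*} [Ring B] [Algebra ℂ B] (f : bdrySpace →ₗ[ℝ] B)
    (hf : ∀ ψ φ, f ψ * f φ - f φ * f ψ = algebraMap ℂ B (Complex.I * (bdrySymp ψ φ : ℂ)))
    (ψ : bdrySpace) : bdryLift f hf (gen ψ) = f ψ :=
  (RingQuot.liftAlgHom_mkAlgHom_apply ℂ _ _ _).trans (tensorLift_tgen f ψ)

theorem gen_add (ψ φ : bdrySpace) : gen (ψ + φ) = gen ψ + gen φ := by
  have h : tgen (ψ + φ) = tgen ψ + tgen φ := by
    change (1 ⊗ₜ TensorAlgebra.ι ℝ (ψ + φ) : ℂ ⊗[ℝ] TensorAlgebra ℝ bdrySpace) = _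
    rw [map_add, TensorProduct.tmul_add]
    rfl
  rw [gen, h, map_add]; rfl

theorem gen_smul (r : ℝ) (ψ : bdrySpace) : gen (r • ψ) = (r : ℂ) • gen ψ := by
  have h : tgen (r • ψ) = (r : ℂ) • tgen ψ := by
    change (1 ⊗ₜ TensorAlgebra.ι ℝ (r • ψ) : ℂ ⊗[ℝ] TensorAlgebra ℝ bdrySpace) =
      (r : ℂ) • (1 ⊗ₜ TensorAlgebra.ι ℝ ψ : ℂ ⊗[ℝ] TensorAlgebra ℝ bdrySpace)
    rw [map_smul, ← TensorProduct.smul_tmul, TensorProduct.smul_tmul', Complex.real_smul,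
      smul_eq_mul]
  rw [gen, h, map_smul]; rfl

/-- The generators as a linear map. -/
def genLin : bdrySpace →ₗ[ℝ] BdryAlgebra where
  toFun := gen
  map_add' := gen_add
  map_smul' r ψ := (gen_smul r ψ).trans (Complex.coe_smul r (gen ψ))

/-- The universal property maps the algebra into the subalgebra generated by the [ψ]. Followed by
the inclusion this fixes the generators, so it is the identity. -/
theorem adjoin_gen : Algebra.adjoin ℂ (Set.range gen) = ⊤ := by
  have hmem : ∀ ψ, gen ψ ∈ Algebra.adjoin ℂ (Set.range gen) := fun ψ =>
    Algebra.subset_adjoin ⟨ψ, rfl⟩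
  let f : bdrySpace →ₗ[ℝ] Algebra.adjoin ℂ (Set.range gen) :=
    { toFun := fun ψ => ⟨gen ψ, hmem ψ⟩
      map_add' := fun ψ φ => Subtype.ext (gen_add ψ φ)
      map_smul' := fun r ψ => Subtype.ext (gen_smul r ψ) }
  have h : (Subalgebra.val _).comp (bdryLift f fun ψ φ => Subtype.ext (gen_comm ψ φ)) =
      AlgHom.id ℂ BdryAlgebra := bdry_hom_ext fun ψ => by
    rw [AlgHom.comp_apply, bdryLift_gen]; rfl
  rw [eq_top_iff]
  intro a _
  have ha := congrArg (fun g : BdryAlgebra →ₐ[ℂ] BdryAlgebra => g a) h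
  rw [← show _ = a from ha]
  exact Subtype.property _

/-- The boundary algebra is spanned by the products of generators. -/
theorem span_prod_gen : Submodule.span ℂ
    (Set.range fun L : List bdrySpace => (L.map gen).prod) = ⊤ := by
  have h := Algebra.adjoin_eq_span ℂ (Set.range gen)
  rw [adjoin_gen, Algebra.top_toSubmodule] at h
  rw [eq_top_iff, h]
  refine Submodule.span_mono ?_
  intro a ha
  obtain ⟨l, hl, rfl⟩ := Submonoid.exists_list_of_mem_closure ha
  choose! f hf using hl
  refine ⟨l.map f, ?_⟩
  change ((l.map f).map gen).prod = l.prod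
  rw [List.map_map]
  congr 1
  conv_rhs => rw [← List.map_id l]
  exact List.map_congr_left fun x hx => hf x hx

theorem bdry_linear_ext {M : Type*} [AddCommGroup M] [Module ℂ M] {f g : BdryAlgebra →ₗ[ℂ] M}
    (h : ∀ L : List bdrySpace, f (L.map gen).prod = g (L.map gen).prod) : f = g := by
  refine LinearMap.ext_on span_prod_gen ?_
  rintro _ ⟨L, rfl⟩
  exact h L

theorem bdry_induction {p : BdryAlgebra → Prop} (halg : ∀ z : ℂ, p (algebraMap ℂ _ z))
    (hgen : ∀ ψ, p (gen ψ)) (hadd : ∀ a b, p a → p b → p (a + b))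
    (hmul : ∀ a b, p a → p b → p (a * b)) (a : BdryAlgebra) : p a := by
  have ha : a ∈ Algebra.adjoin ℂ (Set.range gen) := by rw [adjoin_gen]; trivial
  refine Algebra.adjoin_induction (p := fun a _ => p a) ?_ halg (fun a b _ _ => hadd a b)
    (fun a b _ _ => hmul a b) ha
  rintro _ ⟨ψ, rfl⟩
  exact hgen ψ

/-- A symplectic linear map induces an endomorphism of the boundary algebra. -/
def sympHom (T : bdrySpace →ₗ[ℝ] bdrySpace) (hT : ∀ ψ φ, bdrySymp (T ψ) (T φ) = bdrySymp ψ φ) :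
    BdryAlgebra →ₐ[ℂ] BdryAlgebra :=
  bdryLift (genLin ∘ₗ T) fun ψ φ => by
    rw [← hT]; exact gen_comm (T ψ) (T φ)

theorem sympHom_gen (T : bdrySpace →ₗ[ℝ] bdrySpace)
    (hT : ∀ ψ φ, bdrySymp (T ψ) (T φ) = bdrySymp ψ φ) (ψ : bdrySpace) :
    sympHom T hT (gen ψ) = gen (T ψ) := bdryLift_gen _ _ ψ

theorem star_algebraMap_bdry (z : ℂ) :
    star (algebraMap ℂ BdryAlgebra z) = algebraMap ℂ BdryAlgebra (star z) := by
  rw [← AlgHom.commutes toBdryAlgebra, star_toBdryAlgebra, star_algebraMap_tensor,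
    AlgHom.commutes]

theorem sympHom_star (T : bdrySpace →ₗ[ℝ] bdrySpace)
    (hT : ∀ ψ φ, bdrySymp (T ψ) (T φ) = bdrySymp ψ φ) (a : BdryAlgebra) :
    sympHom T hT (star a) = star (sympHom T hT a) := by
  induction a using bdry_induction with
  | halg z => rw [star_algebraMap_bdry, AlgHom.commutes, AlgHom.commutes, star_algebraMap_bdry]
  | hgen ψ => rw [star_gen, sympHom_gen, star_gen]
  | hadd a b ha hb => rw [star_add, map_add, map_add, star_add, ha, hb]
  | hmul a b ha hb => rw [star_mul, map_mul, map_mul, star_mul, ha, hb]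

theorem starAlgEquiv_ext_gen {α β : BdryAlgebra ≃⋆ₐ[ℂ] BdryAlgebra}
    (h : ∀ ψ, α (gen ψ) = β (gen ψ)) : α = β := by
  have h1 : (α : BdryAlgebra →ₐ[ℂ] BdryAlgebra) = β := bdry_hom_ext h
  ext a
  exact congrArg (fun f : BdryAlgebra →ₐ[ℂ] BdryAlgebra => f a) h1

/-- Mutually inverse symplectic maps induce a `*`-automorphism of the boundary algebra. -/
def sympEquiv (T S : bdrySpace →ₗ[ℝ] bdrySpace)
    (hT : ∀ ψ φ, bdrySymp (T ψ) (T φ) = bdrySymp ψ φ)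
    (hS : ∀ ψ φ, bdrySymp (S ψ) (S φ) = bdrySymp ψ φ) (hTS : ∀ ψ, T (S ψ) = ψ)
    (hST : ∀ ψ, S (T ψ) = ψ) : BdryAlgebra ≃⋆ₐ[ℂ] BdryAlgebra where
  toFun := sympHom T hT
  invFun := sympHom S hS
  left_inv a := by
    have h : (sympHom S hS).comp (sympHom T hT) = AlgHom.id ℂ _ := bdry_hom_ext fun ψ => by
      rw [AlgHom.comp_apply, sympHom_gen, sympHom_gen, hST]; rfl
    exact congrArg (fun f : BdryAlgebra →ₐ[ℂ] BdryAlgebra => f a) h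
  right_inv a := by
    have h : (sympHom T hT).comp (sympHom S hS) = AlgHom.id ℂ _ := bdry_hom_ext fun ψ => by
      rw [AlgHom.comp_apply, sympHom_gen, sympHom_gen, hTS]; rfl
    exact congrArg (fun f : BdryAlgebra →ₐ[ℂ] BdryAlgebra => f a) h
  map_mul' := map_mul _
  map_add' := map_add _
  map_star' := sympHom_star T hT
  map_smul' z a := map_smul (sympHom T hT) z a

/-- Products of generators span the algebra, and on them a quasi-free functional is a polynomial in
two-point values. -/
theorem IsQuasiFree.ext {w w' : BdryAlgebra →ₗ[ℂ] ℂ} (h : IsQuasiFree w) (h' : IsQuasiFree w')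
    (h2 : ∀ ψ φ, w (gen ψ * gen φ) = w' (gen ψ * gen φ)) : w = w' := by
  refine bdry_linear_ext fun L => ?_
  have hL : (L.map gen).prod = (List.ofFn fun i : Fin L.length => gen (L.get i)).prod := by
    conv_lhs => rw [← List.ofFn_get L, List.map_ofFn]
    rfl
  rw [hL, h, h']
  simp only [h2]

theorem IsQuasiFree.comp {w : BdryAlgebra →ₗ[ℂ] ℂ} (h : IsQuasiFree w)
    {β : BdryAlgebra →ₐ[ℂ] BdryAlgebra} {T : bdrySpace → bdrySpace}
    (hβ : ∀ ψ, β (gen ψ) = gen (T ψ)) : IsQuasiFree (w ∘ₗ β.toLinearMap) := by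
  intro n ψ
  have h1 : β (List.ofFn fun i => gen (ψ i)).prod = (List.ofFn fun i => gen (T (ψ i))).prod := by
    rw [map_list_prod, List.map_ofFn]
    simp only [Function.comp_def, hβ]
  have h2 : ∀ a b, (w ∘ₗ β.toLinearMap) (gen a * gen b) = w (gen (T a) * gen (T b)) := by
    intro a b
    change w (β (gen a * gen b)) = _
    rw [map_mul, hβ, hβ]
  simp only [h2]
  rw [← h n fun i => T (ψ i), ← h1]
  rfl

end BdryAlgebra

/-! ### One-parameter unitary groups with nonnegative generator -/

section GroundState

variable {H : Type*} [NormedAddCommGroup H] [InnerProductSpace ℂ H]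

theorem norm_gaussian_le {b : ℝ} (hb : 0 ≤ b) {z : ℂ} {R : ℝ} (hz : ‖z‖ ≤ R) (s : ℝ) :
    ‖Complex.exp (-b * ((s : ℂ) - z) ^ 2)‖ ≤ Real.exp (b * R ^ 2) * Real.exp (-(b / 2) * s ^ 2) := by
  rw [Complex.norm_exp, ← Real.exp_add]
  apply Real.exp_le_exp.2
  have h1 : (-b * ((s : ℂ) - z) ^ 2).re = -b * ((s - z.re) ^ 2 - z.im ^ 2) := by
    simp [pow_two]
  have h2 : z.re ^ 2 + z.im ^ 2 ≤ R ^ 2 := by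
    have h3 : z.re ^ 2 + z.im ^ 2 = ‖z‖ ^ 2 := by
      rw [← Complex.normSq_eq_norm_sq, Complex.normSq_apply]; ring
    rw [h3]
    exact pow_le_pow_left₀ (norm_nonneg _) hz 2
  rw [h1]
  -- With x = Re z, the difference of (s - x)² and s²/2 - x² is (s - 2x)²/2.
  have h4 : 0 ≤ (s - 2 * z.re) ^ 2 := sq_nonneg _
  have h5 : (s ^ 2 / 2 - R ^ 2) ≤ (s - z.re) ^ 2 - z.im ^ 2 := by nlinarith
  nlinarith [mul_le_mul_of_nonneg_left h5 hb]

theorem integrable_gaussian_bound {b : ℝ} (hb : 0 < b) (R C : ℝ) :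
    Integrable fun s : ℝ => 2 * b * (|s| + R) *
      (Real.exp (b * R ^ 2) * Real.exp (-(b / 2) * s ^ 2)) * C := by
  have h1 := (integrable_mul_exp_neg_mul_sq (half_pos hb)).norm
  have h2 := integrable_exp_neg_mul_sq (half_pos hb)
  refine (((h1.const_mul (2 * b * Real.exp (b * R ^ 2) * C)).add
    (h2.const_mul (2 * b * R * Real.exp (b * R ^ 2) * C)))).congr
    (Filter.Eventually.of_forall fun s => ?_)
  simp only [Pi.add_apply, norm_mul, Real.norm_eq_abs, abs_of_pos (Real.exp_pos _)]
  ring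

/-- The Gaussian regularization of a vector along a one-parameter group. -/
def gaussSmooth (U : ℝ → (H ≃ₗᵢ[ℂ] H)) (b : ℝ) (x : H) (z : ℂ) : H :=
  ∫ s : ℝ, Complex.exp (-b * ((s : ℂ) - z) ^ 2) • U s x

/-- The derivative of `gaussSmooth`. -/
def gaussSmoothDeriv (U : ℝ → (H ≃ₗᵢ[ℂ] H)) (b : ℝ) (x : H) (z : ℂ) : H :=
  ∫ s : ℝ, (2 * b * ((s : ℂ) - z) * Complex.exp (-b * ((s : ℂ) - z) ^ 2)) • U s x

theorem HasNonnegGenerator.integrable_gaussian {U : ℝ → (H ≃ₗᵢ[ℂ] H)} (hU : HasNonnegGenerator U)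
    {b : ℝ} (hb : 0 < b) (x : H) (z : ℂ) :
    Integrable fun s : ℝ => Complex.exp (-b * ((s : ℂ) - z) ^ 2) • U s x := by
  have hc := hU.continuous x
  refine Integrable.mono' (((integrable_exp_neg_mul_sq (half_pos hb)).const_mul
    (Real.exp (b * ‖z‖ ^ 2))).mul_const ‖x‖)
    (Continuous.aestronglyMeasurable (by fun_prop)) (Filter.Eventually.of_forall fun s => ?_)
  rw [norm_smul, LinearIsometryEquiv.norm_map]
  exact mul_le_mul_of_nonneg_right (norm_gaussian_le hb.le le_rfl s) (norm_nonneg _)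

/-- The Gaussian is entire in z and its derivative has an integrable bound uniform on unit balls, so
the smoothed orbit is an entire vector-valued function. -/
theorem HasNonnegGenerator.hasDerivAt_gaussSmooth {U : ℝ → (H ≃ₗᵢ[ℂ] H)}
    (hU : HasNonnegGenerator U) {b : ℝ} (hb : 0 < b) (x : H) (z : ℂ) :
    HasDerivAt (gaussSmooth U b x) (gaussSmoothDeriv U b x z) z := by
  have hc := hU.continuous x
  refine (hasDerivAt_integral_of_dominated_loc_of_deriv_le (𝕜 := ℂ)
    (F := fun z s => Complex.exp (-b * ((s : ℂ) - z) ^ 2) • U s x)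
    (F' := fun z s => (2 * b * ((s : ℂ) - z) * Complex.exp (-b * ((s : ℂ) - z) ^ 2)) • U s x)
    (Metric.ball_mem_nhds z one_pos)
    (Filter.Eventually.of_forall fun z => (hU.integrable_gaussian hb x z).1)
    (hU.integrable_gaussian hb x z) (Continuous.aestronglyMeasurable (by fun_prop))
    (bound := fun s => 2 * b * (|s| + (‖z‖ + 1)) *
      (Real.exp (b * (‖z‖ + 1) ^ 2) * Real.exp (-(b / 2) * s ^ 2)) * ‖x‖)
    (Filter.Eventually.of_forall fun s z' hz' => ?_) (integrable_gaussian_bound hb _ _)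
    (Filter.Eventually.of_forall fun s z' _ => ?_)).2
  · have hz : ‖z'‖ ≤ ‖z‖ + 1 := by
      have h1 := norm_le_norm_add_norm_sub' z' z
      have h2 : ‖z' - z‖ < 1 := by rwa [← dist_eq_norm]
      linarith
    rw [norm_smul, LinearIsometryEquiv.norm_map, norm_mul]
    refine mul_le_mul_of_nonneg_right ?_ (norm_nonneg _)
    refine mul_le_mul ?_ (norm_gaussian_le hb.le hz s) (norm_nonneg _) (by positivity)
    rw [norm_mul, norm_mul, Complex.norm_real, Real.norm_of_nonneg hb.le, Complex.norm_ofNat]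
    refine mul_le_mul_of_nonneg_left ?_ (by positivity)
    refine (norm_sub_le _ _).trans (add_le_add ?_ hz)
    rw [Complex.norm_real, Real.norm_eq_abs]
  · have h1 : HasDerivAt (fun z : ℂ => -b * ((s : ℂ) - z) ^ 2) (2 * b * ((s : ℂ) - z')) z' := by
      have := (((hasDerivAt_id z').const_sub (s : ℂ)).pow 2).const_mul (-b : ℂ)
      refine this.congr_deriv ?_
      norm_num
      ring
    have h2 := h1.cexp.smul_const (U s x)
    rwa [mul_comm (Complex.exp _)] at h2

/-- Translation of the integration variable: the group acts on smoothed orbits by real shifts of z.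
-/
theorem HasNonnegGenerator.map_gaussSmooth [CompleteSpace H] {U : ℝ → (H ≃ₗᵢ[ℂ] H)}
    (hU : HasNonnegGenerator U) (b : ℝ) (x : H) (z : ℂ) (t : ℝ) :
    U t (gaussSmooth U b x z) = gaussSmooth U b x (z + t) := by
  have h1 := (U t).toLinearIsometry.integral_comp_comm (μ := (volume : Measure ℝ))
    (fun s : ℝ => Complex.exp (-b * ((s : ℂ) - z) ^ 2) • U s x)
  refine h1.symm.trans ?_
  rw [gaussSmooth]
  conv_rhs => rw [← integral_add_right_eq_self _ t]
  congr 1; funext s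
  change U t (Complex.exp (-b * ((s : ℂ) - z) ^ 2) • U s x) = _
  rw [map_smul, add_comm s t, hU.map_add]
  congr 2
  push_cast
  ring

/-- Smoothed vectors lie in the domain of the generator h, which acts on them as -i d/dz. -/
theorem HasNonnegGenerator.generatorApply_gaussSmooth [CompleteSpace H] {U : ℝ → (H ≃ₗᵢ[ℂ] H)}
    (hU : HasNonnegGenerator U) {b : ℝ} (hb : 0 < b) (x : H) (z : ℂ) :
    GeneratorApply U (gaussSmooth U b x z) (-Complex.I • gaussSmoothDeriv U b x z) := by
  rw [GeneratorApply, smul_smul, mul_neg, Complex.I_mul_I, neg_neg, one_smul]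
  have h1 : HasDerivAt (fun t : ℝ => z + (t : ℂ)) 1 0 :=
    (Complex.ofRealCLM.hasDerivAt (x := (0 : ℝ))).const_add z
  have h2 : HasDerivAt (gaussSmooth U b x) (gaussSmoothDeriv U b x z) (z + ((0 : ℝ) : ℂ)) := by
    simpa using hU.hasDerivAt_gaussSmooth hb x z
  have h3 := HasDerivAt.scomp (0 : ℝ) h2 h1
  rw [one_smul] at h3
  exact h3.congr_of_eventuallyEq (Filter.Eventually.of_forall fun t => hU.map_gaussSmooth b x z t)

/-- Upwards along the imaginary axis F' = -hF, so the derivative of ‖F‖² is -2 Re⟨F, hF⟩ ≤ 0. In the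
real direction the norm is constant, because the group is isometric. No spectral theorem is needed.
-/
theorem HasNonnegGenerator.norm_gaussSmooth_le [CompleteSpace H] {U : ℝ → (H ≃ₗᵢ[ℂ] H)}
    (hU : HasNonnegGenerator U) {b : ℝ} (hb : 0 < b) (x : H) {z : ℂ} (hz : 0 ≤ z.im) :
    ‖gaussSmooth U b x z‖ ≤ ‖gaussSmooth U b x 0‖ := by
  let F : ℝ → H := fun y => gaussSmooth U b x (y * Complex.I)
  have hF : ∀ y : ℝ, HasDerivAt F (Complex.I • gaussSmoothDeriv U b x (y * Complex.I)) y := by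
    intro y
    have h1 : HasDerivAt (fun y : ℝ => (y : ℂ) * Complex.I) Complex.I y := by
      simpa using (Complex.ofRealCLM.hasDerivAt (x := y)).mul_const Complex.I
    exact HasDerivAt.scomp y (hU.hasDerivAt_gaussSmooth hb x (y * Complex.I)) h1
  have hN : ∀ y : ℝ, HasDerivAt (fun y => (inner ℂ (F y) (F y)).re)
      (-2 * (inner ℂ (F y) (-Complex.I • gaussSmoothDeriv U b x (y * Complex.I))).re) y := by
    intro y
    have h1 := (HasDerivAt.inner ℂ (hF y) (hF y))
    have h2 := Complex.reCLM.hasFDerivAt.comp_hasDerivAt y h1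
    refine h2.congr_deriv ?_
    rw [Complex.reCLM_apply, Complex.add_re, ← inner_conj_symm (Complex.I • _) (F y),
      Complex.conj_re, neg_smul, inner_neg_right, Complex.neg_re]
    ring
  have hanti : Antitone fun y => (inner ℂ (F y) (F y)).re := by
    refine antitone_of_deriv_nonpos (fun y => (hN y).differentiableAt) fun y => ?_
    rw [(hN y).deriv]
    have := hU.nonneg _ _ (hU.generatorApply_gaussSmooth hb x (y * Complex.I))
    linarith
  have h0 := hanti hz
  have hsq : ∀ v : H, (inner ℂ v v).re = ‖v‖ ^ 2 := fun v => by
    rw [inner_self_eq_norm_sq_to_K]; norm_cast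
  simp only [hsq] at h0
  have h1 : ‖F z.im‖ = ‖gaussSmooth U b x z‖ := by
    rw [← (U z.re).norm_map, hU.map_gaussSmooth, add_comm, Complex.re_add_im]
  have h2 : F 0 = gaussSmooth U b x 0 := by simp [F]
  rw [h1, h2] at h0
  exact le_of_sq_le_sq h0 (norm_nonneg _)

/-- Real values on the axis give the reflection symmetry g(z̄) = conj g(z), which carries the bound
to the lower half-plane; Liouville's theorem applies. -/
theorem eq_of_bounded_upper_of_real {g : ℂ → ℂ} (hg : Differentiable ℂ g) {C : ℝ}
    (hC : ∀ z, 0 ≤ z.im → ‖g z‖ ≤ C) (hr : ∀ t : ℝ, (g t).im = 0) (z w : ℂ) : g z = g w := by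
  let h : ℂ → ℂ := (starRingEnd ℂ) ∘ g ∘ (starRingEnd ℂ)
  have hh : Differentiable ℂ h := fun z => by
    have := (hg ((starRingEnd ℂ) z)).conj_conj
    rwa [Complex.conj_conj] at this
  have heq : g = h := by
    -- Identity theorem: g and its reflection agree on the real points 1/(n+1), which accumulate at
    -- 0.
    refine AnalyticOnNhd.eq_of_frequently_eq (z₀ := 0) (fun z _ => hg.analyticAt z)
      (fun z _ => hh.analyticAt z) ?_
    have ht : Tendsto (fun n : ℕ => (((1 : ℝ) / (n + 1) : ℝ) : ℂ)) atTop (𝓝[≠] 0) := by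
      refine tendsto_nhdsWithin_iff.2 ⟨?_, Filter.Eventually.of_forall fun n => ?_⟩
      · have := (Complex.continuous_ofReal.tendsto 0).comp tendsto_one_div_add_atTop_nhds_zero_nat
        simpa [Function.comp_def] using this
      · simp only [Set.mem_compl_iff, Set.mem_singleton_iff, Complex.ofReal_eq_zero]
        positivity
    refine ht.frequently (Filter.Frequently.of_forall fun n => ?_)
    change _ = (starRingEnd ℂ) (g ((starRingEnd ℂ) _))
    rw [Complex.conj_ofReal, eq_comm, Complex.conj_eq_iff_im]
    exact hr _
  refine hg.apply_eq_apply_of_bounded ?_ z w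
  refine (isBounded_iff_forall_norm_le).2 ⟨C, ?_⟩
  rintro _ ⟨z, rfl⟩
  by_cases hz : 0 ≤ z.im
  · exact hC z hz
  · rw [heq]
    change ‖(starRingEnd ℂ) (g ((starRingEnd ℂ) z))‖ ≤ C
    rw [RCLike.norm_conj]
    apply hC
    rw [Complex.conj_im]
    linarith [not_le.1 hz]

/-- Rescaling by r = (m + 1)(s - t) shows an approximate identity at t. It removes the Gaussian
regularization. -/
theorem tendsto_gaussian_average {d : ℝ → ℂ} (hd : Continuous d) {C : ℝ} (hC : ∀ t, ‖d t‖ ≤ C)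
    (t : ℝ) :
    Tendsto (fun m : ℕ => ((m : ℝ) + 1) •
      ∫ s : ℝ, Complex.exp (-(((m : ℝ) + 1) ^ 2 : ℝ) * ((s : ℂ) - t) ^ 2) * d s) atTop
      (𝓝 (∫ r : ℝ, Complex.exp (-(r : ℂ) ^ 2) * d t)) := by
  have h1 : ∀ m : ℕ, ((m : ℝ) + 1) •
      ∫ s : ℝ, Complex.exp (-(((m : ℝ) + 1) ^ 2 : ℝ) * ((s : ℂ) - t) ^ 2) * d s =
      ∫ r : ℝ, Complex.exp (-(r : ℂ) ^ 2) * d (r / ((m : ℝ) + 1) + t) := by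
    intro m
    have hm : (0 : ℝ) < (m : ℝ) + 1 := by positivity
    rw [← integral_add_right_eq_self _ t]
    have h2 := Measure.integral_comp_mul_left
      (fun r : ℝ => Complex.exp (-(r : ℂ) ^ 2) * d (r / ((m : ℝ) + 1) + t)) ((m : ℝ) + 1)
    rw [abs_of_pos (inv_pos.2 hm)] at h2
    rw [eq_comm, ← inv_smul_eq_iff₀ hm.ne', ← h2]
    congr 1; funext s
    rw [mul_div_cancel_left₀ _ hm.ne']
    congr 2
    push_cast
    ring
  simp_rw [h1]
  refine tendsto_integral_of_dominated_convergence (fun r => Real.exp (-1 * r ^ 2) * C)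
    (fun m => Continuous.aestronglyMeasurable (by fun_prop))
    ((integrable_exp_neg_mul_sq one_pos).mul_const C) (fun m => ?_) ?_
  · refine Filter.Eventually.of_forall fun r => ?_
    rw [norm_mul, Complex.norm_exp]
    refine mul_le_mul (le_of_eq ?_) (hC _) (norm_nonneg _) (Real.exp_pos _).le
    congr 1
    simp [pow_two]
  · refine Filter.Eventually.of_forall fun r => Tendsto.const_mul _ ?_
    have h3 : Tendsto (fun m : ℕ => r / ((m : ℝ) + 1) + t) atTop (𝓝 t) := by
      have := (tendsto_one_div_add_atTop_nhds_zero_nat (𝕜 := ℝ)).const_mul r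
      simpa [div_eq_mul_inv] using this.add_const t
    exact (hd.tendsto t).comp h3

theorem integral_cexp_neg_sq_ne_zero : ∫ r : ℝ, Complex.exp (-(r : ℂ) ^ 2) ≠ 0 := by
  have h : ∫ r : ℝ, Complex.exp (-(r : ℂ) ^ 2) = ((∫ r : ℝ, Real.exp (-1 * r ^ 2) : ℝ) : ℂ) := by
    rw [← integral_complex_ofReal]
    congr 1; funext r
    push_cast
    ring_nf
  rw [h, integral_gaussian]
  simp [Real.sqrt_eq_zero', Real.pi_pos]

variable {H' : Type*} [NormedAddCommGroup H'] [InnerProductSpace ℂ H']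

/-- If the difference of two correlation functions of positive energy is real, it is constant. -/
theorem correlation_sub_const [CompleteSpace H] [CompleteSpace H'] {U : ℝ → (H ≃ₗᵢ[ℂ] H)}
    {U' : ℝ → (H' ≃ₗᵢ[ℂ] H')} (hU : HasNonnegGenerator U) (hU' : HasNonnegGenerator U')
    (x y : H) (x' y' : H')
    (hr : ∀ t, (inner ℂ x (U t y) - inner ℂ x' (U' t y')).im = 0) (t : ℝ) :
    inner ℂ x (U t y) - inner ℂ x' (U' t y') = inner ℂ x y - inner ℂ x' y' := by
  let d : ℝ → ℂ := fun t => inner ℂ x (U t y) - inner ℂ x' (U' t y')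
  have hcont : Continuous d :=
    (continuous_const.inner (hU.continuous y)).sub (continuous_const.inner (hU'.continuous y'))
  have hbd : ∀ t, ‖d t‖ ≤ ‖x‖ * ‖y‖ + ‖x'‖ * ‖y'‖ := by
    intro t
    refine (norm_sub_le _ _).trans (add_le_add ?_ ?_)
    · exact (norm_inner_le_norm _ _).trans_eq (by rw [LinearIsometryEquiv.norm_map])
    · exact (norm_inner_le_norm _ _).trans_eq (by rw [LinearIsometryEquiv.norm_map])
  let g : ℝ → ℂ → ℂ := fun b z => inner ℂ x (gaussSmooth U b y z) -
    inner ℂ x' (gaussSmooth U' b y' z)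
  -- The difference of the smoothed correlations is the Gaussian average of d.
  have hg : ∀ b : ℝ, 0 < b → ∀ z, g b z = ∫ s : ℝ, Complex.exp (-b * ((s : ℂ) - z) ^ 2) * d s := by
    intro b hb z
    change inner ℂ x (gaussSmooth U b y z) - inner ℂ x' (gaussSmooth U' b y' z) = _
    have i1 := hU.integrable_gaussian hb y z
    have i2 := hU'.integrable_gaussian hb y' z
    rw [gaussSmooth, gaussSmooth, ← integral_inner i1, ← integral_inner i2,
      ← integral_sub (i1.const_inner x) (i2.const_inner x')]
    congr 1; funext s
    rw [inner_smul_right, inner_smul_right, ← mul_sub]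
  -- Positivity of both generators bounds g in the upper half-plane; on the real axis both the
  -- Gaussian weight and d are real.
  have hconst : ∀ b : ℝ, 0 < b → ∀ z w, g b z = g b w := by
    intro b hb
    refine eq_of_bounded_upper_of_real (C := ‖x‖ * ‖gaussSmooth U b y 0‖ +
      ‖x'‖ * ‖gaussSmooth U' b y' 0‖) ?_ ?_ ?_
    · intro z
      have h1 := ((innerSL ℂ x).hasFDerivAt.comp_hasDerivAt z (hU.hasDerivAt_gaussSmooth hb y z))
      have h2 := ((innerSL ℂ x').hasFDerivAt.comp_hasDerivAt z
        (hU'.hasDerivAt_gaussSmooth hb y' z))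
      exact (h1.sub h2).differentiableAt
    · intro z hz
      refine (norm_sub_le _ _).trans (add_le_add ?_ ?_)
      · exact (norm_inner_le_norm _ _).trans
          (mul_le_mul_of_nonneg_left (hU.norm_gaussSmooth_le hb y hz) (norm_nonneg _))
      · exact (norm_inner_le_norm _ _).trans
          (mul_le_mul_of_nonneg_left (hU'.norm_gaussSmooth_le hb y' hz) (norm_nonneg _))
    · intro t
      have h1 : ∀ s : ℝ, Complex.exp (-b * ((s : ℂ) - t) ^ 2) * d s =
          ((Real.exp (-b * (s - t) ^ 2) * (d s).re : ℝ) : ℂ) := by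
        intro s
        have : d s = ((d s).re : ℂ) := Complex.ext rfl (by rw [Complex.ofReal_im]; exact hr s)
        rw [this]
        push_cast
        simp
      rw [hg b hb]
      simp_rw [h1]
      rw [integral_complex_ofReal, Complex.ofReal_im]
  -- At every width the averages around t and around 0 agree; let the width tend to 0.
  have key : ∀ t, (∫ r : ℝ, Complex.exp (-(r : ℂ) ^ 2) * d t) =
      ∫ r : ℝ, Complex.exp (-(r : ℂ) ^ 2) * d 0 := by
    intro t
    refine tendsto_nhds_unique (tendsto_gaussian_average hcont hbd t) ?_
    refine (tendsto_gaussian_average hcont hbd 0).congr fun m => ?_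
    have hm : (0 : ℝ) < ((m : ℝ) + 1) ^ 2 := by positivity
    rw [← hg _ hm (t : ℂ), ← hg _ hm ((0 : ℝ) : ℂ), hconst _ hm _ (t : ℂ)]
  have h := key t
  rw [integral_mul_const, integral_mul_const] at h
  have h2 := mul_left_cancel₀ integral_cexp_neg_sq_ne_zero h
  change d t = _
  rw [h2]
  simp only [d, hU.map_zero, hU'.map_zero]
  rfl

theorem generatorApply_zero_of_fixed {U : ℝ → (H ≃ₗᵢ[ℂ] H)} {x : H} (h : ∀ t, U t x = x) :
    GeneratorApply U x 0 := by
  rw [GeneratorApply, smul_zero]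
  simp only [h]
  exact hasDerivAt_const _ _

theorem intervalIntegrable_correlation {U : ℝ → (H ≃ₗᵢ[ℂ] H)} (hU : HasNonnegGenerator U)
    (x y : H) (a b : ℝ) : IntervalIntegrable (fun t => inner ℂ x (U t y)) volume a b :=
  (continuous_const.inner (hU.continuous y)).intervalIntegrable _ _

theorem norm_integral_correlation_le (U : ℝ → (H ≃ₗᵢ[ℂ] H)) (x y : H) (a b : ℝ) :
    ‖∫ t in a..b, inner ℂ x (U t y)‖ ≤ ‖x‖ * ‖y‖ * |b - a| :=
  intervalIntegral.norm_integral_le_of_norm_le_const fun t _ =>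
    (norm_inner_le_norm _ _).trans_eq (by rw [LinearIsometryEquiv.norm_map])

/-- Without zero modes, the time averages of correlation functions tend to zero. -/
theorem tendsto_average_correlation [CompleteSpace H] {U : ℝ → (H ≃ₗᵢ[ℂ] H)}
    (hU : HasNonnegGenerator U) (M : Submodule ℂ H) (hM : IsClosed (M : Set H))
    (hinv : ∀ t, ∀ x ∈ M, U t x ∈ M) (hzero : ∀ x ∈ M, GeneratorApply U x 0 → x = 0)
    (x : H) {y : H} (hy : y ∈ M) :
    Tendsto (fun T : ℝ => T⁻¹ • ∫ t in (0 : ℝ)..T, inner ℂ x (U t y)) atTop (𝓝 0) := by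
  -- The vectors whose averaged correlation with x vanishes. N is closed because the averages are
  -- bounded uniformly in T.
  let N : Submodule ℂ H :=
    { carrier := {y | Tendsto (fun T : ℝ => T⁻¹ • ∫ t in (0 : ℝ)..T, inner ℂ x (U t y)) atTop (𝓝 0)}
      add_mem' := by
        intro a b ha hb
        have := Tendsto.add ha hb
        rw [add_zero] at this
        refine this.congr fun T => ?_
        rw [← smul_add, ← intervalIntegral.integral_add (intervalIntegrable_correlation hU x a _ _)
          (intervalIntegrable_correlation hU x b _ _)]
        simp only [map_add, inner_add_right]
      zero_mem' := by simp
      smul_mem' := by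
        intro c a ha
        have := Tendsto.const_mul c ha
        rw [mul_zero] at this
        refine this.congr fun T => ?_
        rw [mul_smul_comm, ← intervalIntegral.integral_const_mul]
        simp only [map_smul, inner_smul_right] }
  have hNclosed : IsClosed (N : Set H) := by
    refine isClosed_of_closure_subset fun p hp => ?_
    change Tendsto _ _ _
    rw [Metric.tendsto_atTop]
    intro ε hε
    obtain ⟨q, hq, hpq⟩ := Metric.mem_closure_iff.1 hp (ε / (2 * (‖x‖ + 1))) (by positivity)
    obtain ⟨T0, hT0⟩ := (Metric.tendsto_atTop.1 (show Tendsto _ _ _ from hq)) (ε / 2) (half_pos hε)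
    refine ⟨max T0 1, fun T hT => ?_⟩
    have hT1 : 0 < T := lt_of_lt_of_le one_pos ((le_max_right _ _).trans hT)
    have h1 := hT0 T ((le_max_left _ _).trans hT)
    rw [dist_zero_right] at h1 ⊢
    have h2 : (T⁻¹ • ∫ t in (0 : ℝ)..T, inner ℂ x (U t p)) =
        (T⁻¹ • ∫ t in (0 : ℝ)..T, inner ℂ x (U t q)) +
        T⁻¹ • ∫ t in (0 : ℝ)..T, inner ℂ x (U t (p - q)) := by
      rw [← smul_add, ← intervalIntegral.integral_add (intervalIntegrable_correlation hU x q _ _)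
        (intervalIntegrable_correlation hU x (p - q) _ _)]
      simp only [map_sub, inner_sub_right, add_sub_cancel]
    have h3 : ‖T⁻¹ • ∫ t in (0 : ℝ)..T, inner ℂ x (U t (p - q))‖ ≤ ‖x‖ * ‖p - q‖ := by
      rw [norm_smul, norm_inv, Real.norm_of_nonneg hT1.le]
      have := norm_integral_correlation_le U x (p - q) 0 T
      rw [sub_zero, abs_of_pos hT1] at this
      calc T⁻¹ * _ ≤ T⁻¹ * (‖x‖ * ‖p - q‖ * T) := by gcongr
        _ = _ := by field_simp
    have h4 : ‖x‖ * ‖p - q‖ < ε / 2 := by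
      rw [← dist_eq_norm]
      calc ‖x‖ * dist p q ≤ (‖x‖ + 1) * dist p q := by gcongr; linarith
        _ < (‖x‖ + 1) * (ε / (2 * (‖x‖ + 1))) := by gcongr
        _ = ε / 2 := by field_simp
    rw [h2]
    refine (norm_add_le _ _).trans_lt ?_
    linarith
  -- The average over [0,T] telescopes to integrals over two intervals of length |s|, which are
  -- bounded while the prefactor is 1/T.
  have hdiff : ∀ s, ∀ m, U s m - m ∈ N := by
    intro s m
    change Tendsto _ _ _
    have hb : ∀ᶠ T : ℝ in atTop, ‖T⁻¹ • ∫ t in (0 : ℝ)..T, inner ℂ x (U t (U s m - m))‖ ≤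
        T⁻¹ * (2 * (‖x‖ * ‖m‖ * |s|)) := by
      filter_upwards [eventually_gt_atTop 0] with T hT
      rw [norm_smul, norm_inv, Real.norm_of_nonneg hT.le]
      refine mul_le_mul_of_nonneg_left ?_ (inv_pos.2 hT).le
      have h1 : (∫ t in (0 : ℝ)..T, inner ℂ x (U t (U s m - m))) =
          (∫ t in (0 + s : ℝ)..(T + s), inner ℂ x (U t m)) -
            ∫ t in (0 : ℝ)..T, inner ℂ x (U t m) := by
        rw [← intervalIntegral.integral_comp_add_right (fun t => inner ℂ x (U t m)),
          ← intervalIntegral.integral_sub]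
        · congr 1; funext t
          rw [map_sub, inner_sub_right, hU.map_add]
          rfl
        · exact ((continuous_const.inner (hU.continuous m)).comp
            (continuous_id.add continuous_const)).intervalIntegrable _ _
        · exact intervalIntegrable_correlation hU x m _ _
      rw [h1, intervalIntegral.integral_interval_sub_interval_comm'
        (intervalIntegrable_correlation hU x m _ _) (intervalIntegrable_correlation hU x m _ _)
        (intervalIntegrable_correlation hU x m _ _)]
      refine (norm_sub_le _ _).trans ?_
      have h2 := norm_integral_correlation_le U x m T (T + s)
      have h3 := norm_integral_correlation_le U x m 0 (0 + s)
      rw [add_sub_cancel_left] at h2 h3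
      linarith
    refine squeeze_zero_norm' hb ?_
    have := tendsto_inv_atTop_zero (𝕜 := ℝ).mul_const (2 * (‖x‖ * ‖m‖ * |s|))
    rwa [zero_mul] at this
  let N0 : Submodule ℂ H := (Submodule.span ℂ {v | ∃ s, ∃ m ∈ M, v = U s m - m}).topologicalClosure
  have hN0N : N0 ≤ N := by
    refine Submodule.topologicalClosure_minimal _ (Submodule.span_le.2 ?_) hNclosed
    rintro _ ⟨s, m, -, rfl⟩
    exact hdiff s m
  have hN0M : N0 ≤ M := by
    refine Submodule.topologicalClosure_minimal _ (Submodule.span_le.2 ?_) hM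
    rintro _ ⟨s, m, hm, rfl⟩
    exact M.sub_mem (hinv s m hm) hm
  have : CompleteSpace N0 := (Submodule.isClosed_topologicalClosure _).completeSpace_coe
  -- Mean ergodic decomposition: a vector of M orthogonal to every U_s m - m with m in M is fixed by
  -- the group, hence is a zero mode and vanishes.
  obtain ⟨p, hp, q, hq, rfl⟩ := N0.exists_add_mem_mem_orthogonal y
  have hqM : q ∈ M := by
    have := M.sub_mem hy (hN0M hp)
    rwa [add_sub_cancel_left] at this
  have hq0 : q = 0 := by
    refine hzero q hqM (generatorApply_zero_of_fixed fun t => ?_)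
    rw [← sub_eq_zero, ← inner_self_eq_zero (𝕜 := ℂ)]
    have h1 : ∀ m ∈ M, inner ℂ (U t q - q) m = 0 := by
      intro m hm
      have h2 : inner ℂ (U (-t) m - m) q = 0 :=
        hq _ (Submodule.le_topologicalClosure _ (Submodule.subset_span ⟨-t, m, hm, rfl⟩))
      have h3 : U t (U (-t) m) = m := by
        have := hU.map_add t (-t)
        rw [add_neg_cancel, hU.map_zero] at this
        exact (congrArg (fun V : H ≃ₗᵢ[ℂ] H => V m) this).symm
      have h4 : inner ℂ (U t q) m = inner ℂ q (U (-t) m) := by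
        conv_lhs => rw [← h3]
        rw [LinearIsometryEquiv.inner_map_map]
      rw [inner_sub_left, h4, ← inner_sub_right, ← inner_conj_symm, h2, map_zero]
    exact h1 _ (M.sub_mem (hinv t q hqM) hqM)
  rw [hq0, add_zero]
  exact hN0N hp

/-- Two ground states without zero modes whose correlation functions differ by real functions have
the same correlation functions. -/
theorem correlation_eq [CompleteSpace H] [CompleteSpace H'] {U : ℝ → (H ≃ₗᵢ[ℂ] H)}
    {U' : ℝ → (H' ≃ₗᵢ[ℂ] H')} (hU : HasNonnegGenerator U) (hU' : HasNonnegGenerator U')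
    (M : Submodule ℂ H) (hM : IsClosed (M : Set H))
    (hinv : ∀ t, ∀ x ∈ M, U t x ∈ M) (hzero : ∀ x ∈ M, GeneratorApply U x 0 → x = 0)
    (M' : Submodule ℂ H') (hM' : IsClosed (M' : Set H'))
    (hinv' : ∀ t, ∀ x ∈ M', U' t x ∈ M') (hzero' : ∀ x ∈ M', GeneratorApply U' x 0 → x = 0)
    (x : H) {y : H} (hy : y ∈ M) (x' : H') {y' : H'} (hy' : y' ∈ M')
    (hr : ∀ t, (inner ℂ x (U t y) - inner ℂ x' (U' t y')).im = 0) :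
    inner ℂ x y = inner ℂ x' y' := by
  have h1 := (tendsto_average_correlation hU M hM hinv hzero x hy).sub
    (tendsto_average_correlation hU' M' hM' hinv' hzero' x' hy')
  rw [sub_zero] at h1
  -- The difference of the correlations is constant in t, so it equals its own time average.
  have h2 : Tendsto (fun T : ℝ => (T⁻¹ • ∫ t in (0 : ℝ)..T, inner ℂ x (U t y)) -
      (T⁻¹ • ∫ t in (0 : ℝ)..T, inner ℂ x' (U' t y'))) atTop
      (𝓝 (inner ℂ x y - inner ℂ x' y')) := by
    refine tendsto_const_nhds.congr' ?_
    filter_upwards [eventually_gt_atTop 0] with T hT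
    rw [← smul_sub, ← intervalIntegral.integral_sub (intervalIntegrable_correlation hU x y _ _)
      (intervalIntegrable_correlation hU' x' y' _ _)]
    simp only [correlation_sub_const hU hU' x y x' y' hr]
    rw [intervalIntegral.integral_const, sub_zero, smul_smul, inv_mul_cancel₀ hT.ne', one_smul]
  exact sub_eq_zero.1 (tendsto_nhds_unique h2 h1)

end GroundState

/-! ### The conformal action on the sphere and the surface measure -/

section SphereJacobian

theorem continuous_sphereAct (A : SL2C) : Continuous (sphereAct A) :=
  (contMDiff_sphereAct A).continuous

theorem continuous_dilation (A : SL2C) : Continuous fun s : S2 => dilation A s :=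
  (contMDiff_dilation A).continuous

theorem continuous_confFactor (A : SL2C) : Continuous (confFactor A) :=
  (continuous_dilation A).inv₀ fun s => (dilation_pos A s).ne'

/-- `K_A²` is the Jacobian of the action of `A` on the sphere. -/
def IsConformalJacobian (A : SL2C) : Prop :=
  ∀ f : S2 → ENNReal, Measurable f →
    ∫⁻ s, f (sphereAct A s) * ENNReal.ofReal (confFactor A s ^ 2) ∂sphereMeasure =
      ∫⁻ s, f s ∂sphereMeasure

theorem IsConformalJacobian.mul {A B : SL2C} (hA : IsConformalJacobian A)
    (hB : IsConformalJacobian B) : IsConformalJacobian (A * B) := by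
  intro f hf
  have hm : Measurable fun s => f (sphereAct A s) * ENNReal.ofReal (confFactor A s ^ 2) :=
    (hf.comp (continuous_sphereAct A).measurable).mul
      ((continuous_confFactor A).pow 2).measurable.ennreal_ofReal
  rw [← hA f hf, ← hB _ hm]
  congr 1; funext s
  rw [sphereAct_mul, confFactor_mul, mul_pow, ENNReal.ofReal_mul (sq_nonneg _), mul_assoc]

theorem lintegral_compl_zero_eq {h : E3 → ENNReal} (hh : Measurable h) :
    ∫⁻ v in ({0}ᶜ : Set E3), h v = ∫⁻ s, ∫⁻ r, h ((r : ℝ) • (s : E3))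
      ∂(Measure.volumeIoiPow 2) ∂sphereMeasure := by
  have h1 := (Measure.measurePreserving_homeomorphUnitSphereProd (volume : Measure E3))
  have hdim : Module.finrank ℝ E3 - 1 = 2 := by simp
  rw [hdim] at h1
  have hm : Measurable fun p : S2 × Set.Ioi (0 : ℝ) => h ((p.2 : ℝ) • (p.1 : E3)) :=
    hh.comp (by fun_prop)
  rw [← lintegral_subtype_comap (measurableSet_singleton 0).compl]
  have h2 : ∀ v : ({0}ᶜ : Set E3), h v =
      (fun p : S2 × Set.Ioi (0 : ℝ) => h ((p.2 : ℝ) • (p.1 : E3)))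
        (homeomorphUnitSphereProd E3 v) := by
    intro v
    change _ = h ((homeomorphUnitSphereProd E3 v).2.1 • (homeomorphUnitSphereProd E3 v).1.1)
    rw [← homeomorphUnitSphereProd_symm_apply_coe, Homeomorph.symm_apply_apply]
  simp_rw [h2]
  rw [h1.lintegral_comp hm, lintegral_prod _ hm.aemeasurable]
  rfl

/-- The radial measure is r² dr, so the ray up to 1/c has mass c⁻³/3. -/
theorem lintegral_radial {c : ℝ} (hc : 0 < c) (a : ENNReal) :
    ∫⁻ r : Set.Ioi (0 : ℝ), (if (r : ℝ) * c < 1 then a else 0) ∂(Measure.volumeIoiPow 2) =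
      a * ENNReal.ofReal ((c⁻¹) ^ 3 / 3) := by
  have h : ∀ r : Set.Ioi (0 : ℝ), (if (r : ℝ) * c < 1 then a else 0) =
      (Set.Iio (⟨c⁻¹, inv_pos.2 hc⟩ : Set.Ioi (0 : ℝ))).indicator (fun _ => a) r := by
    intro r
    rw [Set.indicator_apply]
    congr 1
    rw [Set.mem_Iio, ← Subtype.coe_lt_coe, lt_inv_comm₀ r.2 hc, ← one_div, lt_div_iff₀ r.2, mul_comm]
  simp_rw [h]
  rw [lintegral_indicator_const measurableSet_Iio, Measure.volumeIoiPow_apply_Iio]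
  norm_num

/-- The Hermitian matrix of the point `(‖v‖, v)` of the light cone. -/
def coneMatrix (v : E3) : Matrix (Fin 2) (Fin 2) ℂ :=
  !![((‖v‖ + v 2 : ℝ) : ℂ) / 2, ((v 0 : ℂ) + Complex.I * (v 1 : ℂ)) / 2;
     ((v 0 : ℂ) - Complex.I * (v 1 : ℂ)) / 2, ((‖v‖ - v 2 : ℝ) : ℂ) / 2]

/-- The action of `SL(2, ℂ)` on the light cone. -/
def coneMap (A : SL2C) (v : E3) : E3 := vecPart (A.1 * coneMatrix v * A.1ᴴ)

theorem coneMatrix_smul {r : ℝ} (hr : 0 ≤ r) (s : S2) :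
    coneMatrix (r • (s : E3)) = (r : ℂ) • spinProj s := by
  have h : ‖r • (s : E3)‖ = r := by
    rw [norm_smul, norm_eq_of_mem_sphere, mul_one, Real.norm_of_nonneg hr]
  ext i j
  fin_cases i <;> fin_cases j <;> simp [coneMatrix, spinProj, h] <;> ring

theorem vecPart_smul (r : ℝ) (M : Matrix (Fin 2) (Fin 2) ℂ) :
    vecPart ((r : ℂ) • M) = r • vecPart M := by
  ext i
  fin_cases i <;> simp [vecPart] <;> ring

/-- In polar coordinates the action on the cone is the conformal map on directions, with the energy
multiplied by the dilation factor 1/K. -/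
theorem coneMap_smul (A : SL2C) {r : ℝ} (hr : 0 ≤ r) (s : S2) :
    coneMap A (r • (s : E3)) = (r * dilation A s) • (sphereAct A s : E3) := by
  have h : A.1 * coneMatrix (r • (s : E3)) * A.1ᴴ = (r : ℂ) • spinConj A s := by
    rw [coneMatrix_smul hr]; simp [spinConj]
  rw [coneMap, h, vecPart_smul, mul_smul]
  change r • vecPart (spinConj A s) = r • dilation A s • ((dilation A s)⁻¹ • vecPart (spinConj A s))
  rw [smul_smul (dilation A s), mul_inv_cancel₀ (dilation_pos A s).ne', one_smul]

theorem exists_smul_sphere {v : E3} (hv : v ≠ 0) : ∃ r : ℝ, 0 < r ∧ ∃ s : S2, v = r • (s : E3) := by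
  refine ⟨‖v‖, norm_pos_iff.2 hv, ⟨‖v‖⁻¹ • v, ?_⟩, ?_⟩
  · rw [mem_sphere_zero_iff_norm, norm_smul, norm_inv, norm_norm,
      inv_mul_cancel₀ (norm_ne_zero_iff.2 hv)]
  · change v = ‖v‖ • (‖v‖⁻¹ • v)
    rw [smul_smul, mul_inv_cancel₀ (norm_ne_zero_iff.2 hv), one_smul]

theorem coneMap_coneMap (A B : SL2C) {v : E3} (hv : v ≠ 0) :
    coneMap A (coneMap B v) = coneMap (A * B) v := by
  obtain ⟨r, hr, s, rfl⟩ := exists_smul_sphere hv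
  rw [coneMap_smul B hr.le, coneMap_smul A (mul_pos hr (dilation_pos B s)).le, coneMap_smul _ hr.le,
    dilation_mul, sphereAct_mul]
  congr 1
  ring

theorem coneMap_one {v : E3} (hv : v ≠ 0) : coneMap 1 v = v := by
  obtain ⟨r, hr, s, rfl⟩ := exists_smul_sphere hv
  rw [coneMap_smul 1 hr.le, dilation_one, sphereAct_one, mul_one]

theorem coneMap_ne_zero (A : SL2C) {v : E3} (hv : v ≠ 0) : coneMap A v ≠ 0 := by
  obtain ⟨r, hr, s, rfl⟩ := exists_smul_sphere hv
  rw [coneMap_smul A hr.le]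
  exact smul_ne_zero (mul_pos hr (dilation_pos A s)).ne' (ne_zero_of_mem_unit_sphere _)

theorem injOn_coneMap (A : SL2C) : Set.InjOn (coneMap A) {0}ᶜ := by
  intro v hv v' hv' h
  rw [← coneMap_one hv, ← coneMap_one hv', ← inv_mul_cancel A, ← coneMap_coneMap _ _ hv,
    ← coneMap_coneMap _ _ hv', h]

theorem image_coneMap (A : SL2C) : coneMap A '' {0}ᶜ = {0}ᶜ := by
  ext v
  constructor
  · rintro ⟨v, hv, rfl⟩
    exact coneMap_ne_zero A hv
  · intro hv
    refine ⟨coneMap A⁻¹ v, coneMap_ne_zero _ hv, ?_⟩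
    rw [coneMap_coneMap _ _ hv, mul_inv_cancel, coneMap_one hv]

/-- If the Jacobian of the action on the light cone is the energy ratio, then `K_A²` is the
Jacobian of the action on the sphere. -/
theorem isConformalJacobian_of_det {A : SL2C} (Φ : E3 → E3 →L[ℝ] E3)
    (hΦ : ∀ v ≠ 0, HasFDerivAt (coneMap A) (Φ v) v)
    (hdet : ∀ r : ℝ, 0 < r → ∀ s : S2, |(Φ (r • (s : E3))).det| = dilation A s) :
    IsConformalJacobian A := by
  intro f hf
  -- f as a function of the direction alone, cut off at energy 1 so that the radial integral is
  -- finite and explicit.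
  let g : E3 → ENNReal := fun v => if hv : v ∈ ({0}ᶜ : Set E3) then
    if ‖v‖ < 1 then f (homeomorphUnitSphereProd E3 ⟨v, hv⟩).1 else 0 else 0
  have hgs : ∀ (r : ℝ), 0 < r → ∀ s : S2, g (r • (s : E3)) = if r * 1 < 1 then f s else 0 := by
    intro r hr s
    have hv : r • (s : E3) ≠ 0 := smul_ne_zero hr.ne' (ne_zero_of_mem_unit_sphere _)
    have hn : ‖r • (s : E3)‖ = r := by
      rw [norm_smul, norm_eq_of_mem_sphere, mul_one, Real.norm_of_nonneg hr.le]
    have hs : (homeomorphUnitSphereProd E3 ⟨r • (s : E3), hv⟩) = (s, ⟨r, hr⟩) := by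
      rw [← Homeomorph.eq_symm_apply]
      apply Subtype.ext
      rw [homeomorphUnitSphereProd_symm_apply_coe]
    simp only [g]
    rw [dif_pos (show r • (s : E3) ∈ ({0}ᶜ : Set E3) from hv), hn, hs, mul_one]
  have hgm : Measurable g := by
    refine Measurable.dite (f := fun v : ({0}ᶜ : Set E3) =>
        if ‖(v : E3)‖ < 1 then f (homeomorphUnitSphereProd E3 v).1 else 0) (g := fun _ => 0)
      ?_ measurable_const (measurableSet_singleton (0 : E3)).compl
    refine Measurable.ite ?_ ?_ measurable_const
    · exact measurableSet_lt (measurable_subtype_coe.norm) measurable_const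
    · exact hf.comp (measurable_fst.comp (homeomorphUnitSphereProd E3).continuous.measurable)
  have hL : ∫⁻ v in ({0}ᶜ : Set E3), g v = (∫⁻ s, f s ∂sphereMeasure) * ENNReal.ofReal (1 / 3) := by
    rw [lintegral_compl_zero_eq hgm, ← lintegral_mul_const _ hf]
    congr 1; funext s
    have h1 : ∀ r : Set.Ioi (0 : ℝ), g ((r : ℝ) • (s : E3)) =
        if (r : ℝ) * 1 < 1 then f s else 0 := fun r => hgs r r.2 s
    simp_rw [h1]
    rw [lintegral_radial one_pos]
    norm_num
  have hcont : ContinuousOn (coneMap A) {0}ᶜ := fun v hv =>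
    (hΦ v hv).continuousAt.continuousWithinAt
  have hR : ∫⁻ v in ({0}ᶜ : Set E3), g v =
      (∫⁻ s, f (sphereAct A s) * ENNReal.ofReal (confFactor A s ^ 2) ∂sphereMeasure) *
        ENNReal.ofReal (1 / 3) := by
    have h1 := lintegral_image_eq_lintegral_abs_det_fderiv_mul (volume : Measure E3)
      (measurableSet_singleton (0 : E3)).compl (f := coneMap A) (f' := Φ)
      (fun v hv => (hΦ v hv).hasFDerivWithinAt) (injOn_coneMap A) g
    rw [image_coneMap] at h1
    -- The integrand after the change of variables, with the determinant written as the energy ratio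
    -- ‖Av‖/‖v‖, for which measurability is clear.
    let k : E3 → ENNReal := ({0}ᶜ : Set E3).indicator
      fun v => ENNReal.ofReal (‖coneMap A v‖ / ‖v‖) * g (coneMap A v)
    have hkm : Measurable k := by
      have hc : Measurable (({0}ᶜ : Set E3).piecewise (coneMap A) (fun _ => (0 : E3))) :=
        measurable_of_continuousOn_compl_singleton 0 (by
          refine hcont.congr fun v hv => ?_
          exact Set.piecewise_eq_of_mem _ _ _ hv)
      have h3 : k = ({0}ᶜ : Set E3).indicator fun v =>
          ENNReal.ofReal (‖({0}ᶜ : Set E3).piecewise (coneMap A) (fun _ => (0 : E3)) v‖ / ‖v‖) *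
            g (({0}ᶜ : Set E3).piecewise (coneMap A) (fun _ => (0 : E3)) v) := by
        refine Set.indicator_congr fun v hv => ?_
        rw [Set.piecewise_eq_of_mem _ _ _ hv]
      rw [h3]
      exact (((hc.norm.div measurable_norm).ennreal_ofReal).mul (hgm.comp hc)).indicator
        (measurableSet_singleton (0 : E3)).compl
    have hks : ∀ (r : ℝ), 0 < r → ∀ s : S2, k (r • (s : E3)) =
        if r * dilation A s < 1 then
          ENNReal.ofReal (dilation A s) * f (sphereAct A s) else 0 := by
      intro r hr s
      have hv : r • (s : E3) ≠ 0 := smul_ne_zero hr.ne' (ne_zero_of_mem_unit_sphere _)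
      have hrd := mul_pos hr (dilation_pos A s)
      simp only [k]
      rw [Set.indicator_of_mem (show r • (s : E3) ∈ ({0}ᶜ : Set E3) from hv), coneMap_smul A hr.le,
        hgs _ hrd, norm_smul, norm_smul, norm_eq_of_mem_sphere, norm_eq_of_mem_sphere, mul_one,
        mul_one, Real.norm_of_nonneg hrd.le, Real.norm_of_nonneg hr.le,
        mul_div_cancel_left₀ _ hr.ne', mul_one, mul_ite, mul_zero]
    have h2 : ∫⁻ v in ({0}ᶜ : Set E3), ENNReal.ofReal |(Φ v).det| * g (coneMap A v) =
        ∫⁻ v in ({0}ᶜ : Set E3), k v := by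
      refine setLIntegral_congr_fun (measurableSet_singleton (0 : E3)).compl fun v hv => ?_
      obtain ⟨r, hr, s, rfl⟩ := exists_smul_sphere (show v ≠ 0 from hv)
      simp only [k]
      rw [Set.indicator_of_mem hv, hdet r hr s, coneMap_smul A hr.le, norm_smul, norm_smul,
        norm_eq_of_mem_sphere, norm_eq_of_mem_sphere, mul_one, mul_one,
        Real.norm_of_nonneg (mul_pos hr (dilation_pos A s)).le, Real.norm_of_nonneg hr.le,
        mul_div_cancel_left₀ _ hr.ne']
    rw [h1, h2, lintegral_compl_zero_eq hkm, ← lintegral_mul_const']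
    · congr 1; funext s
      have h3 : ∀ r : Set.Ioi (0 : ℝ), k ((r : ℝ) • (s : E3)) =
          if (r : ℝ) * dilation A s < 1 then
            ENNReal.ofReal (dilation A s) * f (sphereAct A s) else 0 := fun r => hks r r.2 s
      have hd := dilation_pos A s
      simp_rw [h3]
      -- One factor K⁻¹ from the Jacobian and K³/3 from the cut-off radius 1/K⁻¹ combine to K²/3.
      rw [lintegral_radial hd, mul_comm (ENNReal.ofReal _) (f _), mul_assoc, mul_assoc,
        ← ENNReal.ofReal_mul hd.le, ← ENNReal.ofReal_mul (sq_nonneg _), confFactor]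
      congr 2
      field_simp
    · exact ENNReal.ofReal_ne_top
  rw [hL] at hR
  refine ((ENNReal.mul_left_inj ?_ ENNReal.ofReal_ne_top).1 hR).symm
  rw [Ne, ENNReal.ofReal_eq_zero]
  norm_num

/-- A shear along the light cone, with `ε = ±1`. -/
def coneShear (α β ε : ℝ) (v : E3) : E3 :=
  !₂[v 0 + α * (‖v‖ - ε * v 2), v 1 + β * (‖v‖ - ε * v 2),
    v 2 + ε * (α * v 0 + β * v 1 + (α ^ 2 + β ^ 2) * (‖v‖ - ε * v 2) / 2)]

/-- The matrix of the derivative of `coneShear`. -/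
def coneShearMatrix (α β ε : ℝ) (n : Fin 3 → ℝ) : Matrix (Fin 3) (Fin 3) ℝ :=
  !![1 + α * n 0, α * n 1, α * (n 2 - ε);
     β * n 0, 1 + β * n 1, β * (n 2 - ε);
     ε * (α + (α ^ 2 + β ^ 2) * n 0 / 2), ε * (β + (α ^ 2 + β ^ 2) * n 1 / 2),
       1 + ε * ((α ^ 2 + β ^ 2) * (n 2 - ε) / 2)]

theorem det_coneShearMatrix {α β ε : ℝ} (hε : ε ^ 2 = 1) (n : Fin 3 → ℝ) :
    (coneShearMatrix α β ε n).det =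
      1 + α * n 0 + β * n 1 + (α ^ 2 + β ^ 2) * (1 - ε * n 2) / 2 := by
  rw [Matrix.det_fin_three]
  simp [coneShearMatrix]
  linear_combination ((α ^ 2 + β ^ 2) / 2) * hε

/-- The derivative of `coneShear`. -/
def coneShearDeriv (α β ε : ℝ) (v : E3) : E3 →L[ℝ] E3 :=
  (Matrix.toLin (EuclideanSpace.basisFun (Fin 3) ℝ).toBasis
    (EuclideanSpace.basisFun (Fin 3) ℝ).toBasis
    (coneShearMatrix α β ε fun i => v i / ‖v‖)).toContinuousLinearMap

theorem coneShearDeriv_apply (α β ε : ℝ) (v w : E3) (i : Fin 3) :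
    coneShearDeriv α β ε v w i = ∑ j, coneShearMatrix α β ε (fun i => v i / ‖v‖) i j * w j := by
  rw [coneShearDeriv, LinearMap.coe_toContinuousLinearMap', Matrix.toLin_apply]
  simp [Matrix.mulVec, dotProduct, Finset.sum_apply, Pi.single_apply]

/-- For directions n = v/‖v‖ the determinant is the factor by which the shear changes the energy:
the Lorentz invariance of d³p/|p|. -/
theorem det_coneShearDeriv {α β ε : ℝ} (hε : ε ^ 2 = 1) (v : E3) :
    (coneShearDeriv α β ε v).det = 1 + α * (v 0 / ‖v‖) + β * (v 1 / ‖v‖) +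
      (α ^ 2 + β ^ 2) * (1 - ε * (v 2 / ‖v‖)) / 2 := by
  rw [ContinuousLinearMap.det, coneShearDeriv, LinearMap.coe_toContinuousLinearMap,
    LinearMap.det_toLin, det_coneShearMatrix hε]

theorem hasFDerivAt_norm_E3 {v : E3} (hv : v ≠ 0) :
    HasFDerivAt (fun v : E3 => ‖v‖) (‖v‖⁻¹ • innerSL ℝ v) v := by
  have hn : ‖v‖ ≠ 0 := norm_ne_zero_iff.2 hv
  have h := (hasStrictFDerivAt_norm_sq v).hasFDerivAt.sqrt (pow_ne_zero 2 hn)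
  simp only [Real.sqrt_sq (norm_nonneg _)] at h
  refine h.congr_fderiv ?_
  ext w
  simp
  field_simp

theorem hasFDerivAt_coneShear (α β ε : ℝ) {v : E3} (hv : v ≠ 0) :
    HasFDerivAt (coneShear α β ε) (coneShearDeriv α β ε v) v := by
  have hn : ‖v‖ ≠ 0 := norm_ne_zero_iff.2 hv
  have h0 := hasFDerivAt_norm_E3 hv
  have hc : ∀ k : Fin 3, HasFDerivAt (fun v : E3 => v k) (EuclideanSpace.proj k : E3 →L[ℝ] ℝ) v :=
    fun k => (EuclideanSpace.proj k : E3 →L[ℝ] ℝ).hasFDerivAt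
  have hl := h0.sub ((hc 2).const_mul ε)
  rw [← hasFDerivWithinAt_univ, hasFDerivWithinAt_euclidean]
  intro i
  rw [hasFDerivWithinAt_univ]
  have hin : ∀ w : E3, inner ℝ v w = v 0 * w 0 + v 1 * w 1 + v 2 * w 2 := by
    intro w
    rw [PiLp.inner_apply, Fin.sum_univ_three]
    simp [mul_comm]
  fin_cases i
  · refine ((hc 0).add (hl.const_mul α)).congr_fderiv ?_
    ext w
    simp [coneShearDeriv_apply, coneShearMatrix, Fin.sum_univ_three, hin]
    field_simp
    ring
  · refine ((hc 1).add (hl.const_mul β)).congr_fderiv ?_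
    ext w
    simp [coneShearDeriv_apply, coneShearMatrix, Fin.sum_univ_three, hin]
    field_simp
    ring
  · refine ((hc 2).add ((((hc 0).const_mul α).add ((hc 1).const_mul β)).add
      ((hl.const_mul (α ^ 2 + β ^ 2)).mul_const (2⁻¹ : ℝ)) |>.const_mul ε)).congr_fderiv ?_
    ext w
    simp [coneShearDeriv_apply, coneShearMatrix, Fin.sum_univ_three, hin]
    field_simp
    ring

theorem isConformalJacobian_of_coneShear {A : SL2C} {α β ε : ℝ} (hε : ε ^ 2 = 1)
    (hA : coneMap A = coneShear α β ε)
    (hd : ∀ v : E3, dilation A v =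
      1 + α * v 0 + β * v 1 + (α ^ 2 + β ^ 2) * (1 - ε * v 2) / 2) :
    IsConformalJacobian A := by
  refine isConformalJacobian_of_det (coneShearDeriv α β ε)
    (fun v hv => by rw [hA]; exact hasFDerivAt_coneShear α β ε hv) fun r hr s => ?_
  have hn : ‖r • (s : E3)‖ = r := by
    rw [norm_smul, norm_eq_of_mem_sphere, mul_one, Real.norm_of_nonneg hr.le]
  have hc : ∀ k, (r • (s : E3)) k / ‖r • (s : E3)‖ = s.1 k := fun k => by
    rw [hn, PiLp.smul_apply, smul_eq_mul, mul_div_cancel_left₀ _ hr.ne']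
  rw [det_coneShearDeriv hε, hc, hc, hc, ← hd, abs_of_pos (dilation_pos A s)]

/-- The upper triangular transvections. -/
def upperSL (b : ℂ) : SL2C := ⟨!![1, b; 0, 1], by simp [Matrix.det_fin_two]⟩

/-- The lower triangular transvections. -/
def lowerSL (c : ℂ) : SL2C := ⟨!![1, 0; c, 1], by simp [Matrix.det_fin_two]⟩

theorem upperSL_coe (b : ℂ) : (upperSL b).1 = !![1, b; 0, 1] := rfl

theorem lowerSL_coe (c : ℂ) : (lowerSL c).1 = !![1, 0; c, 1] := rfl

/-- An upper transvection is a null rotation fixing ζ = ∞; it preserves ‖v‖ - v₂, whence ε = 1. -/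
theorem isConformalJacobian_upperSL (b : ℂ) : IsConformalJacobian (upperSL b) := by
  refine isConformalJacobian_of_coneShear (α := b.re) (β := b.im) (ε := 1) (by norm_num) ?_ ?_
  · funext v
    ext i
    fin_cases i <;>
      simp [coneMap, vecPart, coneMatrix, upperSL, coneShear, Matrix.mul_apply, Fin.sum_univ_two] <;>
      ring
  · intro v
    simp only [dilation, spinConj, spinProj, upperSL, Matrix.trace_fin_two, Matrix.mul_apply,
      Fin.sum_univ_two, Matrix.conjTranspose_apply]
    simp
    ring

/-- Here ‖v‖ + v₂ is preserved, whence ε = -1; c enters the upper right matrix entry conjugated,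
whence the sign of β. -/
theorem isConformalJacobian_lowerSL (c : ℂ) : IsConformalJacobian (lowerSL c) := by
  refine isConformalJacobian_of_coneShear (α := c.re) (β := -c.im) (ε := -1) (by norm_num) ?_ ?_
  · funext v
    ext i
    fin_cases i <;>
      simp [coneMap, vecPart, coneMatrix, lowerSL, coneShear, Matrix.mul_apply, Fin.sum_univ_two] <;>
      ring
  · intro v
    simp only [dilation, spinConj, spinProj, lowerSL, Matrix.trace_fin_two, Matrix.mul_apply,
      Fin.sum_univ_two, Matrix.conjTranspose_apply]
    simp
    ring

theorem isConformalJacobian_of_ne_zero {A : SL2C} (hc : A.1 1 0 ≠ 0) : IsConformalJacobian A := by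
  have hdet : A.1 0 0 * A.1 1 1 - A.1 0 1 * A.1 1 0 = 1 := by
    rw [← Matrix.det_fin_two]; exact A.2
  -- In the product upper(x) lower(c) upper(y) the diagonal is 1 + xc and 1 + cy, which dictates x
  -- and y; the upper right entry is then fixed by the determinant.
  have h : A = upperSL ((A.1 0 0 - 1) / A.1 1 0) * lowerSL (A.1 1 0) *
      upperSL ((A.1 1 1 - 1) / A.1 1 0) := by
    apply Subtype.ext
    rw [Matrix.SpecialLinearGroup.coe_mul, Matrix.SpecialLinearGroup.coe_mul]
    simp only [upperSL_coe, lowerSL_coe]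
    ext i j
    fin_cases i <;> fin_cases j <;>
      simp [Matrix.mul_apply, Fin.sum_univ_two] <;> field_simp
    all_goals first | ring1 | linear_combination -hdet
  rw [h]
  exact ((isConformalJacobian_upperSL _).mul (isConformalJacobian_lowerSL _)).mul
    (isConformalJacobian_upperSL _)

/-- The surface measure transforms under conformal maps with the square of the conformal
factor. -/
theorem isConformalJacobian (A : SL2C) : IsConformalJacobian A := by
  by_cases hc : A.1 1 0 = 0
  -- When c = 0, the determinant gives a ≠ 0, and multiplication by `lowerSL 1` moves a into the
  -- lower left corner.
  · have h : A = lowerSL (-1) * (lowerSL 1 * A) := by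
      rw [← mul_assoc]
      have : lowerSL (-1) * lowerSL 1 = 1 := by
        apply Subtype.ext
        rw [Matrix.SpecialLinearGroup.coe_mul, lowerSL_coe, lowerSL_coe]
        ext i j
        fin_cases i <;> fin_cases j <;> simp [Matrix.mul_apply, Fin.sum_univ_two]
      rw [this, one_mul]
    rw [h]
    refine (isConformalJacobian_lowerSL _).mul (isConformalJacobian_of_ne_zero ?_)
    have hdet : A.1 0 0 * A.1 1 1 - A.1 0 1 * A.1 1 0 = 1 := by
      rw [← Matrix.det_fin_two]; exact A.2
    rw [hc, mul_zero, sub_zero] at hdet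
    have h0 : A.1 0 0 ≠ 0 := fun h0 => by rw [h0, zero_mul] at hdet; exact zero_ne_one hdet
    rw [Matrix.SpecialLinearGroup.coe_mul, lowerSL_coe]
    simpa [Matrix.mul_apply, Fin.sum_univ_two, hc] using h0
  · exact isConformalJacobian_of_ne_zero hc

end SphereJacobian

/-! ### The Fourier-Plancherel transform on the real line -/

section Plancherel

open Complex Real

theorem inner_star_Lp (F G : Lp ℂ 2 (volume : Measure ℝ)) :
    inner ℂ (star F) G = ∫ x, F x * G x := by
  rw [L2.inner_def]
  refine integral_congr_ae ?_
  filter_upwards [Lp.coeFn_star F] with x hx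
  rw [hx]
  simp [mul_comm]

/-- For a Schwartz function G this is the definition of the distributional transform of F; both
sides are continuous in G on L², where Schwartz functions are dense. -/
theorem integral_fourier_mul_Lp (F G : Lp ℂ 2 (volume : Measure ℝ)) :
    ∫ x, G x * (𝓕 F : Lp ℂ 2 (volume : Measure ℝ)) x =
      ∫ x, (𝓕 G : Lp ℂ 2 (volume : Measure ℝ)) x * F x := by
  have hd := SchwartzMap.denseRange_toLpCLM (E := ℝ) (F := ℂ) (p := 2) (μ := volume)
    ENNReal.ofNat_ne_top
  refine hd.induction_on (p := fun G : Lp ℂ 2 (volume : Measure ℝ) =>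
    ∫ x, G x * (𝓕 F : Lp ℂ 2 (volume : Measure ℝ)) x =
      ∫ x, (𝓕 G : Lp ℂ 2 (volume : Measure ℝ)) x * F x) G ?_ ?_
  · have h1 : ∀ G : Lp ℂ 2 (volume : Measure ℝ),
        ∫ x, G x * (𝓕 F : Lp ℂ 2 (volume : Measure ℝ)) x = inner ℂ (star (𝓕 F)) G := fun G => by
      rw [inner_star_Lp]; simp_rw [mul_comm]
    have h2 : ∀ G : Lp ℂ 2 (volume : Measure ℝ),
        ∫ x, (𝓕 G : Lp ℂ 2 (volume : Measure ℝ)) x * F x = inner ℂ (star F) (𝓕 G) := fun G => by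
      rw [inner_star_Lp]; simp_rw [mul_comm]
    simp_rw [h1, h2]
    exact isClosed_eq (by fun_prop)
      (continuous_const.inner (Lp.fourierTransformₗᵢ ℝ ℂ).continuous)
  · intro g
    have h := DFunLike.congr_fun (Lp.fourier_toTemperedDistribution_eq F) g
    rw [TemperedDistribution.fourier_apply, Lp.toTemperedDistribution_apply,
      Lp.toTemperedDistribution_apply] at h
    simp only [SchwartzMap.toLpCLM_apply, SchwartzMap.toLp_fourier_eq]
    calc _ = ∫ x, g x • (𝓕 F : Lp ℂ 2 (volume : Measure ℝ)) x := by
          refine integral_congr_ae ?_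
          filter_upwards [SchwartzMap.coeFn_toLp g 2 volume] with x hx
          rw [hx, smul_eq_mul]
      _ = ∫ x, (𝓕 g) x • F x := h.symm
      _ = _ := by
          refine integral_congr_ae ?_
          filter_upwards [SchwartzMap.coeFn_toLp (𝓕 g) 2 volume] with x hx
          rw [hx, smul_eq_mul]

theorem integral_fourier_mul_eq {f g : ℝ → ℂ} (hf : Integrable f) (hg : Integrable g) :
    ∫ x, 𝓕 f x * g x = ∫ x, f x * 𝓕 g x := by
  simpa using! (VectorFourier.integral_fourierIntegral_smul_eq_flip (L := innerₗ ℝ)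
    (μ := volume) (ν := volume) Real.continuous_fourierChar continuous_inner hf hg)

theorem continuous_fourier {f : ℝ → ℂ} (hf : Integrable f) : Continuous (𝓕 f) :=
  VectorFourier.fourierIntegral_continuous Real.continuous_fourierChar
    (L := innerₗ ℝ) continuous_inner hf

/-- On L¹ ∩ L² the Plancherel transform and the Fourier integral satisfy the same multiplication
formula against test functions, hence agree almost everywhere. -/
theorem coeFn_fourier_toLp {g : ℝ → ℂ} (h1 : Integrable g) (h2 : MemLp g 2 volume) :
    (𝓕 (h2.toLp g) : Lp ℂ 2 (volume : Measure ℝ)) =ᵐ[volume] 𝓕 g := by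
  refine ae_eq_of_integral_contDiff_smul_eq
    ((Lp.memLp _).locallyIntegrable (by norm_num)) (continuous_fourier h1).locallyIntegrable ?_
  intro φ hφ hs
  have hφ' : ContDiff ℝ ∞ (fun x => (φ x : ℂ)) := ofRealCLM.contDiff.comp hφ
  have hs' : HasCompactSupport (fun x => (φ x : ℂ)) := hs.comp_left ofReal_zero
  let Φ : SchwartzMap ℝ ℂ := hs'.toSchwartzMap hφ'
  have hΦ : ∀ x, Φ x = φ x := fun x => rfl
  have h := integral_fourier_mul_Lp (h2.toLp g) (Φ.toLp 2)
  rw [SchwartzMap.toLp_fourier_eq] at h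
  calc _ = ∫ x, (Φ.toLp 2 : Lp ℂ 2 (volume : Measure ℝ)) x *
        (𝓕 (h2.toLp g) : Lp ℂ 2 (volume : Measure ℝ)) x := by
        refine integral_congr_ae ?_
        filter_upwards [SchwartzMap.coeFn_toLp Φ 2 volume] with x hx
        rw [hx, hΦ, real_smul]
    _ = _ := h
    _ = ∫ x, 𝓕 (Φ : ℝ → ℂ) x * g x := by
        refine integral_congr_ae ?_
        filter_upwards [SchwartzMap.coeFn_toLp (𝓕 Φ) 2 volume, h2.coeFn_toLp] with x hx hx'
        rw [hx, hx']
        rfl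
    _ = ∫ x, Φ x * 𝓕 g x := integral_fourier_mul_eq Φ.integrable h1
    _ = _ := by simp [hΦ]

/-- The transform `u ↦ (2π)^{-1/2} ∫ e^{iku} g(k) dk` of an integrable function. -/
def expHat (g : ℝ → ℂ) (u : ℝ) : ℂ :=
  ((Real.sqrt (2 * π))⁻¹ : ℂ) * ∫ k, cexp (I * (k * u : ℝ)) * g k

theorem expHat_eq (g : ℝ → ℂ) (u : ℝ) :
    expHat g u = ((Real.sqrt (2 * π) : ℝ) : ℂ) * 𝓕 (fun x => g (-(2 * π) * x)) u := by
  rw [Real.fourier_real_eq_integral_exp_smul]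
  have h := Measure.integral_comp_mul_left
    (fun k : ℝ => cexp (I * (k * u : ℝ)) * g k) (-(2 * π))
  have h2 : ∀ v : ℝ, cexp (((-2 * π * v * u : ℝ) : ℂ) * I) • g (-(2 * π) * v) =
      cexp (I * ((-(2 * π) * v) * u : ℝ)) * g (-(2 * π) * v) := by
    intro v
    rw [smul_eq_mul]
    congr 2
    push_cast
    ring
  simp_rw [h2]
  rw [h, expHat, abs_inv, abs_neg, abs_of_pos (by positivity), real_smul, ← mul_assoc,
    ← ofReal_inv, ← ofReal_mul, ← div_eq_mul_inv, Real.sqrt_div_self]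

theorem memLp_comp_mul_left {g : ℝ → ℂ} {p : ENNReal} (h : MemLp g p volume) {c : ℝ} (hc : c ≠ 0) :
    MemLp (fun x => g (c * x)) p volume := by
  have hm : Measurable fun x : ℝ => c * x := measurable_const_mul c
  have h1 : MemLp g p (Measure.map (fun x => c * x) volume) := by
    rw [Real.map_volume_mul_left hc]
    exact h.smul_measure ENNReal.ofReal_ne_top
  exact h1.comp_of_map hm.aemeasurable

theorem memLp_expHat {g : ℝ → ℂ} (h1 : Integrable g) (h2 : MemLp g 2 volume) :
    MemLp (expHat g) 2 volume := by
  have hc : -(2 * π) ≠ 0 := by simp [pi_ne_zero]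
  have h3 := memLp_comp_mul_left h2 hc
  have h4 := h1.comp_mul_left' hc
  have h5 := (Lp.memLp (𝓕 (h3.toLp _))).ae_eq (coeFn_fourier_toLp h4 h3)
  have h6 := h5.const_mul ((Real.sqrt (2 * π) : ℝ) : ℂ)
  refine h6.ae_eq (ae_of_all _ fun u => (expHat_eq g u).symm)

theorem fourierPlancherel_eq {f : ℝ → ℝ} (h : MemLp (fun u => (f u : ℂ)) 2 volume) :
    fourierPlancherel f = fun k => ((Real.sqrt (2 * π))⁻¹ : ℂ) *
      (𝓕 (h.toLp (fun u => (f u : ℂ))) : Lp ℂ 2 (volume : Measure ℝ)) (-k / (2 * π)) := by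
  rw [fourierPlancherel, dif_pos h]

theorem neg_div_two_pi (k : ℝ) : -k / (2 * π) = (-(2 * π)⁻¹) * k := by
  rw [div_eq_mul_inv]; ring

theorem memLp_fourierPlancherel (f : ℝ → ℝ) : MemLp (fourierPlancherel f) 2 volume := by
  by_cases h : MemLp (fun u => (f u : ℂ)) 2 volume
  · rw [fourierPlancherel_eq h]
    simp_rw [neg_div_two_pi]
    exact (memLp_comp_mul_left (Lp.memLp _) (by simp [pi_ne_zero])).const_mul _
  · rw [fourierPlancherel, dif_neg h]
    exact MemLp.zero

theorem integral_mul_fourierPlancherel {f : ℝ → ℝ} (hf : MemLp (fun u => (f u : ℂ)) 2 volume)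
    {g : ℝ → ℂ} (h1 : Integrable g) (h2 : MemLp g 2 volume) :
    ∫ k, g k * fourierPlancherel f k = ∫ u, expHat g u * f u := by
  have hc : -(2 * π) ≠ 0 := by simp [pi_ne_zero]
  have h3 := memLp_comp_mul_left h2 hc
  have h4 := h1.comp_mul_left' hc
  rw [fourierPlancherel_eq hf]
  have e1 := Measure.integral_comp_mul_left (fun k : ℝ => g k * (((Real.sqrt (2 * π))⁻¹ : ℂ) *
    (𝓕 (hf.toLp (fun u => (f u : ℂ))) : Lp ℂ 2 (volume : Measure ℝ)) (-k / (2 * π)))) (-(2 * π))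
  have e2 : ∀ x : ℝ, -(-(2 * π) * x) / (2 * π) = x := fun x => by field_simp [pi_ne_zero]
  simp_rw [e2] at e1
  have e3 := integral_fourier_mul_Lp (hf.toLp (fun u => (f u : ℂ))) (h3.toLp _)
  have e4 : ∫ x, (h3.toLp _ : Lp ℂ 2 (volume : Measure ℝ)) x *
      (𝓕 (hf.toLp (fun u => (f u : ℂ))) : Lp ℂ 2 (volume : Measure ℝ)) x =
      ∫ x, g (-(2 * π) * x) *
        (𝓕 (hf.toLp (fun u => (f u : ℂ))) : Lp ℂ 2 (volume : Measure ℝ)) x := by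
    refine integral_congr_ae ?_
    filter_upwards [h3.coeFn_toLp] with x hx
    rw [hx]
  have e5 : ∫ x, (𝓕 (h3.toLp _) : Lp ℂ 2 (volume : Measure ℝ)) x *
      (hf.toLp (fun u => (f u : ℂ)) : Lp ℂ 2 (volume : Measure ℝ)) x =
      ∫ x, 𝓕 (fun x => g (-(2 * π) * x)) x * f x := by
    refine integral_congr_ae ?_
    filter_upwards [coeFn_fourier_toLp h4 h3, hf.coeFn_toLp] with x hx hx'
    rw [hx, hx']
  rw [e4, e5] at e3
  have e6 : ∀ x : ℝ, g (-(2 * π) * x) * (((Real.sqrt (2 * π))⁻¹ : ℂ) *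
      (𝓕 (hf.toLp (fun u => (f u : ℂ))) : Lp ℂ 2 (volume : Measure ℝ)) x) =
      ((Real.sqrt (2 * π))⁻¹ : ℂ) * (g (-(2 * π) * x) *
      (𝓕 (hf.toLp (fun u => (f u : ℂ))) : Lp ℂ 2 (volume : Measure ℝ)) x) := fun x => by ring
  simp_rw [e6] at e1
  rw [integral_const_mul, e3] at e1
  simp_rw [expHat_eq, mul_assoc]
  rw [integral_const_mul]
  rw [abs_inv, abs_neg, abs_of_pos (by positivity : 0 < 2 * π), eq_inv_smul_iff₀ (by positivity)] at e1
  rw [← e1, real_smul, ← mul_assoc, ← ofReal_inv, ← ofReal_mul, ← div_eq_mul_inv, Real.div_sqrt]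

/-- A weak characterization: rules for the L² transform reduce to elementary rules for `expHat` of
test functions. -/
theorem ae_eq_fourierPlancherel {f : ℝ → ℝ} (hf : MemLp (fun u => (f u : ℂ)) 2 volume)
    {h : ℝ → ℂ} (hh : LocallyIntegrable h volume)
    (H : ∀ g : ℝ → ℝ, ContDiff ℝ ∞ g → HasCompactSupport g →
      ∫ k, (g k : ℂ) * h k = ∫ u, expHat (fun k => (g k : ℂ)) u * f u) :
    fourierPlancherel f =ᵐ[volume] h := by
  refine ae_eq_of_integral_contDiff_smul_eq
    ((memLp_fourierPlancherel f).locallyIntegrable (by norm_num)) hh fun g hg hs => ?_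
  have hs' : HasCompactSupport (fun x => (g x : ℂ)) := hs.comp_left ofReal_zero
  have hg' : Continuous fun x => (g x : ℂ) := continuous_ofReal.comp hg.continuous
  simp_rw [real_smul]
  rw [H g hg hs]
  exact integral_mul_fourierPlancherel hf (hg'.integrable_of_hasCompactSupport hs')
    (hg'.memLp_of_hasCompactSupport hs')

end Plancherel

/-! ### Linearity, affine substitution, derivative, reality and Parseval for the transform -/

section PlancherelRules

open Complex Real

theorem memLp_ofReal {α : Type*} [MeasurableSpace α] {μ : Measure α} {f : α → ℝ}
    (hf : MemLp f 2 μ) : MemLp (fun u => (f u : ℂ)) 2 μ := hf.ofReal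

theorem expHat_comp_mul (g : ℝ → ℂ) {κ : ℝ} (hκ : 0 < κ) (c u : ℝ) :
    expHat (fun k => g (κ * k) * cexp (I * (k * c : ℝ))) u =
      (κ⁻¹ : ℂ) * expHat g ((u + c) / κ) := by
  have h := Measure.integral_comp_mul_left
    (fun y : ℝ => cexp (I * (y * ((u + c) / κ) : ℝ)) * g y) κ
  have h2 : ∀ k : ℝ, cexp (I * (κ * k * ((u + c) / κ) : ℝ)) * g (κ * k) =
      cexp (I * (k * u : ℝ)) * (g (κ * k) * cexp (I * (k * c : ℝ))) := by
    intro k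
    have : κ * k * ((u + c) / κ) = k * u + k * c := by field_simp
    rw [this, ofReal_add, mul_add, Complex.exp_add]
    ring
  simp_rw [h2] at h
  rw [expHat, expHat, h, abs_of_pos (inv_pos.2 hκ), real_smul, ofReal_inv]
  ring

theorem hasDerivAt_expHat {g : ℝ → ℂ} (hg : Continuous g) (hs : HasCompactSupport g) (u : ℝ) :
    HasDerivAt (expHat g) (expHat (fun k => I * k * g k) u) u := by
  have hc : -(2 * π) ≠ 0 := by simp [pi_ne_zero]
  have e : expHat g = fun u => ((Real.sqrt (2 * π) : ℝ) : ℂ) * 𝓕 (fun x => g (-(2 * π) * x)) u := by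
    funext u; exact expHat_eq g u
  rw [e, expHat_eq]
  have h1 : Integrable g := hg.integrable_of_hasCompactSupport hs
  have h2 : Integrable fun k : ℝ => ((-(2 * π))⁻¹ : ℝ) • ((k : ℂ) * g k) :=
    ((continuous_ofReal.mul hg).integrable_of_hasCompactSupport hs.mul_left).smul
      ((-(2 * π))⁻¹ : ℝ)
  have h3 : Integrable fun x : ℝ => x • g (-(2 * π) * x) := by
    refine (h2.comp_mul_left' hc).congr (ae_of_all _ fun x => ?_)
    simp only [real_smul]
    rw [← mul_assoc, ← ofReal_mul, inv_mul_cancel_left₀ hc]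
  have h4 := (Real.hasDerivAt_fourier (h1.comp_mul_left' hc) h3 u).const_mul
    ((Real.sqrt (2 * π) : ℝ) : ℂ)
  have h5 : (fun x : ℝ => (-2 * π * I * x : ℂ) • g (-(2 * π) * x)) =
      fun x : ℝ => I * ((-(2 * π) * x : ℝ) : ℂ) * g (-(2 * π) * x) := by
    funext x
    rw [smul_eq_mul]
    push_cast
    ring
  rwa [h5] at h4

theorem conj_expHat (g : ℝ → ℝ) (u : ℝ) :
    (starRingEnd ℂ) (expHat (fun k => (g (-k) : ℂ)) u) = expHat (fun k => (g k : ℂ)) u := by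
  rw [expHat, expHat, map_mul, map_inv₀, conj_ofReal, ← integral_conj,
    ← integral_neg_eq_self]
  congr 2
  funext k
  rw [map_mul, ← exp_conj, map_mul, conj_I, conj_ofReal, conj_ofReal, neg_neg, neg_mul, ← mul_neg,
    ← ofReal_neg, neg_mul, neg_neg]

theorem continuous_ofReal_comp {g : ℝ → ℝ} (hg : ContDiff ℝ ∞ g) :
    Continuous fun x => (g x : ℂ) := continuous_ofReal.comp hg.continuous

theorem hasCompactSupport_ofReal {g : ℝ → ℝ} (hs : HasCompactSupport g) :
    HasCompactSupport fun x => (g x : ℂ) := hs.comp_left ofReal_zero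

theorem integral_mul_fourierPlancherel' {f : ℝ → ℝ} (hf : MemLp f 2 volume)
    {g : ℝ → ℂ} (hg : Continuous g) (hs : HasCompactSupport g) :
    ∫ k, g k * fourierPlancherel f k = ∫ u, expHat g u * f u :=
  integral_mul_fourierPlancherel (memLp_ofReal hf) (hg.integrable_of_hasCompactSupport hs)
    (hg.memLp_of_hasCompactSupport hs)

theorem memLp_expHat' {g : ℝ → ℂ} (hg : Continuous g) (hs : HasCompactSupport g) :
    MemLp (expHat g) 2 volume :=
  memLp_expHat (hg.integrable_of_hasCompactSupport hs) (hg.memLp_of_hasCompactSupport hs)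

theorem integrable_mul_of_memLp {f g : ℝ → ℂ} (hf : MemLp f 2 volume) (hg : MemLp g 2 volume) :
    Integrable fun u => f u * g u := hf.integrable_mul hg

theorem locallyIntegrable_fourierPlancherel (f : ℝ → ℝ) :
    LocallyIntegrable (fourierPlancherel f) volume :=
  (memLp_fourierPlancherel f).locallyIntegrable (by norm_num)

theorem fourierPlancherel_add {f g : ℝ → ℝ} (hf : MemLp f 2 volume) (hg : MemLp g 2 volume) :
    fourierPlancherel (f + g) =ᵐ[volume] fourierPlancherel f + fourierPlancherel g := by
  refine ae_eq_fourierPlancherel (memLp_ofReal (hf.add hg))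
    ((locallyIntegrable_fourierPlancherel f).add (locallyIntegrable_fourierPlancherel g))
    fun φ hφ hs => ?_
  have h1 := continuous_ofReal_comp hφ
  have h2 := hasCompactSupport_ofReal hs
  have h3 := h1.memLp_of_hasCompactSupport (p := 2) (μ := (volume : Measure ℝ)) h2
  simp only [Pi.add_apply, mul_add, ofReal_add]
  rw [integral_add (integrable_mul_of_memLp h3 (memLp_fourierPlancherel f))
    (integrable_mul_of_memLp h3 (memLp_fourierPlancherel g)),
    integral_add (integrable_mul_of_memLp (memLp_expHat' h1 h2) (memLp_ofReal hf))
    (integrable_mul_of_memLp (memLp_expHat' h1 h2) (memLp_ofReal hg)),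
    integral_mul_fourierPlancherel' hf h1 h2, integral_mul_fourierPlancherel' hg h1 h2]

theorem fourierPlancherel_smul (c : ℝ) {f : ℝ → ℝ} (hf : MemLp f 2 volume) :
    fourierPlancherel (c • f) =ᵐ[volume] fun k => (c : ℂ) * fourierPlancherel f k := by
  refine ae_eq_fourierPlancherel (memLp_ofReal (hf.const_smul c))
    (((memLp_fourierPlancherel f).const_mul _).locallyIntegrable (by norm_num)) fun φ hφ hs => ?_
  have h1 := continuous_ofReal_comp hφ
  have h2 := hasCompactSupport_ofReal hs
  simp only [Pi.smul_apply, smul_eq_mul, ofReal_mul, mul_left_comm _ (c : ℂ)]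
  rw [integral_const_mul, integral_const_mul, integral_mul_fourierPlancherel' hf h1 h2]

theorem memLp_comp_affine {f : ℝ → ℝ} (hf : MemLp f 2 volume) {κ : ℝ} (hκ : κ ≠ 0) (c : ℝ) :
    MemLp (fun u => f (κ * u - c)) 2 volume := by
  have h1 : MemLp (fun u => f (u - c)) 2 volume :=
    hf.comp_measurePreserving (measurePreserving_sub_right volume c)
  have hm : Measurable fun x : ℝ => κ * x := measurable_const_mul κ
  have h2 : MemLp (fun u => f (u - c)) 2 (Measure.map (fun x => κ * x) volume) := by
    rw [Real.map_volume_mul_left hκ]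
    exact h1.smul_measure ENNReal.ofReal_ne_top
  exact h2.comp_of_map hm.aemeasurable

theorem fourierPlancherel_comp_affine {f : ℝ → ℝ} (hf : MemLp f 2 volume) {κ : ℝ} (hκ : 0 < κ)
    (c : ℝ) :
    fourierPlancherel (fun u => f (κ * u - c)) =ᵐ[volume]
      fun k => (κ⁻¹ : ℂ) * cexp (I * (κ⁻¹ * k * c : ℝ)) * fourierPlancherel f (κ⁻¹ * k) := by
  have hq : MemLp (fun k => (κ⁻¹ : ℂ) * cexp (I * (κ⁻¹ * k * c : ℝ)) *
      fourierPlancherel f (κ⁻¹ * k)) 2 volume := by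
    refine ((memLp_comp_mul_left (memLp_fourierPlancherel f) (inv_ne_zero hκ.ne')).const_mul
      (κ⁻¹ : ℂ)).of_le (f := fun k => (κ⁻¹ : ℂ) * cexp (I * (κ⁻¹ * k * c : ℝ)) *
      fourierPlancherel f (κ⁻¹ * k)) ?_ (ae_of_all _ fun k => ?_)
    · refine (Continuous.aestronglyMeasurable (by fun_prop)).mul
        (memLp_comp_mul_left (memLp_fourierPlancherel f) (inv_ne_zero hκ.ne')).1
    · rw [norm_mul, norm_mul, norm_mul, mul_comm I, norm_exp_ofReal_mul_I, mul_one]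
  refine ae_eq_fourierPlancherel (memLp_ofReal (memLp_comp_affine hf hκ.ne' c))
    (hq.locallyIntegrable (by norm_num)) fun φ hφ hs => ?_
  have h1 := continuous_ofReal_comp hφ
  have h2 := hasCompactSupport_ofReal hs
  -- The transpose of the claimed rule: scaling and phase are moved from the transform to the test
  -- function.
  let g : ℝ → ℂ := fun k => (φ (κ * k) : ℂ) * cexp (I * (k * c : ℝ))
  have hg1 : Continuous g := (h1.comp (continuous_const_mul κ)).mul (by fun_prop)
  have hg2 : HasCompactSupport g :=
    (h2.comp_homeomorph (Homeomorph.mulLeft₀ κ hκ.ne')).mul_right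
  have h3 := integral_mul_fourierPlancherel' hf hg1 hg2
  have e1 := Measure.integral_comp_mul_left (fun k : ℝ => (φ k : ℂ) *
    ((κ⁻¹ : ℂ) * cexp (I * (κ⁻¹ * k * c : ℝ)) * fourierPlancherel f (κ⁻¹ * k))) κ
  simp_rw [inv_mul_cancel_left₀ hκ.ne'] at e1
  have e2 : ∀ k : ℝ, (φ (κ * k) : ℂ) * ((κ⁻¹ : ℂ) * cexp (I * (k * c : ℝ)) * fourierPlancherel f k) =
      (κ⁻¹ : ℂ) * (g k * fourierPlancherel f k) := fun k => by simp only [g]; ring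
  simp_rw [e2] at e1
  have e3 : ∀ u, expHat g u = (κ⁻¹ : ℂ) * expHat (fun k => (φ k : ℂ)) ((u + c) / κ) :=
    fun u => expHat_comp_mul (fun k => (φ k : ℂ)) hκ c u
  have hκ' : (κ : ℂ) ≠ 0 := by exact_mod_cast hκ.ne'
  rw [integral_const_mul, h3, abs_of_pos (inv_pos.2 hκ), real_smul, ofReal_inv,
    mul_right_inj' (inv_ne_zero hκ')] at e1
  rw [← e1]
  simp_rw [e3, mul_assoc]
  rw [integral_const_mul]
  have e4 := Measure.integral_comp_mul_left (fun u : ℝ =>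
    expHat (fun k => (φ k : ℂ)) ((u - c + c) / κ) * (f (u - c) : ℂ)) κ
  have e5 : ∀ u : ℝ, (κ * u - c + c) / κ = u := fun u => by field_simp; ring
  simp_rw [e5] at e4
  rw [e4, abs_of_pos (inv_pos.2 hκ), real_smul, ofReal_inv,
    integral_sub_right_eq_self (fun u : ℝ => expHat (fun k => (φ k : ℂ)) ((u + c) / κ) * (f u : ℂ)) c]

/-- Integration by parts against `expHat` of a test function; there are no boundary terms because
all the products are integrable. -/
theorem fourierPlancherel_deriv {f f' : ℝ → ℝ} (hf : MemLp f 2 volume) (hf' : MemLp f' 2 volume)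
    (h : ∀ u, HasDerivAt f (f' u) u) :
    fourierPlancherel f' =ᵐ[volume] fun k => -(I * k) * fourierPlancherel f k := by
  have hl : LocallyIntegrable (fun k : ℝ => -(I * k) * fourierPlancherel f k) volume :=
    (locallyIntegrable_fourierPlancherel f).continuous_mul (by fun_prop)
  refine ae_eq_fourierPlancherel (memLp_ofReal hf') hl fun φ hφ hs => ?_
  have h1 := continuous_ofReal_comp hφ
  have h2 := hasCompactSupport_ofReal hs
  have h3 : Continuous fun k : ℝ => I * k * (φ k : ℂ) := by fun_prop
  have h4 : HasCompactSupport fun k : ℝ => I * k * (φ k : ℂ) := h2.mul_left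
  have e1 : ∀ k : ℝ, (φ k : ℂ) * (-(I * k) * fourierPlancherel f k) =
      -((I * k * (φ k : ℂ)) * fourierPlancherel f k) := fun k => by ring
  simp_rw [e1]
  rw [integral_neg, integral_mul_fourierPlancherel' hf h3 h4]
  have e2 := integral_mul_deriv_eq_deriv_mul_of_integrable
    (u := expHat fun k => (φ k : ℂ)) (v := fun u => (f u : ℂ))
    (u' := expHat fun k : ℝ => I * k * (φ k : ℂ)) (v' := fun u => (f' u : ℂ))
    (fun x _ => hasDerivAt_expHat h1 h2 x) (fun x _ => (h x).ofReal_comp)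
    (integrable_mul_of_memLp (memLp_expHat' h1 h2) (memLp_ofReal hf'))
    (integrable_mul_of_memLp (memLp_expHat' h3 h4) (memLp_ofReal hf))
    (integrable_mul_of_memLp (memLp_expHat' h1 h2) (memLp_ofReal hf))
  exact e2.symm

theorem fourierPlancherel_neg {f : ℝ → ℝ} (hf : MemLp f 2 volume) :
    fourierPlancherel f =ᵐ[volume] fun k => (starRingEnd ℂ) (fourierPlancherel f (-k)) := by
  have hq : MemLp (fun k => (starRingEnd ℂ) (fourierPlancherel f (-k))) 2 volume :=
    ((memLp_fourierPlancherel f).comp_measurePreserving (Measure.measurePreserving_neg volume)).star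
  refine ae_eq_fourierPlancherel (memLp_ofReal hf) (hq.locallyIntegrable (by norm_num)) fun φ hφ hs => ?_
  have h1 := continuous_ofReal_comp hφ
  have h2 := hasCompactSupport_ofReal hs
  have e := integral_mul_fourierPlancherel' hf (h1.comp continuous_neg)
    (h2.comp_homeomorph (Homeomorph.neg ℝ))
  have e' := congrArg (starRingEnd ℂ) e
  rw [← integral_conj, ← integral_conj, ← integral_neg_eq_self] at e'
  simp only [Function.comp_def, map_mul, conj_ofReal, neg_neg] at e'
  rw [e']
  congr 1
  funext u
  rw [← conj_expHat φ u]

theorem integral_conj_fourierPlancherel {f g : ℝ → ℝ} (hf : MemLp f 2 volume)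
    (hg : MemLp g 2 volume) :
    ∫ k, (starRingEnd ℂ) (fourierPlancherel f k) * fourierPlancherel g k =
      ((∫ u, f u * g u : ℝ) : ℂ) := by
  have e := Lp.inner_fourier_eq (E := ℝ) (F := ℂ) ((memLp_ofReal hf).toLp _) ((memLp_ofReal hg).toLp _)
  rw [L2.inner_def, L2.inner_def] at e
  have e1 : ∫ u, inner ℂ (((memLp_ofReal hf).toLp _ : Lp ℂ 2 volume) u)
      (((memLp_ofReal hg).toLp _ : Lp ℂ 2 volume) u) = ((∫ u, f u * g u : ℝ) : ℂ) := by
    rw [← integral_complex_ofReal]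
    refine integral_congr_ae ?_
    filter_upwards [(memLp_ofReal hf).coeFn_toLp, (memLp_ofReal hg).coeFn_toLp] with u hu hu'
    rw [hu, hu']
    simp [mul_comm]
  rw [e1] at e
  rw [← e, fourierPlancherel_eq (memLp_ofReal hf), fourierPlancherel_eq (memLp_ofReal hg)]
  simp_rw [neg_div_two_pi]
  have e2 := Measure.integral_comp_mul_left (fun x : ℝ => inner ℂ
    ((𝓕 ((memLp_ofReal hf).toLp fun u => (f u : ℂ)) : Lp ℂ 2 (volume : Measure ℝ)) x)
    ((𝓕 ((memLp_ofReal hg).toLp fun u => (g u : ℂ)) : Lp ℂ 2 (volume : Measure ℝ)) x)) (-(2 * π)⁻¹)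
  have hs : Real.sqrt (2 * π) * Real.sqrt (2 * π) = 2 * π := Real.mul_self_sqrt (by positivity)
  rw [inv_neg, inv_inv, abs_neg, abs_of_pos (by positivity : 0 < 2 * π),
    eq_comm, ← eq_inv_smul_iff₀ (by positivity)] at e2
  rw [e2, real_smul, ← integral_const_mul]
  congr 1
  funext k
  have hs' : ((Real.sqrt (2 * π) : ℝ) : ℂ)⁻¹ * ((Real.sqrt (2 * π) : ℝ) : ℂ)⁻¹ =
      (((2 * π)⁻¹ : ℝ) : ℂ) := by
    rw [← mul_inv, ← ofReal_mul, hs, ofReal_inv]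
  rw [map_mul, map_inv₀, conj_ofReal, ← hs', RCLike.inner_apply]
  ring

end PlancherelRules

/-! ### The one-particle form on a single generator of ℑ -/

section HalfLineForm

open Complex Real

/-- The one-particle inner product on a generator of null infinity. -/
def halfForm (f g : ℝ → ℝ) : ℂ :=
  ∫ k in Set.Ioi (0 : ℝ), 2 * (k : ℂ) * (starRingEnd ℂ) (fourierPlancherel f k) *
    fourierPlancherel g k

variable {f f' g g' : ℝ → ℝ}

theorem memLp_mul_fourierPlancherel (hf : MemLp f 2 volume) (hf' : MemLp f' 2 volume)
    (h : ∀ u, HasDerivAt f (f' u) u) :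
    MemLp (fun k : ℝ => (k : ℂ) * fourierPlancherel f k) 2 volume := by
  refine ((memLp_fourierPlancherel f').const_mul I).ae_eq ?_
  filter_upwards [fourierPlancherel_deriv hf hf' h] with k hk
  rw [hk, ← mul_assoc, ← neg_mul_eq_mul_neg, ← mul_assoc, I_mul_I]
  ring

theorem integrable_mul_conj_mul (hg : MemLp g 2 volume) (hg' : MemLp g' 2 volume)
    (h : ∀ u, HasDerivAt g (g' u) u) (f : ℝ → ℝ) :
    Integrable fun k : ℝ => (k : ℂ) * (starRingEnd ℂ) (fourierPlancherel f k) *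
      fourierPlancherel g k := by
  have h1 := integrable_mul_of_memLp (memLp_fourierPlancherel f).star
    (memLp_mul_fourierPlancherel hg hg' h)
  refine h1.congr (ae_of_all _ fun k => ?_)
  simp only [Pi.star_apply, RCLike.star_def]
  ring

theorem integrable_halfForm (hg : MemLp g 2 volume) (hg' : MemLp g' 2 volume)
    (h : ∀ u, HasDerivAt g (g' u) u) (f : ℝ → ℝ) :
    Integrable (fun k : ℝ => 2 * (k : ℂ) * (starRingEnd ℂ) (fourierPlancherel f k) *
      fourierPlancherel g k) := by
  refine ((integrable_mul_conj_mul hg hg' h f).const_mul 2).congr (ae_of_all _ fun k => ?_)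
  ring

theorem integral_normSq_fourierPlancherel (hf : MemLp f 2 volume) :
    ∫ k, ‖fourierPlancherel f k‖ ^ 2 = ∫ u, f u ^ 2 := by
  have h := integral_conj_fourierPlancherel hf hf
  apply ofReal_injective
  rw [← integral_complex_ofReal]
  simp_rw [pow_two (f _)]
  rw [← h]
  congr 1
  funext k
  rw [conj_mul']
  push_cast
  rfl

/-- Since 2k ≤ 1 + k² and the transform of f' has modulus |k||f̂|, the weighted norm is controlled
by the L² norms of f and f'. -/
theorem integral_halfForm_le (hf : MemLp f 2 volume) (hf' : MemLp f' 2 volume)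
    (h : ∀ u, HasDerivAt f (f' u) u) :
    ∫ k in Set.Ioi (0 : ℝ), 2 * k * ‖fourierPlancherel f k‖ ^ 2 ≤
      (∫ u, f u ^ 2) + ∫ u, f' u ^ 2 := by
  have i1 : Integrable fun k => ‖fourierPlancherel f k‖ ^ 2 :=
    (memLp_fourierPlancherel f).integrable_norm_pow two_ne_zero
  have i2 : Integrable fun k => ‖fourierPlancherel f' k‖ ^ 2 :=
    (memLp_fourierPlancherel f').integrable_norm_pow two_ne_zero
  have hle : ∀ᵐ k : ℝ, 2 * k * ‖fourierPlancherel f k‖ ^ 2 ≤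
      ‖fourierPlancherel f k‖ ^ 2 + ‖fourierPlancherel f' k‖ ^ 2 := by
    filter_upwards [fourierPlancherel_deriv hf hf' h] with k hk
    rw [hk, norm_mul, norm_neg, norm_mul, norm_I, norm_real, one_mul, mul_pow, norm_eq_abs, sq_abs]
    nlinarith [mul_nonneg (sq_nonneg (k - 1)) (sq_nonneg ‖fourierPlancherel f k‖)]
  have i3 : Integrable fun k : ℝ => 2 * k * ‖fourierPlancherel f k‖ ^ 2 := by
    refine ((integrable_halfForm hf hf' h f).re).congr (ae_of_all _ fun k => ?_)
    have e : 2 * (k : ℂ) * (starRingEnd ℂ) (fourierPlancherel f k) * fourierPlancherel f k =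
        ((2 * k * ‖fourierPlancherel f k‖ ^ 2 : ℝ) : ℂ) := by
      rw [mul_assoc, conj_mul']
      push_cast
      ring
    simp only
    rw [e, RCLike.re_eq_complex_re, ofReal_re]
  rw [← integral_normSq_fourierPlancherel hf, ← integral_normSq_fourierPlancherel hf',
    ← integral_add i1 i2]
  calc _ ≤ ∫ k in Set.Ioi (0 : ℝ), (‖fourierPlancherel f k‖ ^ 2 + ‖fourierPlancherel f' k‖ ^ 2) :=
        setIntegral_mono_ae i3.integrableOn (i1.add i2).integrableOn hle
    _ ≤ _ := setIntegral_le_integral (i1.add i2) (ae_of_all _ fun k => by positivity)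

/-- For real f and g the integrand q = k conj(f̂) ĝ satisfies q(-k) = -conj q(k). So its integral
over ℝ is 2i times the imaginary part of the half-line integral, and by Parseval it is i ∫ f g'. -/
theorem halfForm_im (hf : MemLp f 2 volume) (hg : MemLp g 2 volume) (hg' : MemLp g' 2 volume)
    (h : ∀ u, HasDerivAt g (g' u) u) :
    (halfForm f g).im = ∫ u, f u * g' u := by
  set q : ℝ → ℂ := fun k => (k : ℂ) * (starRingEnd ℂ) (fourierPlancherel f k) *
    fourierPlancherel g k with hq
  have hi : Integrable q := integrable_mul_conj_mul hg hg' h f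
  have h1 : halfForm f g = 2 * ∫ k in Set.Ioi (0 : ℝ), q k := by
    rw [halfForm, ← integral_const_mul]
    congr 1
    funext k
    simp only [hq]
    ring
  have h2 : ∫ k, q k = I * ((∫ u, f u * g' u : ℝ) : ℂ) := by
    rw [← integral_conj_fourierPlancherel hf hg', ← integral_const_mul]
    refine integral_congr_ae ?_
    filter_upwards [fourierPlancherel_deriv hg hg' h] with k hk
    simp only [hq]
    rw [hk]
    linear_combination ((k : ℂ) * (starRingEnd ℂ) (fourierPlancherel f k) *
      fourierPlancherel g k) * I_sq
  have h3 : ∫ k in Set.Iic (0 : ℝ), q k =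
      -(starRingEnd ℂ) (∫ k in Set.Ioi (0 : ℝ), q k) := by
    have e := integral_comp_neg_Iic 0 (fun k => q (-k))
    simp only [neg_neg, neg_zero] at e
    rw [e, ← integral_conj, ← integral_neg]
    refine integral_congr_ae (ae_restrict_of_ae ?_)
    filter_upwards [fourierPlancherel_neg hf, fourierPlancherel_neg hg] with k hk hk'
    simp only [hq]
    rw [hk, hk']
    simp
  have h4 := integral_add_compl (s := Set.Ioi (0 : ℝ)) measurableSet_Ioi hi
  rw [Set.compl_Ioi, h3, h2] at h4
  have h5 := congrArg Complex.im h4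
  rw [h1]
  simp at h5 ⊢
  linarith

theorem halfForm_conj (f g : ℝ → ℝ) : (starRingEnd ℂ) (halfForm f g) = halfForm g f := by
  rw [halfForm, halfForm, ← integral_conj]
  congr 1
  funext k
  simp only [map_mul, conj_ofReal, conj_conj, map_ofNat]
  ring

/-- The phases of the two transforms cancel, and the two factors κ⁻¹ compensate the scaling of k dk.
-/
theorem halfForm_comp_affine (hf : MemLp f 2 volume) (hg : MemLp g 2 volume) {κ : ℝ} (hκ : 0 < κ)
    (c : ℝ) :
    halfForm (fun u => f (κ * u - c)) (fun u => g (κ * u - c)) = halfForm f g := by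
  have hκ' : (κ : ℂ) ≠ 0 := by exact_mod_cast hκ.ne'
  have e := integral_comp_mul_left_Ioi (fun k : ℝ => 2 * (k : ℂ) *
    (starRingEnd ℂ) (fourierPlancherel f k) * fourierPlancherel g k) 0 (inv_pos.2 hκ)
  rw [mul_zero, inv_inv, eq_comm, ← eq_inv_smul_iff₀ hκ.ne'] at e
  rw [halfForm, halfForm, e, real_smul, ← integral_const_mul]
  refine integral_congr_ae (ae_restrict_of_ae ?_)
  filter_upwards [fourierPlancherel_comp_affine hf hκ c, fourierPlancherel_comp_affine hg hκ c]
    with k hk hk'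
  rw [hk, hk', map_mul, map_mul, ← exp_conj, map_mul, conj_I, conj_ofReal, map_inv₀, conj_ofReal]
  have he : cexp (-I * (κ⁻¹ * k * c : ℝ)) * cexp (I * (κ⁻¹ * k * c : ℝ)) = 1 := by
    rw [← Complex.exp_add, neg_mul, neg_add_cancel, Complex.exp_zero]
  push_cast at he ⊢
  linear_combination (2 * (k : ℂ) * (κ : ℂ)⁻¹ * (κ : ℂ)⁻¹ *
    (starRingEnd ℂ) (fourierPlancherel f (κ⁻¹ * k)) * fourierPlancherel g (κ⁻¹ * k)) * he

theorem halfForm_const_mul (hf : MemLp f 2 volume) (hg : MemLp g 2 volume) (r : ℝ) :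
    halfForm (r • f) (r • g) = (r : ℂ) ^ 2 * halfForm f g := by
  rw [halfForm, halfForm, ← integral_const_mul]
  refine integral_congr_ae (ae_restrict_of_ae ?_)
  filter_upwards [fourierPlancherel_smul r hf, fourierPlancherel_smul r hg] with k hk hk'
  rw [hk, hk', map_mul, conj_ofReal]
  ring

end HalfLineForm

/-! ### The one-particle map and its inner product -/

section OneParticleMap

open Complex Real

instance : IsFiniteMeasure sphereMeasure :=
  inferInstanceAs (IsFiniteMeasure (volume : Measure E3).toSphere)

/-- Difference quotients of the primitive of the transform of `ψ` along the `u`-direction. -/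
def uHatApprox (ψ : Scri → ℝ) (n : ℕ) (p : Scri) : ℂ :=
  ((n : ℂ) + 1) * ∫ u, expHat ((Set.Ioc p.1 (p.1 + ((n : ℝ) + 1)⁻¹)).indicator fun _ => 1) u *
    (ψ (u, p.2) : ℂ)

/-- A jointly measurable version of the transform along the `u`-direction. -/
def uHatLim (ψ : Scri → ℝ) (p : Scri) : ℂ :=
  limUnder atTop fun n => uHatApprox ψ n p

/-- The Plancherel transform is chosen separately on each slice, only up to null sets, so joint
measurability in (k,s) is not automatic. The difference quotients are explicit parameter integrals
and therefore jointly measurable. -/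
theorem stronglyMeasurable_uHatLim {ψ : Scri → ℝ} (hψ : Measurable ψ) :
    StronglyMeasurable (uHatLim ψ) := by
  refine StronglyMeasurable.limUnder fun n => ?_
  refine stronglyMeasurable_const.mul (StronglyMeasurable.integral_prod_right ?_)
  refine StronglyMeasurable.mul ?_ ?_
  · refine stronglyMeasurable_const.mul ?_
    refine StronglyMeasurable.integral_prod_right (f := fun (q : Scri × ℝ) (k : ℝ) =>
      cexp (I * (k * q.2 : ℝ)) * (Set.Ioc q.1.1 (q.1.1 + ((n : ℝ) + 1)⁻¹)).indicator
        (fun _ => (1 : ℂ)) k) ?_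
    refine Measurable.stronglyMeasurable ?_
    refine Measurable.mul (by fun_prop) ?_
    have hs : MeasurableSet {q : (Scri × ℝ) × ℝ |
        q.1.1.1 < q.2 ∧ q.2 ≤ q.1.1.1 + ((n : ℝ) + 1)⁻¹} :=
      (measurableSet_lt (f := fun q : (Scri × ℝ) × ℝ => q.1.1.1) (g := fun q => q.2)
        (by fun_prop) (by fun_prop)).inter
        (measurableSet_le (f := fun q : (Scri × ℝ) × ℝ => q.2)
          (g := fun q => q.1.1.1 + ((n : ℝ) + 1)⁻¹) (by fun_prop) (by fun_prop))
    exact (measurable_const (a := (1 : ℂ))).indicator hs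
  · refine Measurable.stronglyMeasurable ?_
    exact measurable_ofReal.comp (hψ.comp (by fun_prop))

/-- Lebesgue differentiation: increments of the primitive of ψ̂ pair ψ̂ with an indicator function,
and `integral_mul_fourierPlancherel` moves the transform onto the indicator. -/
theorem uHatLim_ae_eq {ψ : Scri → ℝ} {s : S2} (hs : MemLp (fun u => ψ (u, s)) 2 volume) :
    ∀ᵐ k : ℝ, uHatLim ψ (k, s) = uHat ψ k s := by
  filter_upwards [LocallyIntegrable.ae_hasDerivAt_integral
    (locallyIntegrable_fourierPlancherel fun u => ψ (u, s))]
    with k hk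
  refine Tendsto.limUnder_eq ?_
  have h1 : ∀ n : ℕ, uHatApprox ψ n (k, s) = ((n : ℝ) + 1) •
      ((∫ t in (0 : ℝ)..(k + ((n : ℝ) + 1)⁻¹), fourierPlancherel (fun u => ψ (u, s)) t) -
        ∫ t in (0 : ℝ)..k, fourierPlancherel (fun u => ψ (u, s)) t) := by
    intro n
    have hi : ∀ a b, IntervalIntegrable (fourierPlancherel fun u => ψ (u, s)) volume a b :=
      fun a b => intervalIntegrable_iff.2 (((locallyIntegrable_fourierPlancherel _).integrableOn_isCompact
        isCompact_uIcc).mono_set Set.uIoc_subset_uIcc)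
    have hg1 : Integrable ((Set.Ioc k (k + ((n : ℝ) + 1)⁻¹)).indicator fun _ => (1 : ℂ)) :=
      (integrable_indicator_iff measurableSet_Ioc).2 (by simp)
    have hg2 : MemLp ((Set.Ioc k (k + ((n : ℝ) + 1)⁻¹)).indicator fun _ => (1 : ℂ)) 2 volume :=
      memLp_indicator_const 2 measurableSet_Ioc 1 (Or.inr (by simp))
    have hn : (0 : ℝ) ≤ ((n : ℝ) + 1)⁻¹ := by positivity
    rw [intervalIntegral.integral_interval_sub_left (hi _ _) (hi _ _),
      intervalIntegral.integral_of_le (by linarith), ← integral_indicator measurableSet_Ioc,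
      uHatApprox, ← integral_mul_fourierPlancherel (memLp_ofReal hs) hg1 hg2, real_smul]
    push_cast
    congr 2
    funext t
    by_cases ht : t ∈ Set.Ioc k (k + ((n : ℝ) + 1)⁻¹)
    · rw [Set.indicator_of_mem ht, Set.indicator_of_mem ht, one_mul]
    · rw [Set.indicator_of_notMem ht, Set.indicator_of_notMem ht, zero_mul]
  simp_rw [h1]
  have h2 := (hk 0).tendsto_slope_zero_right
  have h3 : Tendsto (fun n : ℕ => ((n : ℝ) + 1)⁻¹) atTop (𝓝[>] 0) := by
    refine tendsto_nhdsWithin_iff.2 ⟨?_, Eventually.of_forall fun n => ?_⟩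
    · simpa [one_div] using tendsto_one_div_add_atTop_nhds_zero_nat (𝕜 := ℝ)
    · exact Set.mem_Ioi.2 (by positivity)
  have h4 := h2.comp h3
  simpa [Function.comp_def, inv_inv, uHat] using h4

theorem ae_memLp_slice {ψ : Scri → ℝ} (hψ : MemLp ψ 2 scriMeasure) (hm : Measurable ψ) :
    ∀ᵐ s ∂sphereMeasure, MemLp (fun u => ψ (u, s)) 2 volume := by
  have h1 := (memLp_two_iff_integrable_sq hψ.1).1 hψ
  filter_upwards [Integrable.prod_left_ae h1] with s hs
  exact (memLp_two_iff_integrable_sq (hm.comp measurable_prodMk_right).aestronglyMeasurable).2 hs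

theorem SmoothScri.hasDerivAt {ψ : Scri → ℝ} (h : SmoothScri ψ) (s : S2) (u : ℝ) :
    HasDerivAt (fun u => ψ (u, s)) (uDeriv ψ (u, s)) u :=
  (h.differentiableAt (u, s)).hasDerivAt

theorem SmoothScri.measurable {ψ : Scri → ℝ} (h : SmoothScri ψ) : Measurable ψ :=
  h.continuous.measurable

theorem SmoothScri.measurable_uDeriv {ψ : Scri → ℝ} (h : SmoothScri ψ) : Measurable (uDeriv ψ) := by
  have hlim : ∀ p : Scri, Tendsto (fun n : ℕ => ((n : ℝ) + 1) *
      (ψ (p.1 + ((n : ℝ) + 1)⁻¹, p.2) - ψ p)) atTop (𝓝 (uDeriv ψ p)) := by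
    intro p
    have h2 := (h.hasDerivAt p.2 p.1).tendsto_slope_zero_right
    have h3 : Tendsto (fun n : ℕ => ((n : ℝ) + 1)⁻¹) atTop (𝓝[>] 0) := by
      refine tendsto_nhdsWithin_iff.2 ⟨?_, Eventually.of_forall fun n => ?_⟩
      · simpa [one_div] using tendsto_one_div_add_atTop_nhds_zero_nat (𝕜 := ℝ)
      · exact Set.mem_Ioi.2 (by positivity)
    have h4 := h2.comp h3
    simpa [Function.comp_def, -mul_eq_mul_left_iff] using h4
  refine measurable_of_tendsto_metrizable (f := fun (n : ℕ) (p : Scri) => ((n : ℝ) + 1) *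
      (ψ (p.1 + ((n : ℝ) + 1)⁻¹, p.2) - ψ p)) (fun n => ?_) (tendsto_pi_nhds.2 hlim)
  have := h.measurable
  exact measurable_const.mul ((this.comp (by fun_prop)).sub this)

theorem bdrySpace_ae_slice (ψ : bdrySpace) :
    ∀ᵐ s ∂sphereMeasure, MemLp (fun u => ψ.1 (u, s)) 2 volume ∧
      MemLp (fun u => uDeriv ψ.1 (u, s)) 2 volume := by
  obtain ⟨h1, h2, h3⟩ := ψ.2
  filter_upwards [ae_memLp_slice h2 h1.measurable, ae_memLp_slice h3 h1.measurable_uDeriv]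
    with s hs hs'
  exact ⟨hs, hs'⟩

/-- The basis of the boundary space used to choose one-particle vectors linearly. -/
def bdryBasis : Module.Basis (Module.Basis.ofVectorSpaceIndex ℝ bdrySpace) ℝ bdrySpace :=
  Module.Basis.ofVectorSpace ℝ bdrySpace

/-- The one-particle map: a linear choice of jointly measurable versions of
`√(2k) ψ̂(k, s)`. -/
def waveMap : bdrySpace →ₗ[ℝ] (Scri → ℂ) :=
  bdryBasis.constr ℝ fun i p => (Real.sqrt (2 * p.1) : ℂ) * uHatLim (bdryBasis i).1 p

/-- The Fock amplitudes require a map linear at every point, while the transform is linear only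
almost everywhere. The map is thus fixed on a basis, and its link with ψ̂ is extended along finite
combinations. -/
theorem waveMap_spec (ψ : bdrySpace) : StronglyMeasurable (waveMap ψ) ∧
    ∀ᵐ s ∂sphereMeasure, ∀ᵐ k : ℝ,
      waveMap ψ (k, s) = (Real.sqrt (2 * k) : ℂ) * uHat ψ.1 k s := by
  have hψ : ψ ∈ Submodule.span ℝ (Set.range bdryBasis) := by
    rw [bdryBasis.span_eq]; trivial
  induction hψ using Submodule.span_induction with
  | mem x hx =>
    obtain ⟨i, rfl⟩ := hx
    have e : waveMap (bdryBasis i) =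
        fun p => (Real.sqrt (2 * p.1) : ℂ) * uHatLim (bdryBasis i).1 p := by
      rw [waveMap, Module.Basis.constr_basis]
    constructor
    · rw [e]
      refine StronglyMeasurable.mul ?_ (stronglyMeasurable_uHatLim (bdryBasis i).2.1.measurable)
      exact Continuous.stronglyMeasurable (by fun_prop)
    · filter_upwards [bdrySpace_ae_slice (bdryBasis i)] with s hs
      filter_upwards [uHatLim_ae_eq hs.1] with k hk
      rw [e]
      simp only
      rw [hk]
  | zero =>
    rw [map_zero]
    refine ⟨stronglyMeasurable_zero, ae_of_all _ fun s => ?_⟩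
    have h0 : MemLp (0 : ℝ → ℝ) 2 volume := MemLp.zero
    filter_upwards [fourierPlancherel_smul 0 h0] with k hk
    rw [zero_smul] at hk
    have : uHat (0 : bdrySpace).1 k s = 0 := by
      change fourierPlancherel (0 : ℝ → ℝ) k = 0
      rw [hk]; simp
    rw [this, mul_zero]
    rfl
  | add x y _ _ hx hy =>
    rw [map_add]
    refine ⟨hx.1.add hy.1, ?_⟩
    filter_upwards [hx.2, hy.2, bdrySpace_ae_slice x, bdrySpace_ae_slice y] with s h1 h2 h3 h4
    filter_upwards [h1, h2, fourierPlancherel_add h3.1 h4.1] with k k1 k2 k3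
    have : uHat (x + y).1 k s = uHat x.1 k s + uHat y.1 k s := k3
    rw [Pi.add_apply, k1, k2, this, mul_add]
  | smul r x _ hx =>
    rw [map_smul]
    refine ⟨hx.1.const_smul r, ?_⟩
    filter_upwards [hx.2, bdrySpace_ae_slice x] with s h1 h3
    filter_upwards [h1, fourierPlancherel_smul r h3.1] with k k1 k3
    have : uHat (r • x).1 k s = (r : ℂ) * uHat x.1 k s := k3
    rw [Pi.smul_apply, k1, this, real_smul]
    ring

/-- The measure `dk dμ_{𝕊²}` on `ℝ⁺ × 𝕊²`. -/
def momentumMeasure : Measure Scri :=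
  ((volume : Measure ℝ).restrict (Set.Ioi 0)).prod sphereMeasure

instance : SigmaFinite momentumMeasure := by
  unfold momentumMeasure; infer_instance

theorem ae_pos_momentumMeasure : ∀ᵐ p ∂momentumMeasure, 0 < p.1 :=
  Measure.quasiMeasurePreserving_fst.ae (ae_restrict_mem measurableSet_Ioi)

theorem conj_waveMap_mul_waveMap (ψ φ : bdrySpace) :
    ∀ᵐ s ∂sphereMeasure, ∀ᵐ k ∂(volume : Measure ℝ).restrict (Set.Ioi 0),
      (starRingEnd ℂ) (waveMap ψ (k, s)) * waveMap φ (k, s) =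
        2 * (k : ℂ) * (starRingEnd ℂ) (uHat ψ.1 k s) * uHat φ.1 k s := by
  filter_upwards [(waveMap_spec ψ).2, (waveMap_spec φ).2] with s h1 h2
  filter_upwards [ae_restrict_of_ae h1, ae_restrict_of_ae h2, ae_restrict_mem measurableSet_Ioi]
    with k k1 k2 k0
  have hk : (0 : ℝ) ≤ 2 * k := by have : (0 : ℝ) < k := k0; linarith
  have hs : ((Real.sqrt (2 * k) : ℝ) : ℂ) * ((Real.sqrt (2 * k) : ℝ) : ℂ) = 2 * (k : ℂ) := by
    rw [← ofReal_mul, Real.mul_self_sqrt hk]; push_cast; rfl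
  rw [k1, k2, map_mul, conj_ofReal, ← hs]
  ring

theorem integral_conj_waveMap_slice (ψ φ : bdrySpace) :
    ∀ᵐ s ∂sphereMeasure, ∫ k in Set.Ioi (0 : ℝ),
      (starRingEnd ℂ) (waveMap ψ (k, s)) * waveMap φ (k, s) =
        halfForm (fun u => ψ.1 (u, s)) (fun u => φ.1 (u, s)) := by
  filter_upwards [conj_waveMap_mul_waveMap ψ φ] with s hs
  exact integral_congr_ae hs

/-- By Tonelli it suffices to bound the slices, and `integral_halfForm_le` bounds them by the
integrable slice norms of ψ² and (∂_uψ)². -/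
theorem memLp_waveMap (ψ : bdrySpace) : MemLp (waveMap ψ) 2 momentumMeasure := by
  have hm := (waveMap_spec ψ).1
  refine (memLp_two_iff_integrable_sq_norm hm.aestronglyMeasurable).2 ?_
  have hm2 : StronglyMeasurable fun p => ‖waveMap ψ p‖ ^ 2 := hm.norm.pow 2
  have hae : ∀ᵐ s ∂sphereMeasure, ∀ᵐ k ∂(volume : Measure ℝ).restrict (Set.Ioi 0),
      2 * k * ‖fourierPlancherel (fun u => ψ.1 (u, s)) k‖ ^ 2 = ‖waveMap ψ (k, s)‖ ^ 2 := by
    filter_upwards [conj_waveMap_mul_waveMap ψ ψ] with s hs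
    filter_upwards [hs] with k hk
    rw [mul_assoc _ _ (uHat _ _ _), conj_mul', conj_mul'] at hk
    exact_mod_cast hk.symm
  refine (integrable_prod_iff' hm2.aestronglyMeasurable).2 ⟨?_, ?_⟩
  · filter_upwards [hae, bdrySpace_ae_slice ψ] with s h1 h2
    refine Integrable.congr ?_ h1
    have h3 := (integrable_halfForm h2.1 h2.2 (ψ.2.1.hasDerivAt s) fun u => ψ.1 (u, s)).re
    refine (h3.congr (ae_of_all _ fun k => ?_)).restrict
    simp only [mul_assoc, conj_mul', RCLike.re_eq_complex_re]
    norm_cast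
  · have hψ := ((memLp_two_iff_integrable_sq ψ.2.2.1.1).1 ψ.2.2.1).integral_prod_right
    have hψ' := ((memLp_two_iff_integrable_sq ψ.2.2.2.1).1 ψ.2.2.2).integral_prod_right
    refine (hψ.add hψ').mono' ?_ ?_
    · exact (hm2.norm.integral_prod_left' (μ := (volume : Measure ℝ).restrict (Set.Ioi 0))).aestronglyMeasurable
    · filter_upwards [hae, bdrySpace_ae_slice ψ] with s h1 h2
      rw [Real.norm_of_nonneg (integral_nonneg fun k => norm_nonneg _)]
      simp_rw [norm_pow, norm_norm]
      rw [← integral_congr_ae h1]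
      exact integral_halfForm_le h2.1 h2.2 (ψ.2.1.hasDerivAt s)

/-- The one-particle inner product of null infinity. -/
def scriForm (ψ φ : bdrySpace) : ℂ :=
  ∫ s, halfForm (fun u => ψ.1 (u, s)) (fun u => φ.1 (u, s)) ∂sphereMeasure

theorem integrable_halfForm_slice (ψ φ : bdrySpace) :
    Integrable (fun s => halfForm (fun u => ψ.1 (u, s)) (fun u => φ.1 (u, s))) sphereMeasure := by
  have h := (integrable_conj_mul (memLp_waveMap ψ) (memLp_waveMap φ)).integral_prod_right
  exact h.congr (integral_conj_waveMap_slice ψ φ)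

theorem sqForm_waveMap (ψ φ : bdrySpace) :
    sqForm momentumMeasure (waveMap ψ) (waveMap φ) = scriForm ψ φ := by
  rw [sqForm, momentumMeasure, integral_prod_symm]
  · exact integral_congr_ae (integral_conj_waveMap_slice ψ φ)
  · exact integrable_conj_mul (memLp_waveMap ψ) (memLp_waveMap φ)

theorem scriForm_re (ψ φ : bdrySpace) : (scriForm ψ φ).re = bdryInner ψ φ := rfl

theorem scriForm_conj (ψ φ : bdrySpace) : (starRingEnd ℂ) (scriForm ψ φ) = scriForm φ ψ := by
  rw [scriForm, scriForm, ← integral_conj]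
  simp_rw [halfForm_conj]

theorem scriForm_im (ψ φ : bdrySpace) :
    (scriForm ψ φ).im = ∫ p, ψ.1 p * uDeriv φ.1 p ∂scriMeasure := by
  have hi : Integrable (fun p => ψ.1 p * uDeriv φ.1 p) scriMeasure :=
    ψ.2.2.1.integrable_mul φ.2.2.2
  rw [scriMeasure, integral_prod_symm _ hi]
  have h := integral_im (integrable_halfForm_slice ψ φ)
  simp only [RCLike.im_eq_complex_im] at h
  rw [scriForm, ← h]
  refine integral_congr_ae ?_
  filter_upwards [bdrySpace_ae_slice ψ, bdrySpace_ae_slice φ] with s h1 h2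
  exact halfForm_im h1.1 h2.1 h2.2 (φ.2.1.hasDerivAt s)

/-- The form is Hermitian, so its imaginary part is antisymmetric; subtracting ∫ ψ ∂_uφ with the
arguments exchanged doubles it, which gives σ/2. -/
theorem scriForm_eq (ψ φ : bdrySpace) :
    scriForm ψ φ = (bdryInner ψ φ : ℂ) + I / 2 * (bdrySymp ψ φ : ℂ) := by
  have h1 := congrArg Complex.im (scriForm_conj ψ φ)
  rw [conj_im, scriForm_im, scriForm_im] at h1
  have h2 : bdrySymp ψ φ = 2 * (scriForm ψ φ).im := by
    have i1 : Integrable (fun p => ψ.1 p * uDeriv φ.1 p) scriMeasure :=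
      ψ.2.2.1.integrable_mul φ.2.2.2
    have i2 : Integrable (fun p => φ.1 p * uDeriv ψ.1 p) scriMeasure :=
      φ.2.2.1.integrable_mul ψ.2.2.2
    rw [bdrySymp, integral_sub i1 i2, scriForm_im]
    linarith
  apply Complex.ext
  · rw [scriForm_re]; simp
  · rw [h2]; simp

end OneParticleMap

/-! ### BMS transformations on the boundary space -/

section BMSAction

open Complex Real

variable (A : SL2C) (f : SmoothS2)

theorem bmsPerm_symm_apply (p : Scri) : (bmsPerm A f).symm p =
    (confFactor A⁻¹ p.2 * p.1 - f (sphereAct A⁻¹ p.2), sphereAct A⁻¹ p.2) := rfl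

/-- By the cocycle identity, K_A(γ⁻¹p)⁻¹ is the conformal factor of A⁻¹ at p. -/
theorem bmsPush_apply (ψ : Scri → ℝ) (p : Scri) : bmsPush A f ψ p =
    confFactor A⁻¹ p.2 *
      ψ (confFactor A⁻¹ p.2 * p.1 - f (sphereAct A⁻¹ p.2), sphereAct A⁻¹ p.2) := by
  rw [bmsPush, bmsPerm_symm_apply]
  simp only
  rw [inv_eq_of_mul_eq_one_right (confFactor_inv A p.2)]

theorem contMDiff_confFactor : ContMDiff (𝓡 2) 𝓘(ℝ, ℝ) ∞ (confFactor A) :=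
  (contMDiff_dilation A).inv₀ fun s => (dilation_pos A s).ne'

theorem contMDiff_bmsPerm_symm : ContMDiff (𝓘(ℝ, ℝ).prod (𝓡 2)) (𝓘(ℝ, ℝ).prod (𝓡 2)) ∞
    (bmsPerm A f).symm := by
  have h1 : ContMDiff (𝓘(ℝ, ℝ).prod (𝓡 2)) 𝓘(ℝ, ℝ) ∞ fun p : Scri => confFactor A⁻¹ p.2 :=
    (contMDiff_confFactor A⁻¹).comp contMDiff_snd
  have h2 : ContMDiff (𝓘(ℝ, ℝ).prod (𝓡 2)) (𝓡 2) ∞ fun p : Scri => sphereAct A⁻¹ p.2 :=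
    (contMDiff_sphereAct A⁻¹).comp contMDiff_snd
  exact ((h1.mul contMDiff_fst).sub (f.contMDiff.comp h2)).prodMk h2

theorem SmoothScri.bmsPush {ψ : Scri → ℝ} (h : SmoothScri ψ) : SmoothScri (bmsPush A f ψ) := by
  have e : NullInfinity.bmsPush A f ψ =
      fun p => confFactor A⁻¹ p.2 * ψ ((bmsPerm A f).symm p) := by
    funext p
    rw [bmsPush_apply, bmsPerm_symm_apply]
  rw [e]
  have h1 : ContMDiff (𝓘(ℝ, ℝ).prod (𝓡 2)) 𝓘(ℝ, ℝ) ∞ fun p : Scri => confFactor A⁻¹ p.2 :=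
    (contMDiff_confFactor A⁻¹).comp contMDiff_snd
  exact h1.mul (ContMDiff.comp h (contMDiff_bmsPerm_symm A f))

theorem continuous_bmsPerm_symm : Continuous (bmsPerm A f).symm :=
  (contMDiff_bmsPerm_symm A f).continuous

theorem uDeriv_bmsPush {ψ : Scri → ℝ} (h : SmoothScri ψ) :
    uDeriv (bmsPush A f ψ) = fun p => confFactor A⁻¹ p.2 * bmsPush A f (uDeriv ψ) p := by
  funext p
  have h1 := (h.hasDerivAt (sphereAct A⁻¹ p.2)
    (confFactor A⁻¹ p.2 * p.1 - f (sphereAct A⁻¹ p.2)))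
  have h2 : HasDerivAt (fun u : ℝ => confFactor A⁻¹ p.2 * u - f (sphereAct A⁻¹ p.2))
      (confFactor A⁻¹ p.2) p.1 := by
    simpa using ((hasDerivAt_id p.1).const_mul (confFactor A⁻¹ p.2)).sub_const
      (f (sphereAct A⁻¹ p.2))
  have h3 := (h1.comp p.1 h2).const_mul (confFactor A⁻¹ p.2)
  rw [uDeriv, bmsPush_apply]
  have e : (fun u => bmsPush A f ψ (u, p.2)) = fun u => confFactor A⁻¹ p.2 *
      ψ (confFactor A⁻¹ p.2 * u - f (sphereAct A⁻¹ p.2), sphereAct A⁻¹ p.2) := by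
    funext u
    rw [bmsPush_apply]
  rw [e]
  refine h3.deriv.trans ?_
  ring

theorem exists_confFactor_bounds : ∃ C : ℝ, 0 < C ∧ ∀ s, confFactor A s ≤ C ∧
    (confFactor A s)⁻¹ ≤ C := by
  obtain ⟨C₁, h1⟩ := (isCompact_univ (X := S2)).bddAbove_image
    (continuous_confFactor A).continuousOn
  obtain ⟨C₂, h2⟩ := (isCompact_univ (X := S2)).bddAbove_image
    (continuous_dilation A).continuousOn
  refine ⟨max 1 (max C₁ C₂), by positivity, fun s => ⟨?_, ?_⟩⟩
  · exact (h1 ⟨s, trivial, rfl⟩).trans ((le_max_left _ _).trans (le_max_right _ _))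
  · rw [confFactor, inv_inv]
    exact (h2 ⟨s, trivial, rfl⟩).trans ((le_max_right _ _).trans (le_max_right _ _))

/-- BMS maps do not preserve du dμ, but the density is controlled by the conformal factor, which is
bounded above and below on the compact sphere. This is enough for square integrability. -/
theorem exists_map_bmsPerm_symm_le : ∃ C : ENNReal, C ≠ ⊤ ∧
    scriMeasure.map (bmsPerm A f).symm ≤ C • scriMeasure := by
  obtain ⟨C, hC, hb⟩ := exists_confFactor_bounds A⁻¹
  have hm := (continuous_bmsPerm_symm A f).measurable
  refine ⟨ENNReal.ofReal (C ^ 3), ENNReal.ofReal_ne_top, Measure.le_intro fun B hB _ => ?_⟩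
  rw [Measure.map_apply hm hB, Measure.smul_apply, scriMeasure,
    Measure.prod_apply_symm (hm hB), Measure.prod_apply_symm hB, smul_eq_mul,
    ← isConformalJacobian A⁻¹ _ (measurable_measure_prodMk_right hB),
    ← lintegral_const_mul' _ _ ENNReal.ofReal_ne_top]
  refine lintegral_mono fun s => ?_
  have hκ := confFactor_pos A⁻¹ s
  set κ := confFactor A⁻¹ s with hκ_def
  have e : (fun u => (u, s)) ⁻¹' ((bmsPerm A f).symm ⁻¹' B) =
      (fun u => κ * u) ⁻¹' ((fun u => u - f (sphereAct A⁻¹ s)) ⁻¹'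
        ((fun u => (u, sphereAct A⁻¹ s)) ⁻¹' B)) := rfl
  simp only
  rw [e, Real.volume_preimage_mul_left hκ.ne', (measurePreserving_sub_right volume _).measure_preimage
      (measurable_prodMk_right hB).nullMeasurableSet, abs_of_pos (inv_pos.2 hκ),
    mul_comm (volume _), ← mul_assoc, ← ENNReal.ofReal_mul (by positivity)]
  refine mul_le_mul_left (ENNReal.ofReal_le_ofReal ?_) _
  -- κ⁻¹ comes from scaling u; κ² is the Jacobian on the sphere, and the remaining κ⁻³ is at most
  -- C³.
  have h1 : κ⁻¹ = κ⁻¹ ^ 3 * κ ^ 2 := by field_simp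
  rw [h1]
  gcongr
  exact (hb s).2

theorem memLp_bmsPush {φ : Scri → ℝ} (h : MemLp φ 2 scriMeasure) :
    MemLp (bmsPush A f φ) 2 scriMeasure := by
  obtain ⟨C, hC, hle⟩ := exists_map_bmsPerm_symm_le A f
  obtain ⟨M, hM, hb⟩ := exists_confFactor_bounds A⁻¹
  have h1 : MemLp φ 2 (scriMeasure.map (bmsPerm A f).symm) :=
    (h.smul_measure hC).mono_measure hle
  have h2 : MemLp (fun p => φ ((bmsPerm A f).symm p)) 2 scriMeasure :=
    h1.comp_of_map (continuous_bmsPerm_symm A f).measurable.aemeasurable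
  have e : bmsPush A f φ = fun p => confFactor A⁻¹ p.2 * φ ((bmsPerm A f).symm p) := by
    funext p
    rw [bmsPush_apply, bmsPerm_symm_apply]
  rw [e]
  refine (h2.const_mul M).of_le ?_ (ae_of_all _ fun p => ?_)
  · exact (((continuous_confFactor A⁻¹).comp continuous_snd).aestronglyMeasurable).mul h2.1
  · rw [norm_mul, norm_mul, Real.norm_of_nonneg (confFactor_pos _ _).le, Real.norm_of_nonneg hM.le]
    exact mul_le_mul_of_nonneg_right (hb p.2).1 (norm_nonneg _)

theorem bmsPush_mem (ψ : bdrySpace) : bmsPush A f ψ.1 ∈ bdrySpace := by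
  obtain ⟨h1, h2, h3⟩ := ψ.2
  refine ⟨h1.bmsPush A f, memLp_bmsPush A f h2, ?_⟩
  obtain ⟨M, hM, hb⟩ := exists_confFactor_bounds A⁻¹
  have h4 := memLp_bmsPush A f h3
  rw [uDeriv_bmsPush A f h1]
  refine (h4.const_mul M).of_le ?_ (ae_of_all _ fun p => ?_)
  · exact (((continuous_confFactor A⁻¹).comp continuous_snd).aestronglyMeasurable).mul h4.1
  · rw [norm_mul, norm_mul, Real.norm_of_nonneg (confFactor_pos _ _).le, Real.norm_of_nonneg hM.le]
    exact mul_le_mul_of_nonneg_right (hb p.2).1 (norm_nonneg _)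

/-- The action of a BMS transformation on the boundary space. -/
def bmsPushLin : bdrySpace →ₗ[ℝ] bdrySpace where
  toFun ψ := ⟨bmsPush A f ψ.1, bmsPush_mem A f ψ⟩
  map_add' ψ φ := by
    apply Subtype.ext
    funext p
    exact mul_add _ _ _
  map_smul' r ψ := by
    apply Subtype.ext
    funext p
    exact mul_left_comm _ _ _

theorem map_sphereAct_withDensity : (sphereMeasure.withDensity fun s =>
    ENNReal.ofReal (confFactor A s ^ 2)).map (sphereAct A) = sphereMeasure := by
  have hm := (continuous_sphereAct A).measurable
  have hd : Measurable fun s => ENNReal.ofReal (confFactor A s ^ 2) :=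
    ((continuous_confFactor A).pow 2).measurable.ennreal_ofReal
  ext B hB
  rw [Measure.map_apply hm hB, withDensity_apply _ (hm hB), ← lintegral_indicator (hm hB)]
  have h := isConformalJacobian A (B.indicator fun _ => 1) (measurable_const.indicator hB)
  rw [lintegral_indicator_const hB, one_mul] at h
  rw [← h]
  congr 1
  funext s
  by_cases hs : sphereAct A s ∈ B
  · rw [Set.indicator_of_mem (show s ∈ sphereAct A ⁻¹' B from hs), Set.indicator_of_mem hs, one_mul]
  · rw [Set.indicator_of_notMem (show s ∉ sphereAct A ⁻¹' B from hs), Set.indicator_of_notMem hs,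
      zero_mul]

theorem integral_confFactor_sq_smul {F : S2 → ℂ} (hF : AEStronglyMeasurable F sphereMeasure) :
    ∫ s, ((confFactor A s : ℝ) : ℂ) ^ 2 * F (sphereAct A s) ∂sphereMeasure =
      ∫ s, F s ∂sphereMeasure := by
  have hm := (continuous_sphereAct A).measurable
  have hd : Measurable fun s => Real.toNNReal (confFactor A s ^ 2) :=
    ((continuous_confFactor A).pow 2).measurable.real_toNNReal
  have hd' := map_sphereAct_withDensity A
  have h1 : ∫ s, F s ∂sphereMeasure = ∫ s, F (sphereAct A s)
      ∂(sphereMeasure.withDensity fun s => ENNReal.ofReal (confFactor A s ^ 2)) := by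
    conv_lhs => rw [← hd']
    refine integral_map hm.aemeasurable ?_
    rwa [hd']
  rw [h1]
  change _ = ∫ s, F (sphereAct A s)
      ∂(sphereMeasure.withDensity fun s => ((Real.toNNReal (confFactor A s ^ 2) : NNReal) : ENNReal))
  rw [integral_withDensity_eq_integral_smul hd]
  congr 1
  funext s
  rw [NNReal.smul_def, Real.coe_toNNReal _ (sq_nonneg _), real_smul, ofReal_pow]

theorem quasiMeasurePreserving_sphereAct :
    Measure.QuasiMeasurePreserving (sphereAct A) sphereMeasure sphereMeasure := by
  refine ⟨(continuous_sphereAct A).measurable, ?_⟩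
  have h : sphereMeasure ≪ sphereMeasure.withDensity fun s =>
      ENNReal.ofReal (confFactor A s ^ 2) :=
    withDensity_absolutelyContinuous'
      ((continuous_confFactor A).pow 2).measurable.ennreal_ofReal.aemeasurable
      (ae_of_all _ fun s => by
        rw [Ne, ENNReal.ofReal_eq_zero, not_le]
        exact pow_pos (confFactor_pos A s) 2)
  have h2 := h.map (continuous_sphereAct A).measurable
  rwa [map_sphereAct_withDensity] at h2

/-- The core of (a): the weight κ of each argument gives κ², the affine substitution in u leaves the
slice form unchanged, and κ² dμ is the image of the surface measure under the change of direction.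
-/
theorem scriForm_bmsPushLin (ψ φ : bdrySpace) :
    scriForm (bmsPushLin A f ψ) (bmsPushLin A f φ) = scriForm ψ φ := by
  rw [scriForm, scriForm, ← integral_confFactor_sq_smul A⁻¹ (integrable_halfForm_slice ψ φ).1]
  refine integral_congr_ae ?_
  have hq := quasiMeasurePreserving_sphereAct A⁻¹
  filter_upwards [hq.ae (bdrySpace_ae_slice ψ), hq.ae (bdrySpace_ae_slice φ)] with s h1 h2
  have hκ := confFactor_pos A⁻¹ s
  have e : ∀ χ : bdrySpace, (fun u => (bmsPushLin A f χ).1 (u, s)) = confFactor A⁻¹ s • fun u =>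
      (fun v => χ.1 (v, sphereAct A⁻¹ s)) (confFactor A⁻¹ s * u - f (sphereAct A⁻¹ s)) := by
    intro χ
    funext u
    exact bmsPush_apply A f χ.1 (u, s)
  rw [e ψ, e φ, halfForm_const_mul (memLp_comp_affine h1.1 hκ.ne' _)
    (memLp_comp_affine h2.1 hκ.ne' _), halfForm_comp_affine h1.1 h2.1 hκ]

theorem bdrySymp_eq_im (ψ φ : bdrySpace) : bdrySymp ψ φ = 2 * (scriForm ψ φ).im := by
  rw [scriForm_eq]
  simp

/-- The symplectic form is twice the imaginary part of the invariant one-particle form. -/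
theorem bdrySymp_bmsPushLin (ψ φ : bdrySpace) :
    bdrySymp (bmsPushLin A f ψ) (bmsPushLin A f φ) = bdrySymp ψ φ := by
  rw [bdrySymp_eq_im, bdrySymp_eq_im, scriForm_bmsPushLin]

theorem waveMap_translate (t : ℝ) (ψ : bdrySpace) :
    waveMap (bmsPushLin 1 (ContMDiffMap.const t) ψ) =ᵐ[momentumMeasure]
      fun p => cexp (I * (p.1 * t : ℝ)) * waveMap ψ p := by
  have h1 := waveMap_spec (bmsPushLin 1 (ContMDiffMap.const t) ψ)
  have h2 := waveMap_spec ψ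
  have hs : MeasurableSet {p : Scri | waveMap (bmsPushLin 1 (ContMDiffMap.const t) ψ) p =
      cexp (I * (p.1 * t : ℝ)) * waveMap ψ p} :=
    measurableSet_eq_fun h1.1.measurable
      ((Continuous.measurable (by fun_prop)).mul h2.1.measurable)
  have hfib : ∀ᵐ s ∂sphereMeasure, ∀ᵐ k ∂(volume : Measure ℝ).restrict (Set.Ioi 0),
      waveMap (bmsPushLin 1 (ContMDiffMap.const t) ψ) (k, s) =
        cexp (I * (k * t : ℝ)) * waveMap ψ (k, s) := by
    filter_upwards [h1.2, h2.2, bdrySpace_ae_slice ψ] with s a1 a2 a3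
    refine ae_restrict_of_ae ?_
    filter_upwards [a1, a2, fourierPlancherel_comp_affine a3.1 one_pos t] with k k1 k2 k3
    have e : (fun u => (bmsPushLin 1 (ContMDiffMap.const t) ψ).1 (u, s)) =
        fun u => ψ.1 (1 * u - t, s) := by
      funext u
      refine (bmsPush_apply 1 (ContMDiffMap.const t) ψ.1 (u, s)).trans ?_
      rw [inv_one]
      simp only [confFactor_one, sphereAct_one, one_mul]
      rfl
    rw [k1, k2, uHat, e, k3, uHat]
    simp only [inv_one, one_mul, ofReal_one]
    ring
  -- The identity is known slice by slice; measurability of the set where it holds turns this into a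
  -- product null set.
  have hs' := (Measure.ae_prod_iff_ae_ae (μ := sphereMeasure)
    (ν := (volume : Measure ℝ).restrict (Set.Ioi 0)) (measurable_swap hs)).2 hfib
  have hsw : Measure.QuasiMeasurePreserving (Prod.swap : Scri → S2 × ℝ) momentumMeasure
      (sphereMeasure.prod ((volume : Measure ℝ).restrict (Set.Ioi 0))) :=
    Measure.measurePreserving_swap.quasiMeasurePreserving
  exact hsw.ae hs'

end BMSAction

/-! ### The representation of the BMS group on the algebra -/

section BMSRepresentation

/-- The conformal factor can be read off from the transformation itself, so the action on functions
does not depend on the matrix chosen in SL(2,ℂ). -/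
theorem bmsPerm_sub (A : SL2C) (f : SmoothS2) (q : Scri) :
    (bmsPerm A f (q.1 + 1, q.2)).1 - (bmsPerm A f q).1 = confFactor A q.2 := by
  change confFactor A q.2 * (q.1 + 1 + f q.2) - confFactor A q.2 * (q.1 + f q.2) = _
  ring

theorem bmsPush_congr {A B : SL2C} {f g : SmoothS2} (h : bmsPerm A f = bmsPerm B g)
    (ψ : Scri → ℝ) : bmsPush A f ψ = bmsPush B g ψ := by
  funext p
  rw [bmsPush, bmsPush, ← bmsPerm_sub A f, ← bmsPerm_sub B g, h]

theorem bmsPush_mul (A B : SL2C) (f g : SmoothS2) (ψ : Scri → ℝ) :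
    bmsPush (A * B) (g + pullWeight B f) ψ = bmsPush A f (bmsPush B g ψ) := by
  funext p
  have h : ∀ q, (bmsPerm (A * B) (g + pullWeight B f)).symm q =
      (bmsPerm B g).symm ((bmsPerm A f).symm q) := by
    intro q
    rw [← bmsPerm_mul]
    rfl
  rw [bmsPush, bmsPush, bmsPush, h, confFactor_mul, mul_inv, mul_assoc]
  congr 3
  change sphereAct B (sphereAct B⁻¹ ((bmsPerm A f).symm p).2) = _
  rw [← sphereAct_mul, mul_inv_cancel, sphereAct_one]

theorem bmsPush_one (ψ : Scri → ℝ) : bmsPush 1 0 ψ = ψ := by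
  funext p
  rw [bmsPush, bmsPerm_one, confFactor_one, inv_one, one_mul]
  rfl

theorem exists_eq_bms (γ : BMSGroup) : ∃ A f, γ = bms A f := by
  obtain ⟨A, f, h⟩ := γ.2
  exact ⟨A, f, Subtype.ext h⟩

/-- The action of the BMS group on the boundary space. -/
def bmsAct (γ : BMSGroup) : bdrySpace →ₗ[ℝ] bdrySpace :=
  bmsPushLin γ.2.choose γ.2.choose_spec.choose

theorem bmsAct_bms (A : SL2C) (f : SmoothS2) : bmsAct (bms A f) = bmsPushLin A f := by
  refine LinearMap.ext fun ψ => Subtype.ext ?_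
  exact bmsPush_congr (bms A f).2.choose_spec.choose_spec.symm ψ.1

theorem bms_mul (A B : SL2C) (f g : SmoothS2) :
    bms A f * bms B g = bms (A * B) (g + pullWeight B f) :=
  Subtype.ext (bmsPerm_mul A B f g)

theorem bms_one : bms 1 0 = 1 := Subtype.ext bmsPerm_one

theorem bmsAct_mul (γ δ : BMSGroup) (ψ : bdrySpace) :
    bmsAct (γ * δ) ψ = bmsAct γ (bmsAct δ ψ) := by
  obtain ⟨A, f, rfl⟩ := exists_eq_bms γ
  obtain ⟨B, g, rfl⟩ := exists_eq_bms δ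
  rw [bms_mul, bmsAct_bms, bmsAct_bms, bmsAct_bms]
  exact Subtype.ext (bmsPush_mul A B f g ψ.1)

theorem bmsAct_one (ψ : bdrySpace) : bmsAct 1 ψ = ψ := by
  rw [← bms_one, bmsAct_bms]
  exact Subtype.ext (bmsPush_one ψ.1)

theorem bdrySymp_bmsAct (γ : BMSGroup) (ψ φ : bdrySpace) :
    bdrySymp (bmsAct γ ψ) (bmsAct γ φ) = bdrySymp ψ φ :=
  bdrySymp_bmsPushLin _ _ ψ φ

theorem scriForm_bmsAct (γ : BMSGroup) (ψ φ : bdrySpace) :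
    scriForm (bmsAct γ ψ) (bmsAct γ φ) = scriForm ψ φ :=
  scriForm_bmsPushLin _ _ ψ φ

/-- The representation of the BMS group by automorphisms of the boundary algebra. -/
def bmsRep : BMSGroup →* (BdryAlgebra ≃⋆ₐ[ℂ] BdryAlgebra) :=
  MonoidHom.mk'
    (fun γ => sympEquiv (bmsAct γ) (bmsAct γ⁻¹) (bdrySymp_bmsAct γ) (bdrySymp_bmsAct γ⁻¹)
      (fun ψ => by rw [← bmsAct_mul, mul_inv_cancel, bmsAct_one])
      (fun ψ => by rw [← bmsAct_mul, inv_mul_cancel, bmsAct_one]))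
    fun γ δ => starAlgEquiv_ext_gen fun ψ => by
      change sympHom _ _ (gen ψ) = sympHom _ _ (sympHom _ _ (gen ψ))
      rw [sympHom_gen, sympHom_gen, sympHom_gen, bmsAct_mul]

theorem bmsRep_gen (γ : BMSGroup) (ψ : bdrySpace) : bmsRep γ (gen ψ) = gen (bmsAct γ ψ) :=
  sympHom_gen (bmsAct γ) (bdrySymp_bmsAct γ) ψ

theorem isBMSRepresentation_bmsRep : IsBMSRepresentation bmsRep := fun A f ψ =>
  ⟨bmsPush_mem A f ψ, by rw [bmsRep_gen, bmsAct_bms]; rfl⟩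

theorem IsBMSRepresentation.eq_bmsRep {α : BMSGroup →* (BdryAlgebra ≃⋆ₐ[ℂ] BdryAlgebra)}
    (h : IsBMSRepresentation α) : α = bmsRep := by
  refine MonoidHom.ext fun γ => starAlgEquiv_ext_gen fun ψ => ?_
  obtain ⟨A, f, rfl⟩ := exists_eq_bms γ
  obtain ⟨_, h1⟩ := h A f ψ
  obtain ⟨_, h2⟩ := isBMSRepresentation_bmsRep A f ψ
  rw [h1, h2]

end BMSRepresentation

/-! ### The vacuum state and its invariance -/

section BoundaryState

open MvPolynomial

/-- The index set of the basis of the boundary space. -/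
abbrev BdryIndex : Type := Module.Basis.ofVectorSpaceIndex ℝ bdrySpace

theorem twoPt_waveMap (ψ φ : bdrySpace) : twoPt memLp_waveMap ψ φ = scriForm ψ φ := by
  rw [twoPt_apply, sqForm_waveMap]

theorem scriForm_sub (ψ φ : bdrySpace) :
    scriForm ψ φ - scriForm φ ψ = Complex.I * (bdrySymp ψ φ : ℂ) := by
  rw [← scriForm_conj ψ φ, bdrySymp_eq_im, Complex.sub_conj]
  push_cast
  ring

/-- The Fock representation of the boundary algebra. -/
def fockRep : BdryAlgebra →ₐ[ℂ] Module.End ℂ (MvPolynomial BdryIndex ℂ) :=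
  bdryLift (fieldLin bdryBasis (twoPt memLp_waveMap)) fun ψ φ => by
    refine (fieldOp_comm bdryBasis _ ψ φ).trans ?_
    rw [twoPt_waveMap, twoPt_waveMap, scriForm_sub]

theorem fockRep_gen (ψ : bdrySpace) :
    fockRep (gen ψ) = fieldOp bdryBasis (twoPt memLp_waveMap) ψ := bdryLift_gen _ _ ψ

/-- The Fock vector `π(a) Ω`. -/
def fockState : BdryAlgebra →ₗ[ℂ] FockSpace momentumMeasure :=
  fockVec bdryBasis memLp_waveMap ∘ₗ LinearMap.applyₗ 1 ∘ₗ fockRep.toLinearMap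

theorem fockState_apply (a : BdryAlgebra) :
    fockState a = fockVec bdryBasis memLp_waveMap (fockRep a 1) := rfl

/-- The vacuum expectation value. -/
def bdryVacuum : BdryAlgebra →ₗ[ℂ] ℂ :=
  lcoeff ℂ 0 ∘ₗ LinearMap.applyₗ 1 ∘ₗ
    fockRep.toLinearMap

theorem bdryVacuum_apply (a : BdryAlgebra) : bdryVacuum a = constantCoeff (fockRep a 1) := rfl

/-- Fields are symmetric on Fock vectors, and symmetry propagates through sums and products;
positivity of the vacuum functional follows. -/
theorem inner_fockRep (a : BdryAlgebra) (s s' : MvPolynomial BdryIndex ℂ) :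
    inner ℂ (fockVec bdryBasis memLp_waveMap s)
        (fockVec bdryBasis memLp_waveMap (fockRep a s')) =
      inner ℂ (fockVec bdryBasis memLp_waveMap (fockRep (star a) s))
        (fockVec bdryBasis memLp_waveMap s') := by
  induction a using bdry_induction generalizing s s' with
  | halg z =>
    rw [star_algebraMap_bdry, AlgHom.commutes, AlgHom.commutes, Module.algebraMap_end_apply,
      Module.algebraMap_end_apply, map_smul, map_smul, inner_smul_left, inner_smul_right,
      RCLike.star_def, Complex.conj_conj]
  | hgen ψ => rw [star_gen, fockRep_gen, inner_fieldOp]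
  | hadd a b ha hb =>
    rw [star_add, map_add, map_add, LinearMap.add_apply, LinearMap.add_apply, map_add, map_add,
      inner_add_left, inner_add_right, ha, hb]
  | hmul a b ha hb =>
    rw [star_mul, map_mul, map_mul, Module.End.mul_apply, Module.End.mul_apply, ha, hb]

theorem inner_fockState (a c : BdryAlgebra) :
    inner ℂ (fockState a) (fockState c) = bdryVacuum (star a * c) := by
  rw [bdryVacuum_apply, ← inner_fockVec_one bdryBasis memLp_waveMap, map_mul, Module.End.mul_apply,
    inner_fockRep, star_star]
  rfl

theorem bdryVacuum_one : bdryVacuum 1 = 1 := by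
  rw [bdryVacuum_apply, map_one fockRep, Module.End.one_apply]
  exact map_one constantCoeff

theorem bdryVacuum_gen_mul_gen (ψ φ : bdrySpace) :
    bdryVacuum (gen ψ * gen φ) = scriForm ψ φ := by
  rw [bdryVacuum_apply, map_mul, Module.End.mul_apply, fockRep_gen, fockRep_gen,
    constantCoeff_fieldOp, fieldOp_apply _ _ φ, Derivation.map_one_eq_zero, add_zero, mul_one,
    lineDer_emb, constantCoeff_C, twoPt_waveMap]

theorem isQuasiFree_bdryVacuum : IsQuasiFree bdryVacuum := by
  intro n ψ
  have h := constantCoeff_prod_fieldOp bdryBasis (twoPt memLp_waveMap) n ψ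
  have e : fockRep (List.ofFn fun i => gen (ψ i)).prod =
      (List.ofFn fun i => fieldOp bdryBasis (twoPt memLp_waveMap) (ψ i)).prod := by
    rw [map_list_prod, List.map_ofFn]
    simp only [Function.comp_def, fockRep_gen]
  rw [bdryVacuum_apply, e, h, pairingSum]
  simp only [twoPt_waveMap, bdryVacuum_gen_mul_gen]

theorem isBdryState_bdryVacuum : IsBdryState bdryVacuum where
  isState := isState_of_inner bdryVacuum_one inner_fockState
  quasiFree := isQuasiFree_bdryVacuum
  twoPoint ψ φ := by rw [bdryVacuum_gen_mul_gen, scriForm_eq]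

theorem IsBdryState.eq_bdryVacuum {w : BdryAlgebra →ₗ[ℂ] ℂ} (h : IsBdryState w) :
    w = bdryVacuum :=
  h.quasiFree.ext isQuasiFree_bdryVacuum fun ψ φ => by
    rw [h.twoPoint, bdryVacuum_gen_mul_gen, scriForm_eq]

/-- The transformed functional is again quasi-free, and its two-point function is the same by
`scriForm_bmsAct`. -/
theorem bdryVacuum_bmsRep (γ : BMSGroup) (a : BdryAlgebra) :
    bdryVacuum (bmsRep γ a) = bdryVacuum a := by
  have h := isQuasiFree_bdryVacuum.comp (β := (bmsRep γ : BdryAlgebra →ₐ[ℂ] BdryAlgebra))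
    (T := bmsAct γ) fun ψ => bmsRep_gen γ ψ
  refine LinearMap.congr_fun (h.ext isQuasiFree_bdryVacuum fun ψ φ => ?_) a
  change bdryVacuum (bmsRep γ (gen ψ * gen φ)) = _
  rw [map_mul, bmsRep_gen, bmsRep_gen, bdryVacuum_gen_mul_gen, bdryVacuum_gen_mul_gen,
    scriForm_bmsAct]

/-- Substituting the one-particle action into polynomials realizes α_γ, because it intertwines the
field operators of generators. -/
theorem secondQuant_fockRep (γ : BMSGroup) (a : BdryAlgebra) (s : MvPolynomial BdryIndex ℂ) :
    secondQuant bdryBasis (bmsAct γ) (fockRep a s) =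
      fockRep (bmsRep γ a) (secondQuant bdryBasis (bmsAct γ) s) := by
  induction a using bdry_induction generalizing s with
  | halg z =>
    rw [AlgHomClass.commutes (bmsRep γ), AlgHom.commutes, Module.algebraMap_end_apply,
      Module.algebraMap_end_apply, map_smul]
  | hgen ψ =>
    rw [bmsRep_gen, fockRep_gen, fockRep_gen, secondQuant_fieldOp]
    intro v w
    rw [twoPt_waveMap, twoPt_waveMap, scriForm_bmsAct]
  | hadd a b ha hb =>
    rw [map_add, map_add, map_add, LinearMap.add_apply, LinearMap.add_apply, map_add, ha, hb]
  | hmul a b ha hb =>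
    rw [map_mul, map_mul, map_mul, Module.End.mul_apply, Module.End.mul_apply, ha, hb]

theorem fockState_bmsRep (γ : BMSGroup) (a : BdryAlgebra) :
    fockState (bmsRep γ a) = fockVec bdryBasis memLp_waveMap
      (secondQuant bdryBasis (bmsAct γ) (fockRep a 1)) := by
  rw [secondQuant_fockRep, map_one]
  rfl

end BoundaryState

/-! ### Positivity of the energy in Fock space -/

section PhaseMultiplier

open Complex

variable {Y : Type*} [MeasurableSpace Y] {μ : Measure Y}

theorem memLp_phase_mul {q : Y → ℂ} (hq : Measurable q) (h1 : ∀ z, ‖q z‖ = 1) (f : Lp ℂ 2 μ) :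
    MemLp (fun z => q z * f z) 2 μ :=
  (Lp.memLp f).of_le (hq.aestronglyMeasurable.mul (Lp.aestronglyMeasurable f))
    (ae_of_all _ fun z => by rw [norm_mul, h1, one_mul])

/-- Multiplication by a phase. -/
def phaseMul {q : Y → ℂ} (hq : Measurable q) (h1 : ∀ z, ‖q z‖ = 1) :
    Lp ℂ 2 μ →ₗᵢ[ℂ] Lp ℂ 2 μ where
  toFun f := (memLp_phase_mul hq h1 f).toLp _
  map_add' f g := by
    rw [← MemLp.toLp_add, MemLp.toLp_eq_toLp_iff]
    filter_upwards [Lp.coeFn_add f g] with z hz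
    rw [hz, Pi.add_apply, Pi.add_apply, mul_add]
  map_smul' c f := by
    rw [RingHom.id_apply, ← MemLp.toLp_const_smul, MemLp.toLp_eq_toLp_iff]
    filter_upwards [Lp.coeFn_smul c f] with z hz
    rw [hz, Pi.smul_apply, Pi.smul_apply, smul_eq_mul, smul_eq_mul, mul_left_comm]
  norm_map' f := by
    change ‖(memLp_phase_mul hq h1 f).toLp _‖ = ‖f‖
    rw [Lp.norm_toLp, Lp.norm_def]
    congr 1
    exact eLpNorm_congr_norm_ae (ae_of_all _ fun z => by rw [norm_mul, h1, one_mul])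

theorem phaseMul_coe {q : Y → ℂ} (hq : Measurable q) (h1 : ∀ z, ‖q z‖ = 1) (f : Lp ℂ 2 μ) :
    (phaseMul hq h1 f : Y → ℂ) =ᵐ[μ] fun z => q z * f z :=
  (memLp_phase_mul hq h1 f).coeFn_toLp

theorem hasDerivAt_clm_smul {H F : Type*} [NormedAddCommGroup H] [NormedSpace ℂ H]
    [NormedAddCommGroup F] [NormedSpace ℂ F] [NormedSpace ℝ F] [IsScalarTower ℝ ℂ F] (L : H →L[ℂ] F) {g : ℝ → H} {y : H} {t : ℝ} {c : ℂ}
    (h : HasDerivAt g (c • y) t) : HasDerivAt (fun t => L (g t)) (c • L y) t := by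
  have h1 := (L.restrictScalars ℝ).hasFDerivAt.comp_hasDerivAt t h
  rw [ContinuousLinearMap.coe_restrictScalars', map_smul] at h1
  exact h1

theorem norm_exp_I_mul (r : ℝ) : ‖cexp (I * (r : ℂ))‖ = 1 := by
  rw [mul_comm, norm_exp_ofReal_mul_I]

/-- Norm convergence of the difference quotients yields an almost everywhere convergent subsequence,
whose limit is the pointwise derivative of the phase. -/
theorem ae_eq_mul_of_hasDerivAt {S : Y → ℝ} {g : ℝ → Lp ℂ 2 μ} {f y : Lp ℂ 2 μ}
    (hg : ∀ t, (g t : Y → ℂ) =ᵐ[μ] fun z => cexp (I * (t * S z : ℝ)) * f z)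
    (hd : HasDerivAt g (I • y) 0) : (y : Y → ℂ) =ᵐ[μ] fun z => (S z : ℂ) * f z := by
  have h1 := tendstoInMeasure_of_tendsto_Lp hd.tendsto_slope_zero
  obtain ⟨ns, hns, hae⟩ := h1.exists_seq_tendsto_ae'
  have h2 : ∀ᵐ z ∂μ, ∀ i : ℕ, ((ns i)⁻¹ • (g (0 + ns i) - g 0) : Lp ℂ 2 μ) z =
      (ns i)⁻¹ • (cexp (I * ((0 + ns i) * S z : ℝ)) * f z - cexp (I * ((0 : ℝ) * S z : ℝ)) * f z) := by
    rw [ae_all_iff]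
    intro i
    filter_upwards [Lp.coeFn_smul (ns i)⁻¹ (g (0 + ns i) - g 0), Lp.coeFn_sub (g (0 + ns i)) (g 0),
      hg (0 + ns i), hg 0] with z z1 z2 z3 z4
    rw [z1, Pi.smul_apply, z2, Pi.sub_apply, z3, z4]
  filter_upwards [hae, h2, Lp.coeFn_smul I y] with z z1 z2 z3
  have h3 : HasDerivAt (fun t : ℝ => cexp (I * (t * S z : ℝ)) * f z) (I * S z * f z) 0 := by
    have h4 : HasDerivAt (fun t : ℝ => I * ((t * S z : ℝ) : ℂ)) (I * S z) 0 := by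
      simpa using (((hasDerivAt_id (0 : ℝ)).mul_const (S z)).ofReal_comp).const_mul I
    simpa using h4.cexp.mul_const (f z)
  have h5 := h3.tendsto_slope_zero.comp hns
  simp only [z2] at z1
  have h6 := tendsto_nhds_unique z1 h5
  rw [z3, Pi.smul_apply, smul_eq_mul, mul_assoc] at h6
  exact mul_left_cancel₀ I_ne_zero h6

theorem continuous_integral_phase {S : Y → ℝ} (hS : Measurable S) (f : Lp ℂ 2 μ) :
    Continuous fun t : ℝ => ∫ z, inner ℂ (f z) (cexp (I * (t * S z : ℝ)) * f z) ∂μ := by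
  have hi : Integrable (fun z => ‖f z‖ ^ 2) μ := (Lp.memLp f).integrable_norm_pow two_ne_zero
  refine continuous_of_dominated (bound := fun z => ‖f z‖ ^ 2) (fun t => ?_) (fun t => ?_) hi ?_
  · refine (Lp.aestronglyMeasurable f).inner (AEStronglyMeasurable.mul ?_ (Lp.aestronglyMeasurable f))
    exact Measurable.aestronglyMeasurable (by fun_prop)
  · refine ae_of_all _ fun z => (norm_inner_le_norm _ _).trans ?_
    rw [norm_mul, norm_exp_I_mul, one_mul, pow_two]
  · refine ae_of_all _ fun z => ?_
    refine continuous_const.inner (Continuous.mul ?_ continuous_const)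
    fun_prop

end PhaseMultiplier

/-! ### Flows acting by phases of the total energy -/

section Energy

open Complex

variable {X : Type*} [MeasurableSpace X] {ν : Measure X} [SigmaFinite ν] {e : X → ℝ}
  {H : Type*} [NormedAddCommGroup H] [InnerProductSpace ℂ H]

theorem ae_forall_pi {p : X → Prop} (h : ∀ᵐ x ∂ν, p x) (n : ℕ) :
    ∀ᵐ z ∂(Measure.pi fun _ : Fin n => ν), ∀ j, p (z j) :=
  eventually_all.2 fun j => Measure.tendsto_eval_ae_ae.eventually h

/-- The operators `U t` act in Fock space as multiplication by `exp (i t (e(x₁) + ⋯ + e(xₙ)))`. -/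
def IsEnergyFlow (e : X → ℝ) (U : ℝ → (H ≃ₗᵢ[ℂ] H)) (J : H →ₗᵢ[ℂ] FockSpace ν) : Prop :=
  ∀ t x n, (J (U t x) n : (Fin n → X) → ℂ) =ᵐ[Measure.pi fun _ : Fin n => ν]
    fun z => cexp (I * (t * ∑ j, e (z j) : ℝ)) * (J x n : (Fin n → X) → ℂ) z

variable {U : ℝ → (H ≃ₗᵢ[ℂ] H)} {J : H →ₗᵢ[ℂ] FockSpace ν}

/-- The `n`-particle component of a vector. -/
def particleComp (J : H →ₗᵢ[ℂ] FockSpace ν) (n : ℕ) :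
    H →L[ℂ] Lp ℂ 2 (Measure.pi fun _ : Fin n => ν) :=
  (lp.evalCLM ℂ (fun n : ℕ => Lp ℂ 2 (Measure.pi fun _ : Fin n => ν)) 2 n).comp
    J.toContinuousLinearMap

omit [SigmaFinite ν] in
theorem particleComp_apply (J : H →ₗᵢ[ℂ] FockSpace ν) (n : ℕ) (x : H) :
    particleComp J n x = J x n := rfl

theorem measurable_sum_energy (he : Measurable e) (n : ℕ) :
    Measurable fun z : Fin n → X => ∑ j, e (z j) :=
  Finset.measurable_sum _ fun i _ => he.comp (measurable_pi_apply i)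

omit [SigmaFinite ν] in
theorem isEnergyFlow_of_dense (he : Measurable e) {D : Set H} (hD : Dense D)
    (h : ∀ t, ∀ x ∈ D, ∀ n, (J (U t x) n : (Fin n → X) → ℂ) =ᵐ[Measure.pi fun _ : Fin n => ν]
      fun z => cexp (I * (t * ∑ j, e (z j) : ℝ)) * (J x n : (Fin n → X) → ℂ) z) :
    IsEnergyFlow e U J := by
  intro t x n
  have hm := measurable_sum_energy he n
  have hq : Measurable fun z : Fin n → X => cexp (I * (t * ∑ j, e (z j) : ℝ)) := by fun_prop
  have h1 : ∀ z : Fin n → X, ‖cexp (I * (t * ∑ j, e (z j) : ℝ))‖ = 1 := fun z => norm_exp_I_mul _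
  have key : ∀ x, particleComp J n (U t x) = phaseMul hq h1 (particleComp J n x) := by
    intro x
    refine hD.induction (P := fun x => particleComp J n (U t x) =
      phaseMul hq h1 (particleComp J n x)) (fun x hx => ?_) ?_ x
    · refine Lp.ext ?_
      filter_upwards [h t x hx n, phaseMul_coe hq h1 (particleComp J n x)] with z z1 z2
      rw [z2, particleComp_apply, particleComp_apply, z1]
    · exact isClosed_eq ((particleComp J n).continuous.comp (U t).continuous)
        ((phaseMul hq h1).continuous.comp (particleComp J n).continuous)
  have := key x
  rw [particleComp_apply, particleComp_apply] at this
  rw [this]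
  exact phaseMul_coe hq h1 _

omit [SigmaFinite ν] in
theorem IsEnergyFlow.generator (hJ : IsEnergyFlow e U J) {x y : H} (hxy : GeneratorApply U x y)
    (n : ℕ) : (J y n : (Fin n → X) → ℂ) =ᵐ[Measure.pi fun _ : Fin n => ν]
      fun z => ((∑ j, e (z j) : ℝ) : ℂ) * (J x n : (Fin n → X) → ℂ) z := by
  have h2 : HasDerivAt (fun t => particleComp J n (U t x)) (I • particleComp J n y) 0 :=
    hasDerivAt_clm_smul (particleComp J n) hxy
  exact ae_eq_mul_of_hasDerivAt (S := fun z => ∑ j, e (z j))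
    (g := fun t => particleComp J n (U t x)) (f := particleComp J n x) (y := particleComp J n y)
    (fun t => hJ t x n) h2

/-- ⟨x, hx⟩ is the sum over n of the integrals of the total energy against |xₙ|². -/
theorem IsEnergyFlow.nonneg (hpos : ∀ᵐ x ∂ν, 0 < e x) (hJ : IsEnergyFlow e U J) {x y : H}
    (hxy : GeneratorApply U x y) : 0 ≤ (inner ℂ x y).re := by
  rw [← J.inner_map_map]
  have h1 := (lp.hasSum_inner (𝕜 := ℂ) (J x) (J y)).mapL reCLM
  rw [← reCLM_apply]
  refine h1.nonneg fun n => ?_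
  have h2 : inner ℂ (J x n) (J y n) = ((∫ z, (∑ j, e (z j)) * ‖(J x n : (Fin n → X) → ℂ) z‖ ^ 2
      ∂(Measure.pi fun _ : Fin n => ν) : ℝ) : ℂ) := by
    rw [L2.inner_def, ← integral_complex_ofReal]
    refine integral_congr_ae ?_
    filter_upwards [hJ.generator hxy n] with z hz
    rw [hz, RCLike.inner_apply, mul_assoc, RCLike.mul_conj]
    push_cast
    rfl
  rw [h2, reCLM_apply, ofReal_re]
  refine integral_nonneg_of_ae ?_
  filter_upwards [ae_forall_pi hpos n] with z hz
  exact mul_nonneg (Finset.sum_nonneg fun j _ => (hz j).le) (sq_nonneg _)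

/-- For n ≥ 1 the total energy is positive almost everywhere, so the generator can annihilate only
the vacuum component. -/
theorem IsEnergyFlow.eq_zero (hpos : ∀ᵐ x ∂ν, 0 < e x) (hJ : IsEnergyFlow e U J) {x : H}
    (hx : GeneratorApply U x 0) (h0 : J x 0 = 0) : x = 0 := by
  refine J.injective ?_
  rw [map_zero]
  ext1
  funext n
  cases n with
  | zero => exact h0
  | succ n =>
    rw [lp.coeFn_zero, Pi.zero_apply, Lp.eq_zero_iff_ae_eq_zero]
    have h1 := hJ.generator hx (n + 1)
    rw [map_zero, lp.coeFn_zero, Pi.zero_apply] at h1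
    filter_upwards [h1, ae_forall_pi hpos (n + 1), Lp.coeFn_zero ℂ 2
      (Measure.pi fun _ : Fin (n + 1) => ν)] with z z1 z2 z3
    rw [z3] at z1
    refine (mul_eq_zero.1 z1.symm).resolve_left ?_
    have : 0 < ∑ j, e (z j) := Finset.sum_pos (fun j _ => z2 j) Finset.univ_nonempty
    exact_mod_cast this.ne'

omit [SigmaFinite ν] in
theorem IsEnergyFlow.continuous_inner (he : Measurable e) (hJ : IsEnergyFlow e U J) (x : H) :
    Continuous fun t => inner ℂ x (U t x) := by
  have h1 : (fun t => inner ℂ x (U t x)) = fun t => ∑' n, inner ℂ (J x n) (J (U t x) n) := by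
    funext t
    rw [← J.inner_map_map, lp.inner_eq_tsum]
  rw [h1]
  have hs := lp.hasSum_norm (p := 2) (by norm_num) (J x)
  refine continuous_tsum (u := fun n => ‖J x n‖ ^ (2 : ENNReal).toReal) (fun n => ?_)
    hs.summable fun n t => ?_
  · have h2 : (fun t => inner ℂ (J x n) (J (U t x) n)) = fun t : ℝ =>
        ∫ z, inner ℂ ((J x n : (Fin n → X) → ℂ) z)
          (cexp (I * (t * ∑ j, e (z j) : ℝ)) * (J x n : (Fin n → X) → ℂ) z)
          ∂(Measure.pi fun _ : Fin n => ν) := by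
      funext t
      rw [L2.inner_def]
      refine integral_congr_ae ?_
      filter_upwards [hJ t x n] with z hz
      rw [hz]
    rw [h2]
    exact continuous_integral_phase (measurable_sum_energy he n) (J x n)
  · refine (norm_inner_le_norm _ _).trans ?_
    have h3 : ‖J (U t x) n‖ = ‖J x n‖ := by
      rw [Lp.norm_def, Lp.norm_def]
      congr 1
      refine eLpNorm_congr_norm_ae ?_
      filter_upwards [hJ t x n] with z hz
      rw [hz, norm_mul, norm_exp_I_mul, one_mul]
    rw [h3, ENNReal.toReal_ofNat, Real.rpow_two, pow_two]

/-- Weak continuity suffices: ‖U_s x - U_t x‖² = 2‖x‖² - 2 Re⟨x, U_{s-t} x⟩. -/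
theorem IsEnergyFlow.hasNonnegGenerator (he : Measurable e) (hpos : ∀ᵐ x ∂ν, 0 < e x)
    (hJ : IsEnergyFlow e U J) (h0 : U 0 = 1) (hadd : ∀ t s, U (t + s) = U t * U s) :
    HasNonnegGenerator U where
  map_zero := h0
  map_add := hadd
  nonneg _ _ hxy := hJ.nonneg hpos hxy
  continuous x := by
    refine continuous_iff_continuousAt.2 fun t => ?_
    have hU : ∀ s, ‖U s x - U t x‖ ^ 2 =
        2 * ‖x‖ ^ 2 - 2 * (inner ℂ x (U (s - t) x) : ℂ).re := by
      intro s
      have hs : U s x = U t (U (s - t) x) := by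
        change U s x = (U t * U (s - t)) x
        rw [← hadd, add_sub_cancel]
      rw [hs, ← map_sub, LinearIsometryEquiv.norm_map, @norm_sub_sq ℂ,
        LinearIsometryEquiv.norm_map, inner_re_symm]
      simp only [RCLike.re_eq_complex_re]
      ring
    have hc : Tendsto (fun s => ‖U s x - U t x‖ ^ 2) (𝓝 t) (𝓝 0) := by
      simp_rw [hU]
      have h1 : Continuous fun s : ℝ => 2 * ‖x‖ ^ 2 - 2 * (inner ℂ x (U (s - t) x) : ℂ).re :=
        continuous_const.sub (continuous_const.mul (continuous_re.comp
          ((hJ.continuous_inner he x).comp (continuous_id.sub continuous_const))))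
      have h2 := h1.tendsto t
      rw [sub_self, h0] at h2
      have h3 : (inner ℂ x ((1 : H ≃ₗᵢ[ℂ] H) x) : ℂ).re = ‖x‖ ^ 2 :=
        inner_self_eq_norm_sq (𝕜 := ℂ) x
      rwa [h3, sub_self] at h2
    refine tendsto_iff_norm_sub_tendsto_zero.2 ?_
    have h4 := (Real.continuous_sqrt.tendsto 0).comp hc
    simpa [Function.comp_def, Real.sqrt_sq (norm_nonneg _)] using h4

end Energy

/-! ### The vacuum as a ground state -/

section GroundStates

open Complex

variable {w : BdryAlgebra →ₗ[ℂ] ℂ} {H : Type*} [NormedAddCommGroup H] [InnerProductSpace ℂ H]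

theorem GNS.oneParticle_le (G : GNS w H) {M : Submodule ℂ H} (hM : IsClosed (M : Set H))
    (h : ∀ ψ, G.vec (gen ψ) ∈ M) : G.oneParticle ≤ M := by
  refine Submodule.topologicalClosure_minimal _ (Submodule.span_le.2 ?_) hM
  rintro _ ⟨ψ, rfl⟩
  exact h ψ

theorem GNS.vec_gen_mem_oneParticle (G : GNS w H) (ψ : bdrySpace) :
    G.vec (gen ψ) ∈ G.oneParticle :=
  Submodule.le_topologicalClosure _ (Submodule.subset_span ⟨ψ, rfl⟩)

theorem GNS.isClosed_oneParticle (G : GNS w H) : IsClosed (G.oneParticle : Set H) :=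
  Submodule.isClosed_topologicalClosure _

theorem GNS.Implements.map_oneParticle {G : GNS w H} {γ : BMSGroup} {V : H ≃ₗᵢ[ℂ] H}
    (hV : G.Implements (bmsRep γ) V) {x : H} (hx : x ∈ G.oneParticle) : V x ∈ G.oneParticle := by
  refine G.oneParticle_le (M := G.oneParticle.comap V.toLinearEquiv.toLinearMap)
    (G.isClosed_oneParticle.preimage V.continuous) (fun ψ => ?_) hx
  change V (G.vec (gen ψ)) ∈ G.oneParticle
  rw [hV.map_vec, bmsRep_gen]
  exact G.vec_gen_mem_oneParticle _

/-- Generators are self-adjoint, so exchanging them conjugates the two-point function; the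
commutation relations then fix its imaginary part for every normalized functional with a GNS
representation. -/
theorem GNS.two_mul_im_twoPoint (G : GNS w H) (h0 : w 1 = 1) (ψ φ : bdrySpace) :
    2 * (w (gen ψ * gen φ)).im = bdrySymp ψ φ := by
  have h : ∀ ψ φ, w (gen ψ * gen φ) = inner ℂ (G.vec (gen ψ)) (G.vec (gen φ)) := fun ψ φ => by
    rw [G.inner_vec, star_gen]
  have h1 := congrArg w (gen_comm ψ φ)
  have h2 : w (algebraMap ℂ BdryAlgebra (I * (bdrySymp ψ φ : ℂ))) = I * (bdrySymp ψ φ : ℂ) := by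
    rw [Algebra.algebraMap_eq_smul_one, map_smul, h0, smul_eq_mul, mul_one]
  have h4 : (w (gen φ * gen ψ)).im = -(w (gen ψ * gen φ)).im := by
    rw [h, h, ← inner_conj_symm, conj_im]
  rw [map_sub, h2] at h1
  have h5 := congrArg Complex.im h1
  rw [sub_im, h4] at h5
  simp at h5
  linarith

theorem uTranslation_zero : uTranslation 0 = 1 := by
  rw [← bms_one, uTranslation]
  congr 1

theorem uTranslation_add (t s : ℝ) : uTranslation (t + s) = uTranslation t * uTranslation s := by
  refine Subtype.ext (Equiv.ext fun p => Prod.ext ?_ ?_)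
  · change confFactor 1 p.2 * (p.1 + (t + s)) =
      confFactor 1 (sphereAct 1 p.2) * (confFactor 1 p.2 * (p.1 + s) + t)
    simp only [confFactor_one]
    ring
  · change sphereAct 1 p.2 = sphereAct 1 (sphereAct 1 p.2)
    simp only [sphereAct_one]

theorem fockState_translate (t : ℝ) (a : BdryAlgebra) (n : ℕ) :
    (fockState (bmsRep (uTranslation t) a) n : (Fin n → Scri) → ℂ)
      =ᵐ[Measure.pi fun _ : Fin n => momentumMeasure]
    fun z => cexp (I * (t * ∑ j, (z j).1 : ℝ)) * (fockState a n : (Fin n → Scri) → ℂ) z := by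
  have hA : ∀ ψ, waveMap (bmsAct (uTranslation t) ψ) =ᵐ[momentumMeasure]
      fun p => cexp (I * (p.1 * t : ℝ)) * waveMap ψ p := fun ψ => by
    rw [uTranslation, bmsAct_bms]
    exact waveMap_translate t ψ
  rw [fockState_bmsRep, fockState_apply, fockVec_apply, fockVec_apply]
  filter_upwards [fockComp_coe bdryBasis memLp_waveMap n
    (secondQuant bdryBasis (bmsAct (uTranslation t)) (fockRep a 1)),
    fockComp_coe bdryBasis memLp_waveMap n (fockRep a 1),
    amp_secondQuant bdryBasis hA n (fockRep a 1)] with z z1 z2 z3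
  rw [z1, z2, z3, ← Complex.exp_sum, mul_left_comm]
  congr 2
  rw [← Finset.mul_sum, ← ofReal_sum, ← Finset.sum_mul, mul_comm t]

theorem isEnergyFlow_translation {G : GNS bdryVacuum H} {U : ℝ → (H ≃ₗᵢ[ℂ] H)}
    (hU : ∀ t, G.Implements (bmsRep (uTranslation t)) (U t))
    {J : H →ₗᵢ[ℂ] FockSpace momentumMeasure} (hJ : ∀ a, J (G.vec a) = fockState a) :
    IsEnergyFlow Prod.fst U J := by
  refine isEnergyFlow_of_dense measurable_fst G.denseRange_vec ?_
  rintro t _ ⟨a, rfl⟩ n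
  rw [(hU t).map_vec, hJ, hJ]
  exact fockState_translate t a n

theorem vacuumComp_oneParticle {G : GNS bdryVacuum H} {J : H →ₗᵢ[ℂ] FockSpace momentumMeasure}
    (hJ : ∀ a, J (G.vec a) = fockState a) {x : H} (hx : x ∈ G.oneParticle) : J x 0 = 0 := by
  refine G.oneParticle_le (M := LinearMap.ker (particleComp J 0).toLinearMap)
    (particleComp J 0).isClosed_ker (fun ψ => ?_) hx
  change J (G.vec (gen ψ)) 0 = 0
  rw [hJ, fockState_apply, fockRep_gen, fockVec_apply]
  exact fockComp_fieldOp_one bdryBasis memLp_waveMap ψ 0 (by norm_num)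

/-- In every Bondi frame, the vacuum is a ground state without zero modes. -/
theorem groundState_frameTranslation [CompleteSpace H] (G : GNS bdryVacuum H)
    {V : BMSGroup →* (H ≃ₗᵢ[ℂ] H)} (hV : ∀ γ, G.Implements (bmsRep γ) (V γ)) (γ : BMSGroup) :
    HasNonnegGenerator (fun t => V (frameTranslation γ t)) ∧
      G.NoZeroMode (fun t => V (frameTranslation γ t)) := by
  obtain ⟨J, hJ⟩ := G.exists_linearIsometry fockState inner_fockState
  have hE : IsEnergyFlow Prod.fst (fun t => V (uTranslation t)) J :=
    isEnergyFlow_translation (fun t => hV (uTranslation t)) hJ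
  -- The flow of another frame is unitarily conjugate to the standard one, and V γ preserves the
  -- one-particle space.
  have hconj : (fun t => V (frameTranslation γ t)) =
      fun t => (V γ)⁻¹ * V (uTranslation t) * V γ := by
    funext t
    rw [frameTranslation, map_mul, map_mul, map_inv]
  rw [hconj]
  constructor
  · refine HasNonnegGenerator.conj (U := fun t => V (uTranslation t)) ?_ (V γ)
    refine hE.hasNonnegGenerator measurable_fst ae_pos_momentumMeasure ?_ fun t s => ?_
    · rw [uTranslation_zero, map_one]
    · rw [uTranslation_add, map_mul]
  · intro x hx hx0
    rw [generatorApply_conj_iff (fun t => V (uTranslation t)), map_zero] at hx0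
    have h1 := hE.eq_zero ae_pos_momentumMeasure hx0
      (vacuumComp_oneParticle hJ ((hV γ).map_oneParticle hx))
    exact (V γ).injective (h1.trans (map_zero _).symm)

instance : CompleteSpace (closedRange fockState) :=
  inferInstanceAs (CompleteSpace (LinearMap.range fockState).topologicalClosure)

theorem isGroundState_bdryVacuum (γ : BMSGroup) :
    IsGroundStateWithoutZeroModes bdryVacuum fun t => bmsRep (frameTranslation γ t) := by
  let G : GNS bdryVacuum (closedRange fockState) :=
    gnsOfInner (fun a => by rw [star_one, one_mul]) inner_fockState
  obtain ⟨V, hV, -⟩ := GNS.existsUnique_rep bmsRep bdryVacuum_bmsRep G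
  obtain ⟨h1, h2⟩ := groundState_frameTranslation G hV γ
  exact ⟨closedRange fockState, inferInstance, inferInstance, inferInstance, G,
    fun t => V (frameTranslation γ t), fun t => hV _, h1, h2⟩

/-- A quasi-free ground state without zero modes is determined by the dynamics. -/
theorem IsGroundStateWithoutZeroModes.unique {w w' : BdryAlgebra →ₗ[ℂ] ℂ} (h1 : w 1 = 1)
    (h1' : w' 1 = 1) (hw : IsQuasiFree w) (hw' : IsQuasiFree w') {g : ℝ → BMSGroup}
    (h : IsGroundStateWithoutZeroModes w fun t => bmsRep (g t))
    (h' : IsGroundStateWithoutZeroModes w' fun t => bmsRep (g t)) : w' = w := by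
  obtain ⟨H, _, _, _, G, U, hU, hpos, hzero⟩ := h
  obtain ⟨H', _, _, _, G', U', hU', hpos', hzero'⟩ := h'
  refine hw'.ext hw fun ψ φ => ?_
  have key := correlation_eq hpos hpos' G.oneParticle G.isClosed_oneParticle
    (fun t x hx => (hU t).map_oneParticle hx) hzero G'.oneParticle G'.isClosed_oneParticle
    (fun t x hx => (hU' t).map_oneParticle hx) hzero' (G.vec (gen ψ))
    -- Both correlations have imaginary part σ(ψ, A_{g(t)}φ)/2, so their difference is real.
    (G.vec_gen_mem_oneParticle φ) (G'.vec (gen ψ)) (G'.vec_gen_mem_oneParticle φ) fun t => by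
      have e1 := G.two_mul_im_twoPoint h1 ψ (bmsAct (g t) φ)
      have e2 := G'.two_mul_im_twoPoint h1' ψ (bmsAct (g t) φ)
      rw [(hU t).map_vec, (hU' t).map_vec, bmsRep_gen, G.inner_vec, G'.inner_vec, star_gen, sub_im]
      linarith
  rw [G.inner_vec, G'.inner_vec, star_gen] at key
  exact key.symm

end GroundStates

end NullInfinity

end

theorem mainTheorem7 :
    -- the representation `α` of the BMS group and the boundary state exist and are unique
    (∃! α : BMSGroup →* (BdryAlgebra ≃⋆ₐ[ℂ] BdryAlgebra), IsBMSRepresentation α) ∧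
    (∃! w : BdryAlgebra →ₗ[ℂ] ℂ, IsBdryState w) ∧
    ∀ (α : BMSGroup →* (BdryAlgebra ≃⋆ₐ[ℂ] BdryAlgebra)) (w : BdryAlgebra →ₗ[ℂ] ℂ),
      IsBMSRepresentation α → IsBdryState w →
      -- (a) invariance, and unitary implementation of `α` in every GNS representation
      ((∀ γ a, w (α γ a) = w a) ∧
        ∀ (H : Type*) [NormedAddCommGroup H] [InnerProductSpace ℂ H] [CompleteSpace H]
          (G : GNS w H), ∃! V : BMSGroup →* (H ≃ₗᵢ[ℂ] H), ∀ γ, G.Implements (α γ) (V γ)) ∧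
      -- (b) for every Bondi frame, the unitary group implementing the `u`-translations is
      -- strongly continuous with nonnegative generator
      (∀ (γ : BMSGroup) (H : Type*) [NormedAddCommGroup H] [InnerProductSpace ℂ H]
          [CompleteSpace H] (G : GNS w H),
        ∃ U : ℝ → (H ≃ₗᵢ[ℂ] H), HasNonnegGenerator U ∧
          ∀ U' : ℝ → (H ≃ₗᵢ[ℂ] H),
            (∀ t, G.Implements (α (frameTranslation γ t)) (U' t)) ↔ U' = U) ∧
      -- (c) for every fixed Bondi frame, `w` is the unique quasi-free state which is a ground state
      -- without zero modes for the `u`-translations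
      ∀ γ : BMSGroup,
        IsGroundStateWithoutZeroModes w (fun t => α (frameTranslation γ t)) ∧
          ∀ w' : BdryAlgebra →ₗ[ℂ] ℂ, IsState w' → IsQuasiFree w' →
            IsGroundStateWithoutZeroModes w' (fun t => α (frameTranslation γ t)) → w' = w := by
  refine ⟨⟨bmsRep, isBMSRepresentation_bmsRep, fun α hα => hα.eq_bmsRep⟩,
    ⟨bdryVacuum, isBdryState_bdryVacuum, fun w hw => hw.eq_bdryVacuum⟩, ?_⟩
  intro α w hα hw
  obtain rfl := hα.eq_bmsRep
  obtain rfl := hw.eq_bdryVacuum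
  refine ⟨⟨bdryVacuum_bmsRep, ?_⟩, ?_, fun γ => ⟨isGroundState_bdryVacuum γ, ?_⟩⟩
  · intro H _ _ _ G
    exact G.existsUnique_rep bmsRep bdryVacuum_bmsRep
  · intro γ H _ _ _ G
    obtain ⟨V, hV, -⟩ := G.existsUnique_rep bmsRep bdryVacuum_bmsRep
    refine ⟨fun t => V (frameTranslation γ t), (groundState_frameTranslation G hV γ).1,
      fun U' => ⟨fun h => funext fun t => GNS.implements_unique (h t) (hV _), ?_⟩⟩
    rintro rfl t
    exact hV _
  · intro w' hs hq hg
    exact IsGroundStateWithoutZeroModes.unique bdryVacuum_one hs.map_one isQuasiFree_bdryVacuum hq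
      (isGroundState_bdryVacuum γ) hg
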